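/- **Setting.** Let $U\subset\mathbb R^n$ be a coordinate domain of the $n$-dimensional spacetime over which the principal $G$-bundle $P$ is trivialised (the operator $K$ and $K$-sequences exist only over such a domain; a theory on the whole spacetime is restricted to it). Let $Y$ be a graded gauge natural bundle over $U$ with fibre coordinates $u^a$ of ghost degree $d(u^a)$, the fibre being a graded vector space, and let $\Omega_{loc}^{p,q,r}(Y)$ be the variational tricomplex of local forms on $U\times\Gamma(Y)$ (horizontal degree $p$, vertical degree $q$, ghost number $r$), with differentials $d_h$, $d_v$; write $\alpha\simeq0$ if $\alpha$ is $d_h$-exact. For a vertical local vector field $\Xi$ of degree $d(\Xi)$ let $\mathrm{Lie}_\Xi=\iota_\Xi d_v+(-1)^{d(\Xi)}d_v\iota_\Xi$. Let a $QKG^\star$-structure be given: a vertical local vector field $Q$ of degree $1$ with $Q^2=0$ and vertical local vector fields $K_\Xi$ of degree $-1$, linear in the $G$-invariant vector field $\Xi$ on $P|_U$, with $[K_{\Xi_1},K_{\Xi_2}]=0$, $[\Xi_1,K_{\Xi_2}]=K_{[\Xi_1,\Xi_2]}$, $[Q,K_\Xi]=\Xi$, where $\Xi$ acts on sections by the Lie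 derivative and the bracket on invariant vector fields is that of the Lie algebra of $\mathrm{Aut}(P)$. For a section $\lambda$ of $\mathrm{ad}P$ let $I_\lambda=K_\lambda$ and let $\delta_\lambda$ be the gauge transformation. A local form $\alpha$ is called *basic* if $\mathrm{Lie}_{I_\lambda}\alpha\simeq0$ and $\mathrm{Lie}_{\delta_\lambda}\alpha\simeq0$ for all $\lambda$, and *$x$-independent* if $\mathrm{Lie}_{\partial_\mu}\alpha=0$ for all $\mu$. Put $K=dx^\mu\wedge \mathrm{Lie}_{K_{\partial_\mu}}$. Let $0\le m\le n$. An *$m$-extended BV-BFV theory* on a graded bundle consists of a vertical local vector field $Q$ of degree $1$ with $Q^2=0$ and local forms $\mathcal L^{(p)}$ of degree $(n-p,0,p)$ and $\gamma^{(p)}$ of degree $(n-p,1,p-1)$, $0\le p\le n$, with $\gamma^{(p)}=0$ for $p>m$, such that $\omega^{(0)}$ is a BV symplectic local form, where $\omega^{(p)}=d_v\gamma^{(p)}$, $\mathrm{Lie}_Q\mathcal L^{(0)}\simeq0$, $\mathrm{Lie}_Q\omega^{(p)}+d_h\omega^{(p+1)}=0$ and $\iota_Q\omega^{(p)}=d_v\mathcal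 L^{(p)}+d_h\gamma^{(p+1)}$ for $0\le p\le n$ (terms of index $n+1$ are zero). Its BV-BFV difference is $\Delta^{(p)}=\mathcal L^{(p)}-\iota_Q\gamma^{(p)}$. It is *of CohLGFT type* (over the given $QKG^\star$-structure) if it lives on $Y_{ct}=V^*[-1]Y$, with antifields $\Phi^+_a$, and for some Riemannian metric $g$: $\gamma^{(0)}=\gamma_{ct}=\Phi_a^+\delta\Phi^a\wedge d\mathrm{vol}_g$; its vector field is $Q_{BV}=Q_{cl}+Q_{\mathcal L_{BRST}}$, with $Q_{cl}$ the cotangent lift of $Q$ and $Q_{\mathcal L_{BRST}}$ the vector field whose contraction with $d_v\gamma_{ct}$ is the Euler–Lagrange form of $\mathcal L_{BRST}$; $\mathcal L^{(0)}=\mathcal L_{BRST}+\iota_{Q_{BV}}\gamma_{ct}$, where $\mathcal L_{BRST}\in\Omega_{loc}^{n,0,0}(Y)$ has $Q$ and all $I_\lambda$, $\delta_\lambda$ as Noether symmetries; and all $\Delta^{(p)}$ are basic local forms on $U\times\Gamma(Y)$. An *$f$-transformation* $P_f$ is given by basic local forms $f^{(p)}\in\Omega^{n-p,0,p-1}_{loc}(Y)$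 with $f^{(p)}=0$ for $p>m$; it replaces $\mathcal L^{(p)}$ by $\mathcal L^{(p)}+d_hf^{(p+1)}$ and $\gamma^{(p)}$ by $\gamma^{(p)}-d_vf^{(p)}$. The *general $K$-sequence* of an $x$-independent $\Delta^{(m)}$ given by $Q$-closed, $x$-independent, basic forms $W^{(q)}\in\Omega_{loc}^{n-m+q,0,m-q}(Y)$, $1\le q\le m$, is $$\mathcal O^{(p)}=\frac{K^p}{p!}\Delta^{(m)}+\sum_{q=1}^p\frac{K^{p-q}}{(p-q)!}W^{(q)},\qquad 0\le p\le m .$$ **Theorem.** Let an $m$-extended BV-BFV theory of CohLGFT type with difference $\Delta^{(p)}$ be given. 1. For every $f$-transformation $P_f$, the transformed data are again an $m$-extended BV-BFV theory with the same vector field, and $P_f(\sum_p\Delta^{(p)})=\sum_p\Delta^{(p)}+(\mathrm{Lie}_Q+d_h)\sum_pf^{(p)}$. 2. Suppose that the difference is invariant in the sense that $\Delta^{(m)}$ is $x$-independent and, after some $f$-transformation that leaves $\Delta^{(m)}$ unchanged, all members of the difference are $x$-independent. Then there are a general $K$-sequence $\{\mathcal O^{(p)}\}$ of $\Delta^{(m)}$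 and an $f$-transformation $P_f$ with $P_f(\Delta^{(m-p)})=\mathcal O^{(p)}$ for $0\le p\le m$. 3. The difference is determined by this $K$-sequence up to an $f$-transformation: if two $m$-extended theories of CohLGFT type over the same $QKG^\star$-structure are represented, as in 2, by general $K$-sequences with data $(\Delta^{(m)},W^{(q)})$ and $(\Delta'^{(m)},W'^{(q)})$, and these data coincide, or more generally differ by terms $\mathrm{Lie}_Qh^{(q)}$, $0\le q\le m$, with basic $x$-independent $h^{(q)}\in\Omega_{loc}^{n-m+q,0,m-q-1}(Y)$, then there is an $f$-transformation with $\Delta'^{(p)}=P_{f}(\Delta^{(p)})$ for all $p$. -/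

import Mathlib

open scoped ContDiff
open TopologicalSpace

noncomputable section

namespace BVBFV

/-! ### Local functions -/

/-- A finite family of field coordinates `u^a`, each with its ghost degree. -/
structure Fields where
  Idx : Type
  [fin : Fintype Idx]
  [dec : DecidableEq Idx]
  deg : Idx → ℤ

attribute [instance] Fields.fin Fields.dec

/-- The empty family of fields. -/
def Fields.empty : Fields where
  Idx := Empty
  deg := fun a => a.elim

/-- The fields of the shifted vertical cotangent bundle: `Φ^a` (left summand) together with the
antifields `Φ^+_a` (right summand), of degree `-1 - d(Φ^a)`. -/
def Fields.ct (F : Fields) : Fields where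
  Idx := F.Idx ⊕ F.Idx
  deg := Sum.elim F.deg (fun a => -1 - F.deg a)

/-- A degree preserving inclusion of field coordinates. -/
structure Fields.Hom (F F' : Fields) where
  toFun : F.Idx → F'.Idx
  deg_eq : ∀ a, F'.deg (toFun a) = F.deg a

def Fields.emptyHom (F : Fields) : Fields.Hom Fields.empty F where
  toFun := fun a => Empty.elim a
  deg_eq := fun a => Empty.elim a

def Fields.ctHom (F : Fields) : Fields.Hom F F.ct where
  toFun := Sum.inl
  deg_eq := fun _ => rfl

variable {n : ℕ}

/-- Jet coordinates `u^a_I`, where `I` is a symmetric multi-index. -/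
abbrev Jet (n : ℕ) (F : Fields) : Type := F.Idx × (Fin n → ℕ)

/-- Jet coordinates of the fields of degree zero. -/
abbrev Jet0 (n : ℕ) (F : Fields) : Type := {j : Jet n F // F.deg j.1 = 0}

/-- The jet coordinate `u^a_{I ∪ {μ}}`. -/
def Jet.succ {F : Fields} (μ : Fin n) (j : Jet n F) : Jet n F := (j.1, j.2 + Pi.single μ 1)

abbrev JetPt (U : Opens (Fin n → ℝ)) (F : Fields) : Type := U × (Jet0 n F → ℝ)

/-- Smooth functions of `x ∈ U` and of finitely many jet coordinates of degree zero. -/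
def IsLocal (U : Opens (Fin n → ℝ)) (F : Fields) (f : JetPt U F → ℝ) : Prop :=
  ∃ (s : Finset (Jet0 n F)) (g : (Fin n → ℝ) × (s → ℝ) → ℝ),
    ContDiffOn ℝ ∞ g ((U : Set (Fin n → ℝ)) ×ˢ Set.univ) ∧
      ∀ p, f p = g (p.1, fun j => p.2 j)

variable {U : Opens (Fin n → ℝ)} {F : Fields}

lemma IsLocal.enlarge {f : JetPt U F → ℝ} {s t : Finset (Jet0 n F)} (hst : s ⊆ t)
    {g : (Fin n → ℝ) × (s → ℝ) → ℝ}
    (hg : ContDiffOn ℝ ∞ g ((U : Set (Fin n → ℝ)) ×ˢ Set.univ))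
    (hf : ∀ p, f p = g (p.1, fun j => p.2 j)) :
    ∃ g' : (Fin n → ℝ) × (t → ℝ) → ℝ,
      ContDiffOn ℝ ∞ g' ((U : Set (Fin n → ℝ)) ×ˢ Set.univ) ∧
        ∀ p, f p = g' (p.1, fun j => p.2 j) := by
  refine ⟨fun q => g (q.1, fun j => q.2 ⟨j, hst j.2⟩), ?_, fun p => hf p⟩
  refine hg.comp (t := (U : Set (Fin n → ℝ)) ×ˢ Set.univ) ?_ ?_
  · apply ContDiff.contDiffOn
    fun_prop
  · rintro q ⟨h1, -⟩
    exact ⟨h1, trivial⟩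

lemma IsLocal.comp₂ {f f' : JetPt U F → ℝ} (hf : IsLocal U F f) (hf' : IsLocal U F f')
    (op : ℝ → ℝ → ℝ) (hop : ContDiff ℝ ∞ (fun p : ℝ × ℝ => op p.1 p.2)) :
    IsLocal U F (fun p => op (f p) (f' p)) := by
  classical
  obtain ⟨s, g, hg, hfg⟩ := hf
  obtain ⟨t, g', hg', hfg'⟩ := hf'
  obtain ⟨g1, hg1, h1⟩ := IsLocal.enlarge (Finset.subset_union_left (s₁ := s) (s₂ := t)) hg hfg
  obtain ⟨g2, hg2, h2⟩ := IsLocal.enlarge (Finset.subset_union_right (s₁ := s) (s₂ := t)) hg' hfg'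
  refine ⟨s ∪ t, fun q => op (g1 q) (g2 q), ?_, fun p => by simp only [h1, h2]⟩
  exact hop.comp_contDiffOn (hg1.prodMk hg2)

lemma IsLocal.const (c : ℝ) : IsLocal U F (fun _ => c) :=
  ⟨∅, fun _ => c, contDiffOn_const, fun _ => rfl⟩

variable (U F) in
/-- The algebra of local functions of `x` and of the jets of the fields of degree zero. -/
def LocFn : Subalgebra ℝ (JetPt U F → ℝ) where
  carrier := {f | IsLocal U F f}
  mul_mem' := fun ha hb => IsLocal.comp₂ ha hb (fun x y => x * y) (by fun_prop)
  add_mem' := fun ha hb => IsLocal.comp₂ ha hb (fun x y => x + y) (by fun_prop)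
  algebraMap_mem' := fun r => IsLocal.const r

/-- The jet coordinate `u^a_I` of a field of degree zero. -/
def coordFn (j : Jet0 n F) : LocFn U F :=
  ⟨fun p => p.2 j, {j}, fun q => q.2 ⟨j, Finset.mem_singleton_self j⟩,
    ContDiff.contDiffOn (by fun_prop), fun _ => rfl⟩

open Classical in
/-- The explicit partial derivative `∂/∂x^μ` (`U` is open, so only values of `f` matter). -/
def pdxFun (μ : Fin n) (f : JetPt U F → ℝ) (p : JetPt U F) : ℝ :=
  deriv (fun t : ℝ => if h : (p.1 : Fin n → ℝ) + t • (Pi.single μ (1 : ℝ) : Fin n → ℝ) ∈ U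
    then f (⟨_, h⟩, p.2) else 0) 0

open Classical in
/-- The partial derivative `∂/∂u^a_I` for a field of degree zero. -/
def pduFun (j : Jet0 n F) (f : JetPt U F → ℝ) (p : JetPt U F) : ℝ :=
  deriv (fun t : ℝ => f (p.1, Function.update p.2 j t)) (p.2 j)

open Classical in
lemma hasDerivAt_pdx (μ : Fin n) {f : JetPt U F → ℝ} {s : Finset (Jet0 n F)}
    {g : (Fin n → ℝ) × (s → ℝ) → ℝ}
    (hg : ContDiffOn ℝ ∞ g ((U : Set (Fin n → ℝ)) ×ˢ Set.univ))
    (hf : ∀ p, f p = g (p.1, fun j => p.2 j)) (p : JetPt U F) :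
    HasDerivAt (fun t : ℝ => if h : (p.1 : Fin n → ℝ) + t • (Pi.single μ 1 : Fin n → ℝ) ∈ U
      then f (⟨_, h⟩, p.2) else 0)
      (fderiv ℝ g ((p.1 : Fin n → ℝ), fun j => p.2 j) (Pi.single μ 1, 0)) 0 := by
  have hopen : IsOpen ((U : Set (Fin n → ℝ)) ×ˢ (Set.univ : Set (s → ℝ))) :=
    U.isOpen.prod isOpen_univ
  have hmem : ((p.1 : Fin n → ℝ), fun j : s => p.2 j) ∈
      ((U : Set (Fin n → ℝ)) ×ˢ (Set.univ : Set (s → ℝ))) := ⟨p.1.2, trivial⟩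
  have hd : DifferentiableAt ℝ g ((p.1 : Fin n → ℝ), fun j : s => p.2 j) :=
    (hg.contDiffAt (hopen.mem_nhds hmem)).differentiableAt (by simp)
  have hline : HasDerivAt (fun t : ℝ => ((p.1 : Fin n → ℝ) + t • (Pi.single μ 1 : Fin n → ℝ),
      (fun j : s => p.2 j))) ((Pi.single μ 1 : Fin n → ℝ), (0 : s → ℝ)) 0 := by
    refine HasDerivAt.prodMk ?_ (hasDerivAt_const _ _)
    simpa using ((hasDerivAt_id (0 : ℝ)).smul_const (Pi.single μ 1 : Fin n → ℝ)).const_add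
      (p.1 : Fin n → ℝ)
  have hcomp : HasDerivAt (fun t : ℝ => g ((p.1 : Fin n → ℝ) + t • (Pi.single μ 1 : Fin n → ℝ),
      (fun j : s => p.2 j)))
      (fderiv ℝ g ((p.1 : Fin n → ℝ), fun j => p.2 j) (Pi.single μ 1, 0)) 0 := by
    refine HasFDerivAt.comp_hasDerivAt (0 : ℝ) ?_ hline
    simpa using hd.hasFDerivAt
  refine hcomp.congr_of_eventuallyEq ?_
  have hc : Continuous (fun t : ℝ => (p.1 : Fin n → ℝ) + t • (Pi.single μ 1 : Fin n → ℝ)) := by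
    fun_prop
  have : ∀ᶠ t in nhds (0 : ℝ), (p.1 : Fin n → ℝ) + t • (Pi.single μ 1 : Fin n → ℝ) ∈ U :=
    hc.continuousAt.eventually_mem (U.isOpen.mem_nhds (by simp))
  filter_upwards [this] with t ht
  rw [dif_pos ht, hf]

open Classical in
lemma hasDerivAt_pdu (j : Jet0 n F) {f : JetPt U F → ℝ} {s : Finset (Jet0 n F)}
    {g : (Fin n → ℝ) × (s → ℝ) → ℝ}
    (hg : ContDiffOn ℝ ∞ g ((U : Set (Fin n → ℝ)) ×ˢ Set.univ))
    (hf : ∀ p, f p = g (p.1, fun j => p.2 j)) (p : JetPt U F) :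
    HasDerivAt (fun t : ℝ => f (p.1, Function.update p.2 j t))
      (fderiv ℝ g ((p.1 : Fin n → ℝ), fun i => p.2 i)
        (0, fun i => if (i : Jet0 n F) = j then 1 else 0)) (p.2 j) := by
  have hopen : IsOpen ((U : Set (Fin n → ℝ)) ×ˢ (Set.univ : Set (s → ℝ))) :=
    U.isOpen.prod isOpen_univ
  have hmem : ((p.1 : Fin n → ℝ), fun j : s => p.2 j) ∈
      ((U : Set (Fin n → ℝ)) ×ˢ (Set.univ : Set (s → ℝ))) := ⟨p.1.2, trivial⟩
  have hd : DifferentiableAt ℝ g ((p.1 : Fin n → ℝ), fun j : s => p.2 j) :=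
    (hg.contDiffAt (hopen.mem_nhds hmem)).differentiableAt (by simp)
  have hline : HasDerivAt (fun t : ℝ => ((p.1 : Fin n → ℝ),
      (fun i : s => Function.update p.2 j t i)))
      ((0 : Fin n → ℝ), fun i : s => if (i : Jet0 n F) = j then (1 : ℝ) else 0) (p.2 j) := by
    refine HasDerivAt.prodMk (hasDerivAt_const _ _) ?_
    rw [hasDerivAt_pi]
    intro i
    by_cases hi : (i : Jet0 n F) = j
    · simp only [hi, Function.update_self, if_true]
      exact hasDerivAt_id _
    · simp only [Function.update_of_ne hi, if_neg hi]
      exact hasDerivAt_const _ _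
  have : HasDerivAt (fun t : ℝ => g ((p.1 : Fin n → ℝ),
      (fun i : s => Function.update p.2 j t i)))
      (fderiv ℝ g ((p.1 : Fin n → ℝ), fun i => p.2 i)
        (0, fun i => if (i : Jet0 n F) = j then 1 else 0)) (p.2 j) := by
    refine HasFDerivAt.comp_hasDerivAt (p.2 j) ?_ hline
    simpa using hd.hasFDerivAt
  simpa only [hf] using this

lemma isLocal_fderiv {s : Finset (Jet0 n F)} {g : (Fin n → ℝ) × (s → ℝ) → ℝ}
    (hg : ContDiffOn ℝ ∞ g ((U : Set (Fin n → ℝ)) ×ˢ Set.univ))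
    (v : (Fin n → ℝ) × (s → ℝ)) :
    IsLocal U F (fun p => fderiv ℝ g ((p.1 : Fin n → ℝ), fun j => p.2 j) v) :=
  ⟨s, fun q => fderiv ℝ g q v,
    (hg.fderiv_of_isOpen (U.isOpen.prod isOpen_univ) (by simp)).clm_apply contDiffOn_const,
    fun _ => rfl⟩

lemma isLocal_pdx (μ : Fin n) {f : JetPt U F → ℝ} (hf : IsLocal U F f) :
    IsLocal U F (pdxFun μ f) := by
  classical
  obtain ⟨s, g, hg, hfg⟩ := hf
  have : pdxFun μ f = fun p => fderiv ℝ g ((p.1 : Fin n → ℝ), fun j => p.2 j)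
      (Pi.single μ 1, 0) := by
    funext p
    exact (hasDerivAt_pdx μ hg hfg p).deriv
  rw [this]
  exact isLocal_fderiv hg _

lemma isLocal_pdu (j : Jet0 n F) {f : JetPt U F → ℝ} (hf : IsLocal U F f) :
    IsLocal U F (pduFun j f) := by
  classical
  obtain ⟨s, g, hg, hfg⟩ := hf
  have : pduFun j f = fun p => fderiv ℝ g ((p.1 : Fin n → ℝ), fun j => p.2 j)
      (0, fun i => if (i : Jet0 n F) = j then 1 else 0) := by
    funext p
    exact (hasDerivAt_pdu j hg hfg p).deriv
  rw [this]
  exact isLocal_fderiv hg _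

/-- `∂/∂x^μ` on local functions. -/
def pdx (μ : Fin n) (f : LocFn U F) : LocFn U F := ⟨pdxFun μ f.1, isLocal_pdx μ f.2⟩

/-- `∂/∂u^a_I` on local functions. -/
def pdu (j : Jet0 n F) (f : LocFn U F) : LocFn U F := ⟨pduFun j f.1, isLocal_pdu j f.2⟩

open Classical in
lemma differentiable_pdx (μ : Fin n) (f : LocFn U F) (p : JetPt U F) :
    DifferentiableAt ℝ (fun t : ℝ =>
      if h : (p.1 : Fin n → ℝ) + t • (Pi.single μ 1 : Fin n → ℝ) ∈ U
      then f.1 (⟨_, h⟩, p.2) else 0) 0 := by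
  obtain ⟨s, g, hg, hfg⟩ := f.2
  exact (hasDerivAt_pdx μ hg hfg p).differentiableAt

open Classical in
lemma differentiable_pdu (j : Jet0 n F) (f : LocFn U F) (p : JetPt U F) :
    DifferentiableAt ℝ (fun t : ℝ => f.1 (p.1, Function.update p.2 j t)) (p.2 j) := by
  obtain ⟨s, g, hg, hfg⟩ := f.2
  exact (hasDerivAt_pdu j hg hfg p).differentiableAt

lemma pdx_add (μ : Fin n) (f g : LocFn U F) : pdx μ (f + g) = pdx μ f + pdx μ g := by
  classical
  apply Subtype.ext
  funext p
  refine Eq.trans ?_ (deriv_add (differentiable_pdx μ f p) (differentiable_pdx μ g p))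
  simp only [pdx, pdxFun]
  congr 1
  funext t
  by_cases h : (p.1 : Fin n → ℝ) + t • (Pi.single μ 1 : Fin n → ℝ) ∈ U <;> simp [h]

lemma pdx_mul (μ : Fin n) (f g : LocFn U F) : pdx μ (f * g) = pdx μ f * g + f * pdx μ g := by
  classical
  apply Subtype.ext
  funext p
  refine Eq.trans ?_ ((deriv_mul (differentiable_pdx μ f p) (differentiable_pdx μ g p)).trans ?_)
  · simp only [pdx, pdxFun]
    congr 1
    funext t
    by_cases h : (p.1 : Fin n → ℝ) + t • (Pi.single μ 1 : Fin n → ℝ) ∈ U <;> simp [h]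
  · have h0 : (p.1 : Fin n → ℝ) + (0 : ℝ) • (Pi.single μ 1 : Fin n → ℝ) ∈ U := by simp
    have e : (⟨_, h0⟩ : U) = p.1 := by ext1; simp
    rw [dif_pos h0, dif_pos h0, e]
    rfl

lemma pdx_algebraMap (μ : Fin n) (r : ℝ) : pdx μ (algebraMap ℝ (LocFn U F) r) = 0 := by
  classical
  apply Subtype.ext
  funext p
  have := (hasDerivAt_pdx (U := U) (F := F) μ (s := ∅) (g := fun _ => r) (f := fun _ => r)
    contDiffOn_const (fun _ => rfl) p).deriv
  refine Eq.trans this ?_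
  simp

lemma pdu_add (j : Jet0 n F) (f g : LocFn U F) : pdu j (f + g) = pdu j f + pdu j g := by
  classical
  apply Subtype.ext
  funext p
  exact deriv_add (differentiable_pdu j f p) (differentiable_pdu j g p)

lemma pdu_mul (j : Jet0 n F) (f g : LocFn U F) : pdu j (f * g) = pdu j f * g + f * pdu j g := by
  classical
  apply Subtype.ext
  funext p
  refine (deriv_mul (differentiable_pdu j f p) (differentiable_pdu j g p)).trans ?_
  rw [Function.update_eq_self]
  rfl

lemma pdu_algebraMap (j : Jet0 n F) (r : ℝ) : pdu j (algebraMap ℝ (LocFn U F) r) = 0 := by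
  apply Subtype.ext
  funext p
  exact deriv_const _ _

lemma pdu_finite (f : LocFn U F) : {j | pdu j f ≠ 0}.Finite := by
  classical
  obtain ⟨s, g, hg, hfg⟩ := f.2
  refine s.finite_toSet.subset ?_
  intro j hj
  by_contra hjs
  apply hj
  apply Subtype.ext
  funext p
  refine Eq.trans (hasDerivAt_pdu j hg hfg p).deriv ?_
  have : (fun i : s => if (i : Jet0 n F) = j then (1 : ℝ) else 0) = 0 := by
    funext i
    have : (i : Jet0 n F) ≠ j := fun h => hjs (h ▸ i.2)
    simp [this]
  rw [this]
  exact map_zero _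

/-! ### The graded commutative algebra of vertical forms -/

variable (U F) in
/-- Generators of the algebra of vertical local forms: local functions of `x` and of the jets of
degree zero, the jet coordinates of nonzero degree, and the vertical differentials `δu^a_I`. -/
inductive Gen
  | fn (f : LocFn U F)
  | u (j : Jet n F) (h : F.deg j.1 ≠ 0)
  | du (j : Jet n F)

/-- Vertical form degree. -/
def Gen.vdeg : Gen U F → ℤ
  | .fn _ => 0
  | .u _ _ => 0
  | .du _ => 1

/-- Ghost number. -/
def Gen.gdeg : Gen U F → ℤ
  | .fn _ => 0
  | .u j _ => F.deg j.1
  | .du j => F.deg j.1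

/-- The degree that governs the signs: vertical form degree plus ghost number. -/
def Gen.par (g : Gen U F) : ℤ := g.vdeg + g.gdeg

/-- The sign `(-1)^k`. -/
def sg (k : ℤ) : ℝ := (-1 : ℝ) ^ k

lemma sg_add (k l : ℤ) : sg (k + l) = sg k * sg l := zpow_add₀ (by norm_num) k l

@[simp] lemma sg_zero : sg 0 = 1 := zpow_zero _

lemma sg_mul_self (k : ℤ) : sg k * sg k = 1 := by
  rw [sg, ← mul_zpow]; norm_num

lemma sg_even {k : ℤ} (h : Even k) : sg k = 1 := h.neg_one_zpow

variable (U F) in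
/-- Sums, products and constants of local functions are those of `LocFn`, and generators commute
up to the sign of their degrees. -/
inductive Rel : FreeAlgebra ℝ (Gen U F) → FreeAlgebra ℝ (Gen U F) → Prop
  | add (f g : LocFn U F) : Rel (FreeAlgebra.ι ℝ (.fn (f + g)))
      (FreeAlgebra.ι ℝ (.fn f) + FreeAlgebra.ι ℝ (.fn g))
  | mul (f g : LocFn U F) : Rel (FreeAlgebra.ι ℝ (.fn (f * g)))
      (FreeAlgebra.ι ℝ (.fn f) * FreeAlgebra.ι ℝ (.fn g))
  | const (r : ℝ) : Rel (FreeAlgebra.ι ℝ (.fn (algebraMap ℝ (LocFn U F) r)))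
      (algebraMap ℝ (FreeAlgebra ℝ (Gen U F)) r)
  | comm (g h : Gen U F) : Rel (FreeAlgebra.ι ℝ g * FreeAlgebra.ι ℝ h)
      (sg (g.par * h.par) • (FreeAlgebra.ι ℝ h * FreeAlgebra.ι ℝ g))

variable (U F) in
/-- Vertical local forms (all vertical degrees and ghost numbers, horizontal degree zero): the free
graded commutative algebra over the local functions of degree-zero jets. -/
abbrev Alg : Type := RingQuot (Rel U F)

/-- A generator as an element of the algebra. -/
def gen (g : Gen U F) : Alg U F := RingQuot.mkAlgHom ℝ (Rel U F) (FreeAlgebra.ι ℝ g)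

/-- A local function as an element of the algebra. -/
def fn (f : LocFn U F) : Alg U F := gen (.fn f)

lemma fn_add (f g : LocFn U F) : fn (f + g) = fn f + fn g := by
  simpa [fn, gen] using RingQuot.mkAlgHom_rel ℝ (Rel.add f g)

lemma fn_mul (f g : LocFn U F) : fn (f * g) = fn f * fn g := by
  simpa [fn, gen] using RingQuot.mkAlgHom_rel ℝ (Rel.mul f g)

lemma fn_const (r : ℝ) : fn (algebraMap ℝ (LocFn U F) r) = algebraMap ℝ (Alg U F) r := by
  simpa [fn, gen] using RingQuot.mkAlgHom_rel ℝ (Rel.const (U := U) (F := F) r)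

lemma fn_zero : fn (0 : LocFn U F) = 0 := by
  simpa using fn_const (U := U) (F := F) 0

lemma gen_comm (g h : Gen U F) : gen g * gen h = sg (g.par * h.par) • (gen h * gen g) := by
  simpa [gen] using RingQuot.mkAlgHom_rel ℝ (Rel.comm g h)

section lift
variable {B : Type} [Ring B] [Algebra ℝ B]

/-- Algebra homomorphisms out of `Alg` are given by images of generators that respect the
relations. -/
def liftAlg (φ : Gen U F → B)
    (hadd : ∀ f g, φ (.fn (f + g)) = φ (.fn f) + φ (.fn g))
    (hmul : ∀ f g, φ (.fn (f * g)) = φ (.fn f) * φ (.fn g))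
    (hconst : ∀ r, φ (.fn (algebraMap ℝ _ r)) = algebraMap ℝ B r)
    (hcomm : ∀ g h, φ g * φ h = sg (g.par * h.par) • (φ h * φ g)) : Alg U F →ₐ[ℝ] B :=
  RingQuot.liftAlgHom ℝ ⟨FreeAlgebra.lift ℝ φ, by
    intro x y h
    induction h with
    | add f g => simp [hadd]
    | mul f g => simp [hmul]
    | const r => simp [hconst]
    | comm g h => simpa using hcomm g h⟩

lemma liftAlg_gen (φ : Gen U F → B) (hadd hmul hconst hcomm) (g : Gen U F) :
    liftAlg φ hadd hmul hconst hcomm (gen g) = φ g := by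
  simp [liftAlg, gen]

end lift

lemma alg_induction {P : Alg U F → Prop} (hgen : ∀ g, P (gen g))
    (hconst : ∀ r, P (algebraMap ℝ _ r)) (hadd : ∀ a b, P a → P b → P (a + b))
    (hmul : ∀ a b, P a → P b → P (a * b)) (a : Alg U F) : P a := by
  obtain ⟨x, rfl⟩ := RingQuot.mkAlgHom_surjective ℝ (Rel U F) a
  induction x using FreeAlgebra.induction with
  | grade0 r => rw [AlgHom.commutes]; exact hconst r
  | grade1 g => exact hgen g
  | mul a b ha hb => rw [map_mul]; exact hmul _ _ ha hb
  | add a b ha hb => rw [map_add]; exact hadd _ _ ha hb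

/-- The automorphism that multiplies an element of degree `i` by `(-1)^(k i)`. -/
def twist (k : ℤ) : Alg U F →ₐ[ℝ] Alg U F :=
  liftAlg (fun g => sg (k * g.par) • gen g)
    (by intro f g; simp only [Gen.par, Gen.vdeg, Gen.gdeg, add_zero, mul_zero, sg_zero, one_smul]
        exact fn_add f g)
    (by intro f g; simp only [Gen.par, Gen.vdeg, Gen.gdeg, add_zero, mul_zero, sg_zero, one_smul]
        exact fn_mul f g)
    (by intro r; simp only [Gen.par, Gen.vdeg, Gen.gdeg, add_zero, mul_zero, sg_zero, one_smul]
        exact fn_const r)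
    (by intro g h
        simp only [smul_mul_assoc, mul_smul_comm]
        rw [gen_comm g h]
        simp only [smul_smul]
        congr 1
        ring)

lemma twist_gen (k : ℤ) (g : Gen U F) : twist k (gen g) = sg (k * g.par) • gen g :=
  liftAlg_gen _ _ _ _ _ g

lemma twist_fn (k : ℤ) (f : LocFn U F) : twist k (fn f) = fn f := by
  rw [fn, twist_gen]; simp [Gen.par, Gen.vdeg, Gen.gdeg]

/-- `a` has degree `i` modulo two. -/
def IsParity (i : ℤ) (a : Alg U F) : Prop := ∀ k, twist k a = sg (k * i) • a

lemma isParity_gen (g : Gen U F) : IsParity g.par (gen g) := fun k => twist_gen k g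

lemma IsParity.zero (i : ℤ) : IsParity i (0 : Alg U F) := fun k => by simp

lemma IsParity.add {i : ℤ} {a b : Alg U F} (ha : IsParity i a) (hb : IsParity i b) :
    IsParity i (a + b) := fun k => by rw [map_add, ha, hb, smul_add]

lemma IsParity.smul {i : ℤ} {a : Alg U F} (r : ℝ) (ha : IsParity i a) :
    IsParity i (r • a) := fun k => by rw [map_smul, ha, smul_comm]

lemma IsParity.mul {i l : ℤ} {a b : Alg U F} (ha : IsParity i a) (hb : IsParity l b) :
    IsParity (i + l) (a * b) := fun k => by
  rw [map_mul, ha, hb, mul_add, sg_add, smul_mul_assoc, mul_smul_comm, smul_smul]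

lemma isParity_fn (f : LocFn U F) : IsParity 0 (fn f) := fun k => by simp [twist_fn]

/-- Graded commutativity with a generator. -/
lemma mul_gen (a : Alg U F) (h : Gen U F) : a * gen h = gen h * twist h.par a := by
  induction a using alg_induction with
  | hgen g => rw [twist_gen, mul_smul_comm, gen_comm, mul_comm g.par]
  | hconst r => rw [AlgHom.commutes, Algebra.commutes]
  | hadd a b ha hb => rw [add_mul, ha, hb, map_add, mul_add]
  | hmul a b ha hb => rw [mul_assoc, hb, ← mul_assoc, ha, map_mul, mul_assoc]

lemma IsParity.mul_gen {i : ℤ} {a : Alg U F} (ha : IsParity i a) (h : Gen U F) :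
    a * gen h = sg (h.par * i) • (gen h * a) := by
  rw [BVBFV.mul_gen, ha, mul_smul_comm]

lemma mul_fn (a : Alg U F) (f : LocFn U F) : a * fn f = fn f * a := by
  have h0 : (Gen.fn f : Gen U F).par = 0 := by simp [Gen.par, Gen.vdeg, Gen.gdeg]
  have h1 : twist 0 a = a := by
    induction a using alg_induction with
    | hgen g => simp [twist_gen]
    | hconst r => simp
    | hadd a b ha hb => rw [map_add, ha, hb]
    | hmul a b ha hb => rw [map_mul, ha, hb]
  rw [fn, mul_gen, h0, h1]

/-! ### Graded derivations -/

/-- Images of generators under the derivation with `x^μ ↦ v μ`, `u_j ↦ φ j`, `δu_j ↦ ψ j`. -/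
def derGen (v : Fin n → ℝ) (φ ψ : Jet n F → Alg U F) : Gen U F → Alg U F
  | .fn f => ∑ μ, v μ • fn (pdx μ f) + ∑ᶠ j : Jet0 n F, fn (pdu j f) * φ j.1
  | .u j _ => φ j
  | .du j => ψ j

lemma derGen_finite (φ : Jet n F → Alg U F) (f : LocFn U F) :
    (Function.support fun j : Jet0 n F => fn (pdu j f) * φ j.1).Finite := by
  refine (pdu_finite f).subset fun j hj => ?_
  intro h
  apply hj
  simp [h, fn_zero]

lemma derGen_add (v : Fin n → ℝ) (φ ψ : Jet n F → Alg U F) (f g : LocFn U F) :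
    derGen v φ ψ (.fn (f + g)) = derGen v φ ψ (.fn f) + derGen v φ ψ (.fn g) := by
  simp only [derGen, pdx_add, pdu_add, fn_add, smul_add, add_mul, Finset.sum_add_distrib]
  rw [finsum_add_distrib (derGen_finite φ f) (derGen_finite φ g)]
  abel

lemma derGen_mul (v : Fin n → ℝ) (φ ψ : Jet n F → Alg U F) (f g : LocFn U F) :
    derGen v φ ψ (.fn (f * g)) =
      derGen v φ ψ (.fn f) * fn g + fn f * derGen v φ ψ (.fn g) := by
  have key : ∀ j : Jet0 n F, fn (pdu j (f * g)) * φ j.1 =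
      fn g * (fn (pdu j f) * φ j.1) + fn f * (fn (pdu j g) * φ j.1) := by
    intro j
    rw [pdu_mul, fn_add, fn_mul, fn_mul, add_mul, mul_assoc (fn f), mul_fn (fn (pdu j f)) g,
      mul_assoc (fn g)]
  simp only [derGen, key]
  rw [finsum_add_distrib ((derGen_finite φ f).subset fun j hj h => hj (by simp [h]))
    ((derGen_finite φ g).subset fun j hj h => hj (by simp [h])),
    ← mul_finsum' _ _ (derGen_finite φ f), ← mul_finsum' _ _ (derGen_finite φ g), mul_fn]
  simp only [pdx_mul, fn_add, fn_mul, smul_add, Finset.sum_add_distrib, mul_add, Finset.mul_sum,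
    mul_smul_comm, fun μ => mul_fn (fn (pdx μ f)) g]
  abel

lemma derGen_const (v : Fin n → ℝ) (φ ψ : Jet n F → Alg U F) (r : ℝ) :
    derGen v φ ψ (.fn (algebraMap ℝ _ r)) = 0 := by
  simp [derGen, pdx_algebraMap, pdu_algebraMap, fn_zero]

section der
variable {ε : ℤ} {v : Fin n → ℝ} {φ ψ : Jet n F → Alg U F}

lemma derGen_parity (hv : v = 0 ∨ Even ε) (hφ : ∀ j, IsParity (F.deg j.1 + ε) (φ j))
    (hψ : ∀ j, IsParity (1 + F.deg j.1 + ε) (ψ j)) (g : Gen U F) :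
    IsParity (g.par + ε) (derGen v φ ψ g) := by
  cases g with
  | u j h => simpa [Gen.par, Gen.vdeg, Gen.gdeg, derGen] using hφ j
  | du j => simpa [Gen.par, Gen.vdeg, Gen.gdeg, derGen] using hψ j
  | fn f =>
    simp only [Gen.par, Gen.vdeg, Gen.gdeg, zero_add, derGen]
    refine IsParity.add ?_ ?_
    · rcases hv with rfl | hε
      · simpa using IsParity.zero _
      · refine Finset.sum_induction _ (IsParity ε) (fun _ _ => IsParity.add) (IsParity.zero _) ?_
        intro μ _ k
        rw [map_smul, twist_fn, sg_even (hε.mul_left k), one_smul]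
    · refine finsum_induction (IsParity ε) (IsParity.zero _) (fun _ _ => IsParity.add) ?_
      intro j
      have := (isParity_fn (pdu j f)).mul (hφ j.1)
      rwa [j.2, zero_add, zero_add] at this

/-- The pair (sign twist, derivation) as a homomorphism into upper triangular matrices. -/
def derHom (hv : v = 0 ∨ Even ε) (hφ : ∀ j, IsParity (F.deg j.1 + ε) (φ j))
    (hψ : ∀ j, IsParity (1 + F.deg j.1 + ε) (ψ j)) :
    Alg U F →ₐ[ℝ] Matrix (Fin 2) (Fin 2) (Alg U F) :=
  liftAlg (fun g => !![twist ε (gen g), derGen v φ ψ g; 0, gen g])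
    (by
      intro f g
      have e : (gen (.fn (f + g)) : Alg U F) = gen (.fn f) + gen (.fn g) := fn_add f g
      rw [e, derGen_add]
      ext i j; fin_cases i <;> fin_cases j <;> simp)
    (by
      intro f g
      have e : (gen (.fn (f * g)) : Alg U F) = gen (.fn f) * gen (.fn g) := fn_mul f g
      rw [e, derGen_mul]
      ext i j; fin_cases i <;> fin_cases j <;> simp [Matrix.mul_apply, Fin.sum_univ_two]
      rw [show gen (Gen.fn f) = fn f from rfl, twist_fn, add_comm]; rfl)
    (by
      intro r
      have e : (gen (.fn (algebraMap ℝ _ r)) : Alg U F) = algebraMap ℝ _ r := fn_const r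
      rw [e, derGen_const]
      ext i j; fin_cases i <;> fin_cases j <;> simp [Matrix.algebraMap_matrix_apply])
    (by
      intro g h
      ext i j; fin_cases i <;> fin_cases j <;> simp [Matrix.mul_apply, Fin.sum_univ_two]
      · rw [← map_mul, gen_comm, map_smul, map_mul]
      · rw [twist_gen, twist_gen, (derGen_parity hv hφ hψ g).mul_gen h,
          (derGen_parity hv hφ hψ h).mul_gen g]
        simp only [smul_mul_assoc, smul_smul, mul_add, sg_add]
        rw [add_comm, mul_comm h.par g.par, mul_comm h.par ε, mul_comm g.par ε]
        congr 2
        rw [← mul_assoc, sg_mul_self, one_mul]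
      · exact gen_comm g h)

/-- The graded derivation of parity `ε` of the algebra of vertical forms with `x^μ ↦ v μ`,
`u_j ↦ φ j` and `δu_j ↦ ψ j`. -/
def der (ε : ℤ) (v : Fin n → ℝ) (φ ψ : Jet n F → Alg U F) (hv : v = 0 ∨ Even ε)
    (hφ : ∀ j, IsParity (F.deg j.1 + ε) (φ j)) (hψ : ∀ j, IsParity (1 + F.deg j.1 + ε) (ψ j)) :
    Alg U F →ₗ[ℝ] Alg U F where
  toFun a := derHom hv hφ hψ a 0 1
  map_add' a b := by simp
  map_smul' r a := by simp

variable (hv : v = 0 ∨ Even ε) (hφ : ∀ j, IsParity (F.deg j.1 + ε) (φ j))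
  (hψ : ∀ j, IsParity (1 + F.deg j.1 + ε) (ψ j))

lemma derHom_gen (g : Gen U F) :
    derHom hv hφ hψ (gen g) = !![twist ε (gen g), derGen v φ ψ g; 0, gen g] :=
  liftAlg_gen _ _ _ _ _ g

lemma derHom_eq (a : Alg U F) :
    derHom hv hφ hψ a 0 0 = twist ε a ∧ derHom hv hφ hψ a 1 0 = 0 ∧ derHom hv hφ hψ a 1 1 = a := by
  induction a using alg_induction with
  | hgen g => rw [derHom_gen]; simp
  | hconst r => rw [AlgHom.commutes]; simp [Matrix.algebraMap_matrix_apply]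
  | hadd a b ha hb => simp [ha, hb]
  | hmul a b ha hb => simp [Matrix.mul_apply, Fin.sum_univ_two, ha, hb]

lemma der_gen (g : Gen U F) : der ε v φ ψ hv hφ hψ (gen g) = derGen v φ ψ g := by
  change derHom hv hφ hψ (gen g) 0 1 = _
  rw [derHom_gen]; simp

lemma der_mul (a b : Alg U F) : der ε v φ ψ hv hφ hψ (a * b) =
    der ε v φ ψ hv hφ hψ a * b + twist ε a * der ε v φ ψ hv hφ hψ b := by
  change derHom hv hφ hψ (a * b) 0 1 = derHom hv hφ hψ a 0 1 * b +
    twist ε a * derHom hv hφ hψ b 0 1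
  rw [map_mul, Matrix.mul_apply, Fin.sum_univ_two, (derHom_eq hv hφ hψ a).1,
    (derHom_eq hv hφ hψ b).2.2, add_comm]

lemma der_const (r : ℝ) : der ε v φ ψ hv hφ hψ (algebraMap ℝ _ r) = 0 := by
  change derHom hv hφ hψ (algebraMap ℝ _ r) 0 1 = 0
  rw [AlgHom.commutes]; simp [Matrix.algebraMap_matrix_apply]

lemma twist_twist (k l : ℤ) (a : Alg U F) : twist k (twist l a) = twist l (twist k a) := by
  induction a using alg_induction with
  | hgen g => simp only [twist_gen, map_smul]; rw [smul_comm]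
  | hconst r => simp
  | hadd a b ha hb => simp [ha, hb]
  | hmul a b ha hb => simp [ha, hb]

lemma twist_der (k : ℤ) (a : Alg U F) :
    twist k (der ε v φ ψ hv hφ hψ a) = sg (k * ε) • der ε v φ ψ hv hφ hψ (twist k a) := by
  induction a using alg_induction with
  | hgen g =>
    rw [twist_gen, map_smul, der_gen, derGen_parity hv hφ hψ g k, mul_add, sg_add, smul_smul,
      mul_comm (sg (k * ε))]
  | hconst r => simp [der_const]
  | hadd a b ha hb => simp [ha, hb]
  | hmul a b ha hb =>
    simp only [der_mul, map_add, map_mul, ha, hb, smul_add, smul_mul_assoc, mul_smul_comm]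
    rw [twist_twist]

lemma IsParity.der {i : ℤ} {a : Alg U F} (ha : IsParity i a) :
    IsParity (i + ε) (BVBFV.der ε v φ ψ hv hφ hψ a) := fun k => by
  rw [twist_der, ha, map_smul, smul_smul, mul_add, sg_add, mul_comm (sg (k * ε))]

end der

/-! ### Degrees -/

lemma isParity_prod (l : List (Gen U F)) :
    IsParity ((l.map Gen.vdeg).sum + (l.map Gen.gdeg).sum) (l.map gen).prod := by
  induction l with
  | nil => intro k; simp
  | cons g l ih =>
    have := (isParity_gen g).mul ih
    simp only [List.map_cons, List.prod_cons, List.sum_cons]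
    convert this using 1
    simp only [Gen.par]
    ring

variable (U F) in
/-- Elements of vertical form degree `q` and ghost number `r`: the span of the monomials in the
generators that have these degrees. -/
def bideg (q r : ℤ) : Submodule ℝ (Alg U F) :=
  Submodule.span ℝ {a | ∃ l : List (Gen U F),
    (l.map Gen.vdeg).sum = q ∧ (l.map Gen.gdeg).sum = r ∧ (l.map gen).prod = a}

lemma isParity_of_mem_bideg {q r : ℤ} {a : Alg U F} (h : a ∈ bideg U F q r) :
    IsParity (q + r) a := by
  induction h using Submodule.span_induction with
  | mem a h =>
    obtain ⟨l, rfl, rfl, rfl⟩ := h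
    exact isParity_prod l
  | zero => exact IsParity.zero _
  | add a b _ _ ha hb => exact ha.add hb
  | smul r a _ ha => exact ha.smul r

/-! ### The basic operators on vertical forms -/

/-- The jet coordinate `u^a_I` as an element of the algebra. -/
def coord (j : Jet n F) : Alg U F :=
  if h : F.deg j.1 = 0 then fn (coordFn ⟨j, h⟩) else gen (.u j h)

lemma isParity_coord (j : Jet n F) : IsParity (F.deg j.1) (coord j : Alg U F) := by
  unfold coord
  split_ifs with h
  · rw [h]; exact isParity_fn _
  · simpa [Gen.par, Gen.vdeg, Gen.gdeg] using isParity_gen (U := U) (Gen.u j h)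

lemma isParity_du (j : Jet n F) : IsParity (1 + F.deg j.1) (gen (.du j) : Alg U F) := by
  simpa [Gen.par, Gen.vdeg, Gen.gdeg] using isParity_gen (U := U) (Gen.du j)

/-- The total derivative: the Lie derivative along the horizontal lift of `∂_μ`. -/
def totalD (μ : Fin n) : Alg U F →ₗ[ℝ] Alg U F :=
  der 0 (Pi.single μ 1) (fun j => coord (j.succ μ)) (fun j => gen (.du (j.succ μ)))
    (Or.inr (by simp)) (fun j => by rw [add_zero]; exact isParity_coord (U := U) (j.succ μ))
    (fun j => by rw [add_zero]; exact isParity_du (U := U) (j.succ μ))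

/-- The explicit derivative `Lie_{∂_μ}`, which annihilates all `u^a_I` and `δu^a_I`. -/
def explicitD (μ : Fin n) : Alg U F →ₗ[ℝ] Alg U F :=
  der 0 (Pi.single μ 1) 0 0 (Or.inr (by simp)) (fun _ => IsParity.zero _)
    (fun _ => IsParity.zero _)

/-- The vertical differential `d_v`. -/
def dv : Alg U F →ₗ[ℝ] Alg U F :=
  der 1 0 (fun j => gen (.du j)) 0 (Or.inl rfl)
    (fun j => by rw [add_comm]; exact isParity_du j) (fun _ => IsParity.zero _)

/-- The contraction with `∂/∂u_j`. -/
def contractJet (j : Jet n F) : Alg U F →ₗ[ℝ] Alg U F :=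
  der (-1 - F.deg j.1) 0 0 (Pi.single j 1) (Or.inl rfl) (fun _ => IsParity.zero _)
    (fun i => by
      by_cases h : i = j
      · subst h
        rw [Pi.single_eq_same]
        intro k
        simp
      · rw [Pi.single_eq_of_ne h]
        exact IsParity.zero _)

/-- The iterated total derivative `D_I`. -/
def totalDs (I : Fin n → ℕ) (a : Alg U F) : Alg U F :=
  (List.finRange n).foldr (fun μ b => (totalD μ)^[I μ] b) a

lemma IsParity.totalD {i : ℤ} {a : Alg U F} (ha : IsParity i a) (μ : Fin n) :
    IsParity i (BVBFV.totalD μ a) := by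
  have := ha.der (ε := 0) (v := Pi.single μ 1) (φ := fun j => coord (j.succ μ))
    (ψ := fun j => gen (.du (j.succ μ))) (Or.inr (by simp))
    (fun j => by rw [add_zero]; exact isParity_coord (U := U) (j.succ μ))
    (fun j => by rw [add_zero]; exact isParity_du (U := U) (j.succ μ))
  rwa [add_zero] at this

lemma IsParity.totalDs {i : ℤ} {a : Alg U F} (ha : IsParity i a) (I : Fin n → ℕ) :
    IsParity i (BVBFV.totalDs I a) := by
  unfold BVBFV.totalDs
  induction List.finRange n with
  | nil => exact ha
  | cons μ l ih =>
    rw [List.foldr_cons]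
    generalize I μ = k
    induction k with
    | zero => exact ih
    | succ k ihk => rw [Function.iterate_succ_apply']; exact ihk.totalD μ

variable (U F) in
/-- Vertical local vector fields of degree `k`, given by their components `Ξ^a`; the field is
`Ξ^a ∂/∂u^a + D_I(Ξ^a) ∂/∂u^a_I`. -/
def VField (k : ℤ) : Submodule ℝ (F.Idx → Alg U F) :=
  Submodule.pi Set.univ fun a => bideg U F 0 (F.deg a + k)

lemma VField.isParity {k : ℤ} (X : VField U F k) (a : F.Idx) :
    IsParity (F.deg a + k) (X.1 a) := by
  have := isParity_of_mem_bideg (X.2 a trivial)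
  rwa [zero_add] at this

/-- The contraction `ι_Ξ`, with `δu^a_I ↦ D_I(Ξ^a)`. -/
def contract {k : ℤ} (X : VField U F k) : Alg U F →ₗ[ℝ] Alg U F :=
  der (k - 1) 0 0 (fun j => totalDs j.2 (X.1 j.1)) (Or.inl rfl) (fun _ => IsParity.zero _)
    (fun j => by
      have := (VField.isParity X j.1).totalDs j.2
      convert this using 1
      ring)

/-- The Lie derivative `Lie_Ξ = ι_Ξ d_v + (-1)^{d(Ξ)} d_v ι_Ξ`. -/
def lie {k : ℤ} (X : VField U F k) : Alg U F →ₗ[ℝ] Alg U F :=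
  contract X ∘ₗ dv + sg k • (dv ∘ₗ contract X)

/-- The components of the graded commutator of two vertical local vector fields. -/
def bracket {k l : ℤ} (X : VField U F k) (Y : VField U F l) (a : F.Idx) : Alg U F :=
  lie X (Y.1 a) - sg (k * l) • lie Y (X.1 a)

/-! ### Local forms -/

variable (U F) in
/-- Local forms; `w S` is the coefficient of `dx^{μ_1} ∧ ⋯ ∧ dx^{μ_p}`, where `μ_1 < ⋯ < μ_p` are
the elements of `S`. The `dx^μ` commute with all vertical objects. -/
abbrev Form : Type := Finset (Fin n) → Alg U F

variable (U F) in
/-- Local forms of horizontal degree `p`, vertical degree `q` and ghost number `r`. -/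
def Form.deg (p : ℕ) (q r : ℤ) : Submodule ℝ (Form U F) where
  carrier := {w | ∀ S, if S.card = p then w S ∈ bideg U F q r else w S = 0}
  add_mem' := by
    intro a b ha hb S
    have h1 := ha S
    have h2 := hb S
    split_ifs at h1 h2 ⊢
    · exact Submodule.add_mem _ h1 h2
    · rw [Pi.add_apply, h1, h2, add_zero]
  zero_mem' := by intro S; split_ifs <;> simp
  smul_mem' := by
    intro c a ha S
    have h1 := ha S
    split_ifs at h1 ⊢
    · exact Submodule.smul_mem _ _ h1
    · rw [Pi.smul_apply, h1, smul_zero]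

/-- A vertical operator acts on the coefficients of a local form. -/
def vert (T : Alg U F →ₗ[ℝ] Alg U F) : Form U F →ₗ[ℝ] Form U F := T.compLeft _

/-- The operator `ω ↦ dx^μ ∧ T_μ ω` (summed over `μ`). -/
def horiz (T : Fin n → Alg U F →ₗ[ℝ] Alg U F) : Form U F →ₗ[ℝ] Form U F where
  toFun w := fun S => ∑ μ ∈ S, sg ((S.filter (· < μ)).card : ℤ) • T μ (w (S.erase μ))
  map_add' a b := by
    funext S; simp [Finset.sum_add_distrib]
  map_smul' r a := by
    funext S; simp [Finset.smul_sum, smul_comm r]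

/-- The horizontal differential `d_h`. -/
def dh : Form U F →ₗ[ℝ] Form U F := horiz totalD

/-- `w ≃ 0`: the form is `d_h`-exact. -/
def HExact (w : Form U F) : Prop := ∃ η : Form U F, w = dh η

/-- `Ω_∘`: the coefficients of the form do not depend explicitly on the coordinates `x^μ`. -/
def XIndep (w : Form U F) : Prop := ∀ μ, vert (explicitD μ) w = 0

/-- The form `a dx^1 ∧ ⋯ ∧ dx^n`. -/
def topForm (a : Alg U F) : Form U F := fun S => if S = Finset.univ then a else 0

/-- The interior Euler operator on forms of degree `(n, s)`, `s ≥ 1`, normalised so as to be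
idempotent. -/
def interiorEuler (s : ℕ) (w : Form U F) : Form U F := fun S =>
  (s : ℝ)⁻¹ • ∑ a : F.Idx, gen (.du (a, 0)) *
    ∑ᶠ I : Fin n → ℕ, sg (∑ μ, (I μ : ℤ)) • totalDs I (contractJet (a, I) (w S))

/-- Symplectic local forms of degree `(n, 2, -1)`. -/
structure IsBVSymplectic (w : Form U F) : Prop where
  deg : w ∈ Form.deg U F n 2 (-1)
  closed : HExact (vert dv w)
  functional : interiorEuler 2 w = w
  nondegenerate : ∀ (k : ℤ) (X : VField U F k), HExact (vert (contract X) w) → X = 0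

/-- `Ξ` is a Noether symmetry of the Lagrangian `L`. -/
def IsNoether {k : ℤ} (X : VField U F k) (L : Form U F) : Prop := HExact (vert (lie X) L)

/-! ### Pullback along an inclusion of fields -/

section pull
variable {F' : Fields} (e : Fields.Hom F F')

def Fields.Hom.jet (j : Jet n F) : Jet n F' := (e.toFun j.1, j.2)

def Fields.Hom.jet0 (j : Jet0 n F) : Jet0 n F' := ⟨e.jet j.1, (e.deg_eq _).trans j.2⟩

/-- Local functions of the fields in `F` as local functions of the fields in `F'`. -/
def pullFn (f : LocFn U F) : LocFn U F' :=
  ⟨fun p => f.1 (p.1, fun j => p.2 (e.jet0 j)), by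
    classical
    obtain ⟨s, g, hg, hf⟩ := f.2
    refine ⟨s.image e.jet0, fun q => g (q.1, fun j => q.2 ⟨e.jet0 j,
      Finset.mem_image_of_mem _ j.2⟩), ?_, fun p => hf _⟩
    refine hg.comp (t := (U : Set (Fin n → ℝ)) ×ˢ Set.univ) (ContDiff.contDiffOn (by fun_prop)) ?_
    rintro q ⟨h1, -⟩
    exact ⟨h1, trivial⟩⟩

def pullGen : Gen U F → Gen U F'
  | .fn f => .fn (pullFn e f)
  | .u j h => .u (e.jet j) (by rw [Fields.Hom.jet, e.deg_eq]; exact h)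
  | .du j => .du (e.jet j)

lemma pullGen_par (g : Gen U F) : (pullGen e g).par = g.par := by
  cases g <;> simp [pullGen, Gen.par, Gen.vdeg, Gen.gdeg, Fields.Hom.jet, e.deg_eq]

/-- Vertical forms of the fields in `F` as vertical forms of the fields in `F'`. -/
def pullAlg : Alg U F →ₐ[ℝ] Alg U F' :=
  liftAlg (fun g => gen (pullGen e g)) (fun f g => fn_add (pullFn e f) (pullFn e g))
    (fun f g => fn_mul (pullFn e f) (pullFn e g)) (fun r => fn_const r)
    (fun g h => by rw [gen_comm, pullGen_par, pullGen_par])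

/-- Local forms of the fields in `F` as local forms of the fields in `F'`. -/
def pull : Form U F →ₗ[ℝ] Form U F' := (pullAlg e).toLinearMap.compLeft _

end pull

/-! ### Invariant vector fields, gauge natural bundles, `QKG*`-structures -/

variable (U) in
/-- Smooth functions on `U`. -/
abbrev BaseFn : Type := LocFn U Fields.empty

/-- A smooth function on `U` as a function of `x` and the jets. -/
def base (f : BaseFn U) : Alg U F := fn (pullFn F.emptyHom f)

/-- The iterated partial derivative `∂_α`. -/
def pdxs (α : Fin n → ℕ) (f : BaseFn U) : BaseFn U :=
  (List.finRange n).foldr (fun μ g => (pdx μ)^[α μ] g) f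

variable (U) in
/-- `G`-invariant vector fields `Ξ = Ξ^μ ∂_μ + Ξ^a ρ_a` on `U × G`, where `ρ_a` are the right
invariant vector fields of a basis of the Lie algebra indexed by `κ`. -/
abbrev InvVF (κ : Type) : Type := (Fin n → BaseFn U) × (κ → BaseFn U)

section gauge
variable {κ : Type} [Fintype κ] {𝔤 : Type} [LieRing 𝔤] [LieAlgebra ℝ 𝔤]

/-- The bracket of the Lie algebra of the automorphism group of `U × G`, which is the negative of
the commutator of vector fields; on sections of the adjoint bundle it is the pointwise bracket. -/
def autBracket (b : Module.Basis κ ℝ 𝔤) (X Y : InvVF U κ) : InvVF U κ :=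
  (fun μ => ∑ ν, (Y.1 ν * pdx ν (X.1 μ) - X.1 ν * pdx ν (Y.1 μ)),
   fun c => ∑ ν, (Y.1 ν * pdx ν (X.2 c) - X.1 ν * pdx ν (Y.2 c)) +
     ∑ a, ∑ a', b.repr ⁅b a, b a'⁆ c • (X.2 a * Y.2 a'))

variable (U κ) in
/-- The coordinate vector field `∂_μ`. -/
def InvVF.partial (μ : Fin n) : InvVF U κ := (Pi.single μ 1, 0)

/-- The vertical invariant vector field of a section `λ` of the adjoint bundle. -/
def InvVF.gauge (lam : κ → BaseFn U) : InvVF U κ := (0, lam)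

/-- Functions on the typical fibre: no dependence on `x` and on jets of positive order. -/
def IsFibreFn (a : Alg U F) : Prop :=
  (∀ μ, explicitD μ a = 0) ∧ ∀ j : Jet n F, j.2 ≠ 0 → contractJet j (dv a) = 0

variable (U F) in
/-- A graded gauge natural bundle over `U` with fibre coordinates `F`, through the infinitesimal
action of the invariant vector fields: the Lie derivative `Lie_Ξ u^a = Ξ^μ u^a_μ - (Ξ_Y)^a` of
sections, where `Ξ_Y` is of finite order in `Ξ` with coefficients that are functions on the typical
fibre (the action of the Lie algebra of the jet group on the fibre). -/
structure GaugeNatural (b : Module.Basis κ ℝ 𝔤) where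
  order : ℕ
  A : (Fin n → ℕ) → Fin n → F.Idx → Alg U F
  B : (Fin n → ℕ) → κ → F.Idx → Alg U F
  A_deg : ∀ α μ a, A α μ a ∈ bideg U F 0 (F.deg a)
  B_deg : ∀ α c a, B α c a ∈ bideg U F 0 (F.deg a)
  A_fibre : ∀ α μ a, IsFibreFn (A α μ a)
  B_fibre : ∀ α c a, IsFibreFn (B α c a)
  A_zero : ∀ μ a, A 0 μ a = 0
  act : InvVF U κ → VField U F 0
  act_eq : ∀ X a, (act X).1 a = ∑ μ, base (X.1 μ) * coord (a, Pi.single μ 1) -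
    ∑ α ∈ Fintype.piFinset fun _ : Fin n => Finset.range (order + 1),
      (∑ μ, base (pdxs α (X.1 μ)) * A α μ a + ∑ c, base (pdxs α (X.2 c)) * B α c a)
  act_bracket : ∀ X Y, bracket (act X) (act Y) = (act (autBracket b X Y)).1

/-- A `QKG*`-structure. -/
structure QKG {b : Module.Basis κ ℝ 𝔤} (N : GaugeNatural U F b) where
  Q : VField U F 1
  Q_sq : bracket Q Q = 0
  K : InvVF U κ →ₗ[ℝ] VField U F (-1)
  K_K : ∀ X Y, bracket (K X) (K Y) = 0
  act_K : ∀ X Y, bracket (N.act X) (K Y) = (K (autBracket b X Y)).1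
  Q_K : ∀ X, bracket Q (K X) = (N.act X).1

variable {b : Module.Basis κ ℝ 𝔤} {N : GaugeNatural U F b}

/-- `I_λ`. -/
def QKG.I (S : QKG N) (lam : κ → BaseFn U) : VField U F (-1) := S.K (InvVF.gauge lam)

/-- The infinitesimal gauge transformation `δ_λ`. -/
def GaugeNatural.delta (N : GaugeNatural U F b) (lam : κ → BaseFn U) : VField U F 0 :=
  N.act (InvVF.gauge lam)

/-- The homotopy operator `K = dx^μ ∧ Lie_{K_μ}`. -/
def QKG.homotopy (S : QKG N) : Form U F →ₗ[ℝ] Form U F :=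
  horiz fun μ => lie (S.K (InvVF.partial U κ μ))

/-- Basic with respect to the `Gau(P)*`-action, up to `d_h`-exact terms. -/
def QKG.IsBasic (S : QKG N) (w : Form U F) : Prop :=
  ∀ lam : κ → BaseFn U,
    HExact (vert (lie (S.I lam)) w) ∧ HExact (vert (lie (N.delta lam)) w)

/-- A cohomological Lagrangian gauge field theory with Lagrangian `L`. -/
structure IsCohLGFT (S : QKG N) (L : Form U F) : Prop where
  deg : L ∈ Form.deg U F n 0 0
  noether_Q : IsNoether S.Q L
  noether_I : ∀ lam, IsNoether (S.I lam) L
  noether_delta : ∀ lam, IsNoether (N.delta lam) L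

/-! ### Extended BV-BFV theories -/

/-- `m`-extended BV-BFV Lagrangian field theories with `ω^(p) = d_v γ^(p)`. Potentials, hence also
the `ω^(p)`, vanish for `p > m`. -/
structure IsExtendedBVBFV (m : ℕ) (Q : VField U F 1) (L γ : ℕ → Form U F) : Prop where
  Q_sq : bracket Q Q = 0
  noether : IsNoether Q (L 0)
  symplectic : IsBVSymplectic (vert dv (γ 0))
  L_deg : ∀ p ≤ n, L p ∈ Form.deg U F (n - p) 0 p
  L_zero : ∀ p, n < p → L p = 0
  γ_deg : ∀ p ≤ n, γ p ∈ Form.deg U F (n - p) 1 (p - 1)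
  γ_zero : ∀ p, m < p → γ p = 0
  ascent : ∀ p ≤ n, vert (lie Q) (vert dv (γ p)) + dh (vert dv (γ (p + 1))) = 0
  hamilton : ∀ p ≤ n, vert (contract Q) (vert dv (γ p)) = vert dv (L p) + dh (γ (p + 1))

/-- The BV-BFV difference `Δ^(p) = L^(p) - ι_Q γ^(p)`. -/
def difference (Q : VField U F 1) (L γ : ℕ → Form U F) (p : ℕ) : Form U F :=
  L p - vert (contract Q) (γ p)

variable (U) in
/-- A Riemannian metric on `U` with its volume density. -/
structure Metric where
  g : Fin n → Fin n → BaseFn U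
  vol : BaseFn U
  posDef : ∀ p, (Matrix.of fun μ ν => (g μ ν).1 p).PosDef
  vol_eq : ∀ p, vol.1 p = Real.sqrt (Matrix.of fun μ ν => (g μ ν).1 p).det

/-- The antifield `Φ^+_a`. -/
def antifield (a : F.Idx) : Alg U F.ct := coord ((Sum.inr a, 0) : Jet n F.ct)

/-- `γ_ct = Φ^+_a δΦ^a ∧ dvol_g`. -/
def gammaCt (g : Metric U) : Form U F.ct :=
  topForm (∑ a : F.Idx, antifield a * gen (.du (Sum.inl a, 0)) * base g.vol)

/-- `ω_ct = d_v γ_ct`. -/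
def omegaCt (g : Metric U) : Form U F.ct := vert dv (gammaCt g)

/-- The local form `Φ^+_a Ξ^a dvol_g` of a vertical local vector field `Ξ` on the space of the
fields `Φ`. -/
def tildeForm (g : Metric U) {k : ℤ} (X : VField U F k) : Form U F.ct :=
  topForm (∑ a : F.Idx, antifield a * pullAlg F.ctHom (X.1 a) * base g.vol)

/-- `Ξ_cl` is the cotangent lift of `Ξ`. -/
def IsCotangentLift (g : Metric U) {k : ℤ} (X : VField U F k) (Xcl : VField U F.ct k) : Prop :=
  vert (contract Xcl) (omegaCt g) = interiorEuler 1 (vert dv (tildeForm g X))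

/-- `Q_L` is the vector field of the Lagrangian `L` of the fields `Φ`: its contraction with `ω_ct`
is the Euler-Lagrange form of `L`. -/
def IsLagrangianField (g : Metric U) (L : Form U F) (QL : VField U F.ct 1) : Prop :=
  vert (contract QL) (omegaCt g) = interiorEuler 1 (vert dv (pull F.ctHom L))

/-- `m`-extended BV-BFV theories of CohLGFT type over a given `QKG*`-structure. -/
structure CohLGFTType (S : QKG N) (m : ℕ) where
  /-- the metric -/
  g : Metric U
  /-- the Lagrangian of the CohLGFT -/
  LBRST : Form U F
  cohLGFT : IsCohLGFT S LBRST
  /-- the cohomological vector field on the space of fields and antifields -/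
  QBV : VField U F.ct 1
  /-- the Lagrangians -/
  L : ℕ → Form U F.ct
  /-- the potentials -/
  γ : ℕ → Form U F.ct
  extended : IsExtendedBVBFV m QBV L γ
  QBV_eq : ∃ Qcl QL : VField U F.ct 1,
    IsCotangentLift g S.Q Qcl ∧ IsLagrangianField g LBRST QL ∧ QBV = Qcl + QL
  γ_zero : γ 0 = gammaCt g
  L_zero : L 0 = pull F.ctHom LBRST + vert (contract QBV) (gammaCt g)
  /-- the BV-BFV difference, a local form of the fields `Φ` only -/
  Δ : ℕ → Form U F
  Δ_eq : ∀ p, pull F.ctHom (Δ p) = difference QBV L γ p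
  Δ_deg : ∀ p ≤ n, Δ p ∈ Form.deg U F (n - p) 0 p
  basic : ∀ p, S.IsBasic (Δ p)

/-- The sequences `f^(p)` that define `f`-transformations of `m`-extended theories of CohLGFT
type. -/
structure IsFSeq (S : QKG N) (m : ℕ) (f : ℕ → Form U F) : Prop where
  deg : ∀ p ≤ n, f p ∈ Form.deg U F (n - p) 0 (p - 1)
  zero : ∀ p, m < p → f p = 0
  basic : ∀ p, S.IsBasic (f p)

/-- The Lagrangians of the `f`-transformed theory. -/
def fL (f : ℕ → Form U F) (L : ℕ → Form U F.ct) (p : ℕ) : Form U F.ct :=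
  L p + dh (pull F.ctHom (f (p + 1)))

/-- The potentials of the `f`-transformed theory. -/
def fγ (f : ℕ → Form U F) (γ : ℕ → Form U F.ct) (p : ℕ) : Form U F.ct :=
  γ p - vert dv (pull F.ctHom (f p))

/-- The part of degree `n - p` of `(Lie_Q + d_h) ∑ f^(p)`. -/
def QKG.fShift (S : QKG N) (f : ℕ → Form U F) (p : ℕ) : Form U F :=
  vert (lie S.Q) (f p) + dh (f (p + 1))

/-- The member of index `p` of the general `K`-sequence of `O`, with the forms `W^(q)`, `q ≥ 1`:
`K^p O / p! + ∑_{1 ≤ q ≤ p} K^{p-q} W^(q) / (p-q)!`. -/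
def QKG.kSeq (S : QKG N) (O : Form U F) (W : ℕ → Form U F) (p : ℕ) : Form U F :=
  (p.factorial : ℝ)⁻¹ • (S.homotopy ^ p) O +
    ∑ q ∈ Finset.Icc 1 p, ((p - q).factorial : ℝ)⁻¹ • (S.homotopy ^ (p - q)) (W q)

/-- The forms `W^(q)`, `1 ≤ q ≤ m`, of a general `K`-sequence of `Δ^(m)`. -/
structure QKG.IsSeed (S : QKG N) (m : ℕ) (W : ℕ → Form U F) : Prop where
  deg : ∀ q, 1 ≤ q → q ≤ m → W q ∈ Form.deg U F (n - m + q) 0 (m - q)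
  closed : ∀ q, 1 ≤ q → q ≤ m → vert (lie S.Q) (W q) = 0
  xIndep : ∀ q, 1 ≤ q → q ≤ m → XIndep (W q)
  basic : ∀ q, 1 ≤ q → q ≤ m → S.IsBasic (W q)

/-- The `f`-transformation `P_f` carries the BV-BFV difference of `T` into the general `K`-sequence
of `Δ^(m)` given by the `W^(q)`. -/
structure CohLGFTType.Represents {S : QKG N} {m : ℕ} (T : CohLGFTType S m)
    (W f : ℕ → Form U F) : Prop where
  seed : S.IsSeed m W
  fSeq : IsFSeq S m f
  xIndep : XIndep (T.Δ m)
  eq : ∀ p ≤ m, difference T.QBV (fL f T.L) (fγ f T.γ) (m - p) =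
    pull F.ctHom (S.kSeq (T.Δ m) W p)

/-- The BV-BFV difference of `T` is invariant (free of explicit `x`-dependence) after some
`f`-transformation that does not change `Δ^(m)`. -/
def CohLGFTType.IsInvariant {S : QKG N} {m : ℕ} (T : CohLGFTType S m) : Prop :=
  XIndep (T.Δ m) ∧ ∃ f : ℕ → Form U F, IsFSeq S m f ∧ S.fShift f m = 0 ∧
    ∀ p ≤ m, XIndep (T.Δ p + S.fShift f p)

/-- The data `(O, W)` and `(O', W')` of two general `K`-sequences differ by terms `Lie_Q h^(q)`,
where the `h^(q)` are basic and do not depend explicitly on `x`. -/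
def QKG.Cohomologous (S : QKG N) (m : ℕ) (O : Form U F) (W : ℕ → Form U F) (O' : Form U F)
    (W' : ℕ → Form U F) : Prop :=
  ∃ h : ℕ → Form U F,
    (∀ q ≤ m, h q ∈ Form.deg U F (n - m + q) 0 (m - q - 1) ∧ XIndep (h q) ∧ S.IsBasic (h q)) ∧
    O' = O + vert (lie S.Q) (h 0) ∧
    ∀ q, 1 ≤ q → q ≤ m → W' q = W q + vert (lie S.Q) (h q)

end gauge

end BVBFV

end

/-!
The algebra of vertical forms is generated by local functions, jet coordinates and their vertical
differentials, so a graded derivation that obeys the chain rule is determined by its values on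
jet coordinates and differentials (`IsChain.ext`), and a Lie derivative along a vertical local
vector field already by its values on the fields (`IsEvol.ext`). Since the graded commutator of two
such derivations is again one, because second partial derivatives commute, all operator identities
reduce to a check on coordinates: `d_v^2 = 0`, the commutation of `d_v`, contractions and Lie
derivatives with the total derivatives, and the translation of brackets of vector fields into
commutators of Lie derivatives (`lie_lie_of_bracket_eq`). The relations of a `QKG*`-structure then
say that `Q` and the `K_{∂_μ}` do not depend explicitly on `x` and that on forms without explicit
dependence on `x`

  `Lie_Q K + K Lie_Q = d_h`, `K d_h + d_h K = 0`

(`QKG.lie_Q_homotopy`, `QKG.homotopy_dh`). Here the `dx^μ` commute with all vertical objects, so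
that `Lie_Q` and `d_h` commute and the difference of a theory obeys
`Lie_Q Δ^(p) = d_h Δ^(p+1)` with a plus sign.

The vector field of a theory of CohLGFT type restricts to `Q` on the fields (`CohLGFTType.QBV_inl`):
the coefficient of `δΦ^+_a` in `ι_{Q_BV} d_v γ_ct` is `Q_BV^a dvol_g`, and on the side of the
Euler-Lagrange forms it is `Q^a dvol_g`, as `L_BRST` does not involve the antifields. Hence
`ι_{Q_BV} d_v f = Lie_Q f` for forms `f` of the fields, which gives the shift of the difference under
`f`-transformations (`CohLGFTType.difference_f`).

The structure equations of the theory imply that `Lie_Q Δ^(p) - d_h Δ^(p+1)` is `d_v`-closed. It has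
vertical degree zero and positive ghost number, and there `d_v` is injective, as contraction with
the Euler vector field of the ghost grading inverts it up to the ghost number
(`eq_zero_of_dv_eq_zero`). This proves the descent equations (`CohLGFTType.descent`), and in the
same way `Δ^(p) = 0` for `p > m`.

Every sequence `δ` is the general `K`-sequence of a seed that is found recursively from
`W^(p) = δ^(p) - ∑_{q<p} K^{p-q} W^(q) / (p-q)!`. By the homotopy formula
`Lie_Q (K^p/p!) = d_h K^{p-1}/(p-1)! + (-1)^p (K^p/p!) Lie_Q` the descent equations for `δ` mean that
the seed is `Q`-closed (`QKG.lie_Q_seedOf`), and `K` preserves basic forms because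
`[δ_λ, K_{∂_μ}] = I_{∂_μ λ}` (`QKG.isBasic_homotopy`). The same formula shows that a `Lie_Q`-exact
change `Lie_Q h^(q)` of the seed changes the `K`-sequence by the shift of the `f`-transformation
with `g^(m-p) = ∑_q (-1)^{p-q} K^{p-q} h^(q) / (p-q)!` (`QKG.kSum_lie_Q`).
-/

noncomputable section

namespace BVBFV

variable {n : ℕ} {U : Opens (Fin n → ℝ)} {F : Fields}

/-! ### Partial derivatives of local functions -/

/-- `D` differentiates every representative of a local function along a fixed vector, which depends
only on the jet coordinates that the representative involves. -/
def IsDirectional (D : LocFn U F → LocFn U F) : Prop :=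
  ∀ s : Finset (Jet0 n F), ∃ v : (Fin n → ℝ) × (s → ℝ),
    ∀ (f : LocFn U F) (g : (Fin n → ℝ) × (s → ℝ) → ℝ),
      ContDiffOn ℝ ∞ g ((U : Set (Fin n → ℝ)) ×ˢ Set.univ) →
      (∀ p, f.1 p = g (p.1, fun j => p.2 j)) →
      ∀ p : JetPt U F, (D f).1 p = fderiv ℝ g ((p.1 : Fin n → ℝ), fun j => p.2 j) v

lemma isDirectional_pdx (μ : Fin n) : IsDirectional (U := U) (F := F) (pdx μ) := by
  intro s
  refine ⟨(Pi.single μ 1, 0), fun f g hg hf p => ?_⟩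
  classical
  exact (hasDerivAt_pdx μ hg hf p).deriv

lemma isDirectional_pdu (j : Jet0 n F) : IsDirectional (U := U) (F := F) (pdu j) := by
  classical
  intro s
  refine ⟨(0, fun i => if (i : Jet0 n F) = j then 1 else 0), fun f g hg hf p => ?_⟩
  have := (hasDerivAt_pdu j hg hf p).deriv
  refine Eq.trans this ?_
  congr!

/-- Symmetry of second derivatives. -/
lemma IsDirectional.comm {D D' : LocFn U F → LocFn U F} (hD : IsDirectional D)
    (hD' : IsDirectional D') (f : LocFn U F) : D (D' f) = D' (D f) := by
  obtain ⟨s, g, hg, hf⟩ := f.2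
  obtain ⟨v, hv⟩ := hD s
  obtain ⟨v', hv'⟩ := hD' s
  have hopen : IsOpen ((U : Set (Fin n → ℝ)) ×ˢ (Set.univ : Set (s → ℝ))) :=
    U.isOpen.prod isOpen_univ
  have hsm : ∀ w : (Fin n → ℝ) × (s → ℝ), ContDiffOn ℝ ∞ (fun q => fderiv ℝ g q w)
      ((U : Set (Fin n → ℝ)) ×ˢ Set.univ) := fun w =>
    (hg.fderiv_of_isOpen hopen (by simp)).clm_apply contDiffOn_const
  apply Subtype.ext
  funext p
  rw [hv _ _ (hsm v') (hv' f g hg hf) p, hv' _ _ (hsm v) (hv f g hg hf) p]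
  have hmem : ((p.1 : Fin n → ℝ), fun j : s => p.2 j) ∈
      ((U : Set (Fin n → ℝ)) ×ˢ (Set.univ : Set (s → ℝ))) := ⟨p.1.2, trivial⟩
  have hat := hg.contDiffAt (hopen.mem_nhds hmem)
  have hd : DifferentiableAt ℝ (fderiv ℝ g) ((p.1 : Fin n → ℝ), fun j : s => p.2 j) :=
    ((hat.fderiv_right (m := 1) (by norm_cast)).differentiableAt (by simp))
  have key : ∀ w w' : (Fin n → ℝ) × (s → ℝ),
      fderiv ℝ (fun q => fderiv ℝ g q w) ((p.1 : Fin n → ℝ), fun j : s => p.2 j) w' =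
        fderiv ℝ (fderiv ℝ g) ((p.1 : Fin n → ℝ), fun j : s => p.2 j) w' w := by
    intro w w'
    rw [fderiv_clm_apply hd (differentiableAt_const w)]
    simp
  rw [key, key]
  exact (hat.isSymmSndFDerivAt (by simp; norm_cast)) _ _

lemma pdx_zero (μ : Fin n) : pdx μ (0 : LocFn U F) = 0 := by
  have := pdx_algebraMap (U := U) (F := F) μ 0
  rwa [map_zero] at this

lemma pdu_zero (j : Jet0 n F) : pdu j (0 : LocFn U F) = 0 := by
  have := pdu_algebraMap (U := U) j 0
  rwa [map_zero] at this

lemma pdx_coordFn (μ : Fin n) (j : Jet0 n F) : pdx μ (coordFn (U := U) j) = 0 := by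
  classical
  apply Subtype.ext
  funext p
  have hc : ContDiff ℝ ∞ (fun q : (Fin n → ℝ) × (({j} : Finset (Jet0 n F)) → ℝ) =>
    q.2 ⟨j, Finset.mem_singleton_self j⟩) := by fun_prop
  refine Eq.trans (hasDerivAt_pdx (U := U) μ hc.contDiffOn (f := (coordFn (U := U) j).1)
    (fun _ => rfl) p).deriv ?_
  have hl : (fun q : (Fin n → ℝ) × (({j} : Finset (Jet0 n F)) → ℝ) =>
    q.2 ⟨j, Finset.mem_singleton_self j⟩) = ⇑((ContinuousLinearMap.proj
      (R := ℝ) (φ := fun _ : ({j} : Finset (Jet0 n F)) => ℝ)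
      ⟨j, Finset.mem_singleton_self j⟩).comp (ContinuousLinearMap.snd ℝ (Fin n → ℝ) _)) := rfl
  rw [hl, ContinuousLinearMap.fderiv]
  simp

lemma pdu_coordFn (i j : Jet0 n F) [Decidable (i = j)] :
    pdu i (coordFn (U := U) j) = if i = j then 1 else 0 := by
  classical
  apply Subtype.ext
  funext p
  by_cases h : i = j
  · subst h
    rw [if_pos rfl]
    change deriv (fun t : ℝ => Function.update p.2 i t i) (p.2 i) = 1
    simp
  · rw [if_neg h]
    change deriv (fun t : ℝ => Function.update p.2 i t j) (p.2 i) = 0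
    simp [Function.update_of_ne (Ne.symm h)]

/-! ### Graded derivations -/

lemma twist_add (k l : ℤ) (a : Alg U F) : twist (k + l) a = twist k (twist l a) := by
  induction a using alg_induction with
  | hgen g => rw [twist_gen, twist_gen, map_smul, twist_gen, smul_smul, add_mul, sg_add, mul_comm]
  | hconst r => simp
  | hadd a b ha hb => simp [ha, hb]
  | hmul a b ha hb => simp [ha, hb]

/-- Graded commutativity with an element of definite parity. -/
lemma IsParity.mul_comm_twist {i : ℤ} {a : Alg U F} (ha : IsParity i a) (b : Alg U F) :
    a * b = twist i b * a := by
  induction b using alg_induction with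
  | hgen h => rw [ha.mul_gen, twist_gen, smul_mul_assoc, mul_comm h.par]
  | hconst r => rw [AlgHom.commutes, Algebra.commutes]
  | hadd b c hb hc => rw [mul_add, hb, hc, map_add, add_mul]
  | hmul b c hb hc => rw [← mul_assoc, hb, mul_assoc, hc, map_mul, mul_assoc]

lemma IsParity.comm {i l : ℤ} {a b : Alg U F} (ha : IsParity i a) (hb : IsParity l b) :
    a * b = sg (i * l) • (b * a) := by
  rw [ha.mul_comm_twist, hb, smul_mul_assoc]

-- `sub_smul` and `neg_smul` do not unify with the instances of `RingQuot` under `rw` and `simp`.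
lemma alg_sub_smul (r s : ℝ) (a : Alg U F) : (r - s) • a = r • a - s • a := sub_smul r s a

lemma alg_neg_smul (r : ℝ) (a : Alg U F) : (-r) • a = -(r • a) := neg_smul r a

/-- A graded derivation of parity `ε`. -/
structure IsGDer (ε : ℤ) (T : Alg U F →ₗ[ℝ] Alg U F) : Prop where
  map_mul : ∀ a b, T (a * b) = T a * b + twist ε a * T b
  twist_map : ∀ k a, twist k (T a) = sg (k * ε) • T (twist k a)

/-- A graded derivation of parity `ε` that obeys the chain rule on local functions, with
`x^μ ↦ v μ`. -/
structure IsChain (ε : ℤ) (v : Fin n → ℝ) (T : Alg U F →ₗ[ℝ] Alg U F) : Prop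
    extends IsGDer ε T where
  even : v = 0 ∨ Even ε
  map_fn : ∀ f : LocFn U F, T (fn f) =
    ∑ μ, v μ • fn (pdx μ f) + ∑ᶠ j : Jet0 n F, fn (pdu j f) * T (coord j.1)

lemma coord_of_deg_eq_zero (j : Jet0 n F) : (coord j.1 : Alg U F) = fn (coordFn j) := by
  rw [coord, dif_pos j.2]

lemma isParity_coord0 (j : Jet0 n F) : IsParity 0 (coord j.1 : Alg U F) := by
  rw [coord_of_deg_eq_zero]
  exact isParity_fn _

section der
variable {ε : ℤ} {v : Fin n → ℝ} {φ ψ : Jet n F → Alg U F} (hv : v = 0 ∨ Even ε)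
  (hφ : ∀ j, IsParity (F.deg j.1 + ε) (φ j)) (hψ : ∀ j, IsParity (1 + F.deg j.1 + ε) (ψ j))

lemma der_coord (j : Jet n F) : der ε v φ ψ hv hφ hψ (coord j) = φ j := by
  classical
  unfold coord
  split_ifs with h
  · rw [fn, der_gen, derGen]
    simp only [pdx_coordFn, fn_zero, smul_zero, Finset.sum_const_zero, zero_add]
    rw [finsum_eq_single _ (⟨j, h⟩ : Jet0 n F)]
    · rw [pdu_coordFn, if_pos rfl]
      have : (fn (1 : LocFn U F)) = 1 := by simpa using fn_const (U := U) (F := F) 1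
      rw [this, one_mul]
    · intro i hi
      rw [pdu_coordFn, if_neg hi, fn_zero, zero_mul]
  · rw [der_gen, derGen]

lemma der_du (j : Jet n F) : der ε v φ ψ hv hφ hψ (gen (.du j)) = ψ j := by
  rw [der_gen, derGen]

lemma isChain_der : IsChain ε v (der ε v φ ψ hv hφ hψ) where
  map_mul := der_mul hv hφ hψ
  twist_map := twist_der hv hφ hψ
  even := hv
  map_fn f := by
    simp only [der_coord]
    rw [fn, der_gen, derGen]

end der

section chain
variable {ε ε' : ℤ} {v v' : Fin n → ℝ} {T T' : Alg U F →ₗ[ℝ] Alg U F}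

lemma IsGDer.map_algebraMap (h : IsGDer ε T) (r : ℝ) : T (algebraMap ℝ _ r) = 0 := by
  have h1 := h.map_mul 1 1
  simp only [mul_one, one_mul, map_one] at h1
  have h2 : T 1 = 0 := by simpa using h1
  rw [Algebra.algebraMap_eq_smul_one, map_smul, h2, smul_zero]

lemma IsGDer.ext (h : IsGDer ε T) (h' : IsGDer ε T') (hg : ∀ g, T (gen g) = T' (gen g)) :
    T = T' := by
  ext a
  induction a using alg_induction with
  | hgen g => exact hg g
  | hconst r => rw [h.map_algebraMap, h'.map_algebraMap]
  | hadd a b ha hb => rw [map_add, map_add, ha, hb]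
  | hmul a b ha hb => rw [h.map_mul, h'.map_mul, ha, hb]

lemma IsGDer.isParity (h : IsGDer ε T) {i : ℤ} {a : Alg U F} (ha : IsParity i a) :
    IsParity (i + ε) (T a) := fun k => by
  rw [h.twist_map, ha, map_smul, smul_smul, mul_add, sg_add, mul_comm (sg (k * ε))]

lemma IsChain.map_fn_sum (h : IsChain ε v T) (f : LocFn U F) {s : Finset (Jet0 n F)}
    (hs : ∀ j ∉ s, pdu j f = 0) : T (fn f) =
      ∑ μ, v μ • fn (pdx μ f) + ∑ j ∈ s, fn (pdu j f) * T (coord j.1) := by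
  rw [h.map_fn, finsum_eq_sum_of_support_subset]
  intro j hj
  by_contra hjs
  exact hj (by simp only [hs j hjs, fn_zero, zero_mul])

lemma exists_finset_pdu (f : LocFn U F) : ∃ s : Finset (Jet0 n F), ∀ j ∉ s, pdu j f = 0 :=
  ⟨(pdu_finite f).toFinset, fun j hj => by simpa using hj⟩

lemma IsChain.ext (h : IsChain ε v T) (h' : IsChain ε v T')
    (hu : ∀ j, T (coord j) = T' (coord j)) (hdu : ∀ j, T (gen (.du j)) = T' (gen (.du j))) :
    T = T' := by
  refine h.toIsGDer.ext h'.toIsGDer fun g => ?_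
  cases g with
  | fn f =>
    change T (fn f) = T' (fn f)
    rw [h.map_fn, h'.map_fn]
    simp only [hu]
  | u j hj =>
    have := hu j
    rwa [coord, dif_neg hj] at this
  | du j => exact hdu j

lemma IsGDer.add (h : IsGDer ε T) (h' : IsGDer ε T') : IsGDer ε (T + T') where
  map_mul a b := by simp only [LinearMap.add_apply, h.map_mul, h'.map_mul, add_mul, mul_add]; abel
  twist_map k a := by simp [h.twist_map, h'.twist_map]

lemma IsGDer.smul (h : IsGDer ε T) (c : ℝ) : IsGDer ε (c • T) where
  map_mul a b := by simp [h.map_mul, smul_add]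
  twist_map k a := by simp only [LinearMap.smul_apply, map_smul, h.twist_map, smul_comm c]

lemma IsChain.sub (h : IsChain ε v T) (h' : IsChain ε v' T') : IsChain ε (v - v') (T - T') where
  toIsGDer := by
    have e : T - T' = T + (-1 : ℝ) • T' := by
      ext a
      rw [LinearMap.add_apply, LinearMap.smul_apply, alg_neg_smul, one_smul]
      exact sub_eq_add_neg _ _
    exact e ▸ h.toIsGDer.add (h'.toIsGDer.smul (-1))
  even := by
    rcases h.even with rfl | h1
    · rcases h'.even with rfl | h2
      · simp
      · exact Or.inr h2
    · exact Or.inr h1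
  map_fn f := by
    obtain ⟨s, hs⟩ := exists_finset_pdu f
    rw [finsum_eq_sum_of_support_subset (s := s)]
    · rw [LinearMap.sub_apply, h.map_fn_sum f hs, h'.map_fn_sum f hs]
      simp only [Pi.sub_apply, alg_sub_smul, LinearMap.sub_apply, mul_sub, Finset.sum_sub_distrib]
      abel
    · intro j hj
      by_contra hjs
      exact hj (by simp only [hs j hjs, fn_zero, zero_mul])

variable (ε ε' T T') in
/-- The graded commutator of operators of parity `ε` and `ε'`. -/
def gcomm : Alg U F →ₗ[ℝ] Alg U F := T ∘ₗ T' - sg (ε * ε') • (T' ∘ₗ T)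

lemma gcomm_apply (a : Alg U F) : gcomm ε ε' T T' a = T (T' a) - sg (ε * ε') • T' (T a) := rfl

lemma IsGDer.gcomm (h : IsGDer ε T) (h' : IsGDer ε' T') :
    IsGDer (ε + ε') (gcomm ε ε' T T') where
  map_mul a b := by
    have e1 : twist ε (T' a) = sg (ε * ε') • T' (twist ε a) := h'.twist_map ε a
    have e2 : sg (ε * ε') • twist ε' (T a) = T (twist ε' a) := by
      rw [h.twist_map ε' a, smul_smul, mul_comm ε' ε, sg_mul_self, one_smul]
    simp only [gcomm_apply, h.map_mul, h'.map_mul, map_add, smul_add, ← smul_mul_assoc, e1, e2,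
      twist_add, sub_mul, mul_sub]
    rw [twist_twist ε' ε a, mul_smul_comm]
    simp only [smul_mul_assoc]
    abel
  twist_map k a := by
    simp only [gcomm_apply, map_sub, map_smul, h.twist_map, h'.twist_map, smul_sub, mul_add,
      sg_add, smul_smul]
    congr 2
    ring

/-- The graded commutator of derivations that obey the chain rule obeys it again: the terms with
second partial derivatives cancel by symmetry and graded commutativity. -/
lemma IsChain.gcomm (h : IsChain ε v T) (h' : IsChain ε' v' T') :
    IsChain (ε + ε') 0 (gcomm ε ε' T T') where
  toIsGDer := h.toIsGDer.gcomm h'.toIsGDer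
  even := Or.inl rfl
  map_fn f := by
    obtain ⟨s, hs⟩ := exists_finset_pdu f
    have hsu : ∀ i, ∀ j ∉ s, pdu j (pdu i f) = 0 := fun i j hj => by
      rw [(isDirectional_pdu j).comm (isDirectional_pdu i), hs j hj, pdu_zero]
    have hsx : ∀ μ, ∀ j ∉ s, pdu j (pdx μ f) = 0 := fun i j hj => by
      rw [(isDirectional_pdu j).comm (isDirectional_pdx i), hs j hj, pdx_zero]
    rw [finsum_eq_sum_of_support_subset (s := s)]
    swap
    · intro j hj
      by_contra hjs
      exact hj (by simp only [hs j hjs, fn_zero, zero_mul])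
    -- a nonzero `v` forces even parity, so that the mixed second derivatives carry no sign
    have hv : ∀ μ, sg (ε * ε') * v μ = v μ := fun μ => by
      rcases h.even with rfl | he
      · simp
      · rw [sg_even (he.mul_right _), one_mul]
    have hv' : ∀ μ, sg (ε * ε') * v' μ = v' μ := fun μ => by
      rcases h'.even with rfl | he
      · simp
      · rw [sg_even (he.mul_left _), one_mul]
    -- the chain rule applied twice, before the symmetric terms are cancelled
    have expand : ∀ {δ δ' : ℤ} {w w' : Fin n → ℝ} {S S' : Alg U F →ₗ[ℝ] Alg U F},
        IsChain δ w S → IsChain δ' w' S' → S (S' (fn f)) =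
          ∑ μ, ∑ ν, (w' μ * w ν) • fn (pdx ν (pdx μ f)) +
          ∑ μ, ∑ j ∈ s, w' μ • (fn (pdx μ (pdu j f)) * S (coord j.1)) +
          ∑ μ, ∑ j ∈ s, w μ • (fn (pdx μ (pdu j f)) * S' (coord j.1)) +
          ∑ j ∈ s, ∑ i ∈ s, fn (pdu i (pdu j f)) * (S (coord i.1) * S' (coord j.1)) +
          ∑ j ∈ s, fn (pdu j f) * S (S' (coord j.1)) := by
      intro δ δ' w w' S S' hS hS'
      rw [hS'.map_fn_sum f hs, map_add, map_sum, map_sum]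
      simp only [map_smul, hS.map_mul, twist_fn]
      simp only [fun μ => hS.map_fn_sum (pdx μ f) (hsx μ),
        fun j => hS.map_fn_sum (pdu j f) (hsu j), smul_add, add_mul, Finset.sum_add_distrib,
        Finset.smul_sum, Finset.sum_mul, smul_smul, smul_mul_assoc, mul_assoc,
        fun μ j => (isDirectional_pdu (U := U) (F := F) j).comm (isDirectional_pdx μ) f]
      rw [Finset.sum_comm (s := s) (t := Finset.univ)]
      abel
    have hcomm : ∀ i j : Jet0 n F, T (coord i.1) * T' (coord j.1) =
        sg (ε * ε') • (T' (coord j.1) * T (coord i.1)) := fun i j => by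
      have hi : IsParity (0 + ε) (T (coord i.1)) := h.isParity (isParity_coord0 i)
      have hj : IsParity (0 + ε') (T' (coord j.1)) := h'.isParity (isParity_coord0 j)
      simpa using hi.comm hj
    have hxx : ∑ μ, ∑ ν, (v μ * v' ν) • fn (pdx ν (pdx μ f)) =
        ∑ μ, ∑ ν, (v' μ * v ν) • (fn (pdx ν (pdx μ f)) : Alg U F) := by
      rw [Finset.sum_comm]
      refine Finset.sum_congr rfl fun μ _ => Finset.sum_congr rfl fun ν _ => ?_
      rw [mul_comm, (isDirectional_pdx μ).comm (isDirectional_pdx ν)]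
    have huu : ∑ j ∈ s, ∑ i ∈ s, fn (pdu i (pdu j f)) * (T (coord i.1) * T' (coord j.1)) =
        ∑ j ∈ s, ∑ i ∈ s, sg (ε * ε') •
          (fn (pdu i (pdu j f)) * (T' (coord i.1) * T (coord j.1)) : Alg U F) := by
      rw [Finset.sum_comm]
      refine Finset.sum_congr rfl fun i _ => Finset.sum_congr rfl fun j _ => ?_
      rw [hcomm, mul_smul_comm, (isDirectional_pdu i).comm (isDirectional_pdu j)]
    rw [gcomm_apply, expand h h', expand h' h, huu, ← hxx]
    simp only [gcomm_apply, smul_add, Finset.smul_sum, smul_smul, ← mul_assoc, hv, hv', mul_sub,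
      Finset.sum_sub_distrib, mul_smul_comm, Pi.zero_apply, zero_smul, Finset.sum_const_zero,
      zero_add]
    abel

end chain

/-! ### Commutation relations of the basic operators -/

lemma IsChain.graded_commute {ε ε' : ℤ} {v v' : Fin n → ℝ} {T T' : Alg U F →ₗ[ℝ] Alg U F}
    (h : IsChain ε v T) (h' : IsChain ε' v' T')
    (hu : ∀ j, T (T' (coord j)) = sg (ε * ε') • T' (T (coord j)))
    (hdu : ∀ j, T (T' (gen (.du j))) = sg (ε * ε') • T' (T (gen (.du j)))) (a : Alg U F) :
    T (T' a) = sg (ε * ε') • T' (T a) := by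
  have h0 : IsChain (ε + ε') 0 (0 : Alg U F →ₗ[ℝ] Alg U F) :=
    { map_mul := by simp
      twist_map := by simp
      even := Or.inl rfl
      map_fn := by simp }
  have := LinearMap.congr_fun ((h.gcomm h').ext h0
    (fun j => by rw [gcomm_apply, hu, sub_self]; rfl)
    (fun j => by rw [gcomm_apply, hdu, sub_self]; rfl)) a
  exact sub_eq_zero.mp this

lemma isChain_totalD (μ : Fin n) :
    IsChain 0 (Pi.single μ 1) (totalD μ : Alg U F →ₗ[ℝ] Alg U F) := isChain_der _ _ _

lemma totalD_coord (μ : Fin n) (j : Jet n F) : totalD μ (coord j : Alg U F) = coord (j.succ μ) :=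
  der_coord _ _ _ j

lemma totalD_du (μ : Fin n) (j : Jet n F) :
    totalD μ (gen (.du j) : Alg U F) = gen (.du (j.succ μ)) := der_du _ _ _ j

lemma isChain_explicitD (μ : Fin n) :
    IsChain 0 (Pi.single μ 1) (explicitD μ : Alg U F →ₗ[ℝ] Alg U F) := isChain_der _ _ _

lemma explicitD_coord (μ : Fin n) (j : Jet n F) : explicitD μ (coord j : Alg U F) = 0 :=
  der_coord _ _ _ j

lemma explicitD_du (μ : Fin n) (j : Jet n F) : explicitD μ (gen (.du j) : Alg U F) = 0 :=
  der_du _ _ _ j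

lemma isChain_dv : IsChain 1 0 (dv : Alg U F →ₗ[ℝ] Alg U F) := isChain_der _ _ _

lemma dv_coord (j : Jet n F) : dv (coord j : Alg U F) = gen (.du j) := der_coord _ _ _ j

lemma dv_du (j : Jet n F) : dv (gen (.du j) : Alg U F) = 0 := der_du _ _ _ j

lemma isChain_contract {k : ℤ} (X : VField U F k) : IsChain (k - 1) 0 (contract X) :=
  isChain_der _ _ _

lemma contract_coord {k : ℤ} (X : VField U F k) (j : Jet n F) : contract X (coord j) = 0 :=
  der_coord _ _ _ j

lemma contract_du {k : ℤ} (X : VField U F k) (j : Jet n F) :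
    contract X (gen (.du j)) = totalDs j.2 (X.1 j.1) := der_du _ _ _ j

lemma isChain_contractJet (j : Jet n F) :
    IsChain (-1 - F.deg j.1) 0 (contractJet j : Alg U F →ₗ[ℝ] Alg U F) := isChain_der _ _ _

lemma contractJet_coord (i j : Jet n F) : contractJet i (coord j : Alg U F) = 0 :=
  der_coord _ _ _ j

lemma contractJet_du_self (j : Jet n F) : contractJet j (gen (.du j) : Alg U F) = 1 :=
  (der_du _ _ _ j).trans (Pi.single_eq_same _ _)

lemma contractJet_du_of_ne {i j : Jet n F} (h : j ≠ i) :
    contractJet i (gen (.du j) : Alg U F) = 0 :=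
  (der_du _ _ _ j).trans (Pi.single_eq_of_ne h _)

lemma eq_zero_of_eq_neg_self {E : Type*} [AddCommGroup E] [Module ℝ E] {a : E} (h : a = -a) :
    a = 0 := by
  have h2 : (2 : ℝ) • a = 0 := by
    rw [two_smul]
    nth_rewrite 1 [h]
    exact neg_add_cancel _
  simpa using h2

lemma dv_dv (a : Alg U F) : dv (dv a) = 0 := by
  have h := isChain_dv.graded_commute (isChain_dv (U := U) (F := F))
    (fun j => by simp [dv_coord, dv_du]) (fun j => by simp [dv_du]) a
  have h1 : sg (1 * 1) = -1 := by simp [sg]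
  rw [h1, alg_neg_smul, one_smul] at h
  exact eq_zero_of_eq_neg_self h

lemma dv_totalD (μ : Fin n) (a : Alg U F) : dv (totalD μ a) = totalD μ (dv a) := by
  have h := isChain_dv.graded_commute (isChain_totalD (U := U) (F := F) μ)
    (fun j => by simp [dv_coord, totalD_coord, totalD_du])
    (fun j => by simp [dv_du, totalD_du]) a
  simpa using h

lemma totalD_comm (μ ν : Fin n) (a : Alg U F) :
    totalD μ (totalD ν a) = totalD ν (totalD μ a) := by
  have hs : ∀ j : Jet n F, (j.succ ν).succ μ = (j.succ μ).succ ν := fun j => by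
    simp [Jet.succ, add_right_comm]
  have h := (isChain_totalD (U := U) (F := F) μ).graded_commute (isChain_totalD ν)
    (fun j => by simp [totalD_coord, hs]) (fun j => by simp [totalD_du, hs]) a
  simpa using h

lemma explicitD_totalD (μ ν : Fin n) (a : Alg U F) :
    explicitD μ (totalD ν a) = totalD ν (explicitD μ a) := by
  have h := (isChain_explicitD (U := U) (F := F) μ).graded_commute (isChain_totalD ν)
    (fun j => by simp [totalD_coord, explicitD_coord])
    (fun j => by simp [totalD_du, explicitD_du]) a
  simpa using h

lemma explicitD_dv (μ : Fin n) (a : Alg U F) : explicitD μ (dv a) = dv (explicitD μ a) := by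
  have h := (isChain_explicitD (U := U) (F := F) μ).graded_commute isChain_dv
    (fun j => by simp [dv_coord, explicitD_coord, explicitD_du])
    (fun j => by simp [dv_du, explicitD_du]) a
  simpa using h

/-! ### Iterated total derivatives -/

lemma map_totalDs {F' : Fields} {T : Alg U F → Alg U F'}
    (hT : ∀ μ a, T (totalD μ a) = totalD μ (T a)) (I : Fin n → ℕ) (a : Alg U F) :
    T (totalDs I a) = totalDs I (T a) := by
  unfold totalDs
  induction List.finRange n with
  | nil => rfl
  | cons μ l ih =>
    rw [List.foldr_cons, List.foldr_cons, ← ih]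
    exact Function.Semiconj.iterate_right (f := T) (ga := totalD μ) (gb := totalD μ) (hT μ) (I μ) _

lemma totalDs_map_zero (I : Fin n → ℕ) : totalDs I (0 : Alg U F) = 0 :=
  (map_totalDs (T := fun _ : Alg U F => (0 : Alg U F)) (by simp) I 0).symm

/-- The order of differentiation chosen in the definition of `D_I` is immaterial. -/
lemma totalDs_add_single (I : Fin n → ℕ) (μ : Fin n) (a : Alg U F) :
    totalDs (I + Pi.single μ 1) a = totalD μ (totalDs I a) := by
  have key : ∀ l : List (Fin n), l.Nodup →
      l.foldr (fun ν b => (totalD ν)^[(I + Pi.single μ 1 : Fin n → ℕ) ν] b) a =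
        if μ ∈ l then totalD μ (l.foldr (fun ν b => (totalD ν)^[I ν] b) a)
        else l.foldr (fun ν b => (totalD ν)^[I ν] b) a := by
    intro l
    induction l with
    | nil => simp
    | cons ν l ih =>
      intro hl
      rw [List.nodup_cons] at hl
      rw [List.foldr_cons, List.foldr_cons, ih hl.2]
      by_cases h : ν = μ
      · subst h
        rw [if_neg hl.1, if_pos List.mem_cons_self, Pi.add_apply, Pi.single_eq_same,
          Function.iterate_succ_apply']
      · have e : (I + Pi.single μ 1 : Fin n → ℕ) ν = I ν := by simp [Pi.single_eq_of_ne h]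
        rw [e]
        by_cases hm : μ ∈ l
        · rw [if_pos hm, if_pos (List.mem_cons_of_mem _ hm)]
          exact (Function.Semiconj.iterate_right (f := totalD μ) (ga := totalD ν)
            (gb := totalD ν) (totalD_comm μ ν) (I ν) _).symm
        · rw [if_neg hm, if_neg]
          simp [hm, Ne.symm h]
  have := key _ (List.nodup_finRange n)
  rwa [if_pos (List.mem_finRange μ)] at this

lemma totalDs_zero (a : Alg U F) : totalDs 0 a = a := by
  unfold totalDs
  induction List.finRange n with
  | nil => rfl
  | cons μ l ih => rw [List.foldr_cons, ih]; rfl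

/-- Induction on multi-indices. -/
lemma multiIndex_induction {P : (Fin n → ℕ) → Prop} (h0 : P 0)
    (hs : ∀ I μ, P I → P (I + Pi.single μ 1)) (I : Fin n → ℕ) : P I := by
  induction h : ∑ μ, I μ generalizing I with
  | zero =>
    have : I = 0 := by
      funext μ
      exact (Finset.sum_eq_zero_iff.mp h) μ (Finset.mem_univ μ)
    exact this ▸ h0
  | succ k ih =>
    obtain ⟨μ, -, hμ⟩ : ∃ μ ∈ Finset.univ, I μ ≠ 0 := by
      by_contra! hc
      rw [Finset.sum_eq_zero hc] at h
      omega
    have e : I - Pi.single μ 1 + Pi.single μ 1 = I := by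
      funext ν
      by_cases hν : ν = μ
      · subst hν; simp; omega
      · simp [Pi.single_eq_of_ne hν]
    rw [← e]
    refine hs _ μ (ih _ ?_)
    have h2 : ∑ ν, (I - Pi.single μ 1 + Pi.single μ 1 : Fin n → ℕ) ν = k + 1 := by rw [e, h]
    simpa [Finset.sum_add_distrib] using h2

lemma totalDs_coord (I : Fin n → ℕ) (a : F.Idx) :
    totalDs I (coord (a, 0) : Alg U F) = coord (a, I) := by
  induction I using multiIndex_induction with
  | h0 => exact totalDs_zero _
  | hs I μ ih => rw [totalDs_add_single, ih, totalD_coord]; rfl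

lemma contract_totalD {k : ℤ} (X : VField U F k) (μ : Fin n) (a : Alg U F) :
    contract X (totalD μ a) = totalD μ (contract X a) := by
  have h := (isChain_contract X).graded_commute (isChain_totalD μ)
    (fun j => by simp [totalD_coord, contract_coord])
    (fun j => by simp [totalD_du, contract_du, Jet.succ, totalDs_add_single]) a
  simpa using h

/-! ### Evolutionary derivations -/

/-- A derivation of the algebra of vertical forms that commutes with the total derivatives and, in
the graded sense, with `d_v`; such derivations are the Lie derivatives along vertical local vector
fields. -/
structure IsEvol (k : ℤ) (T : Alg U F →ₗ[ℝ] Alg U F) : Prop extends IsChain k 0 T where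
  map_totalD : ∀ μ a, T (totalD μ a) = totalD μ (T a)
  map_dv : ∀ a, T (dv a) = sg k • dv (T a)

/-- An evolutionary derivation is determined by its values on the fields. -/
lemma IsEvol.ext {k : ℤ} {T T' : Alg U F →ₗ[ℝ] Alg U F} (h : IsEvol k T) (h' : IsEvol k T')
    (h0 : ∀ a, T (coord (a, 0)) = T' (coord (a, 0))) : T = T' := by
  have hc : ∀ j, T (coord j) = T' (coord j) := by
    rintro ⟨a, I⟩
    rw [← totalDs_coord, map_totalDs h.map_totalD, map_totalDs h'.map_totalD, h0]
  refine h.toIsChain.ext h'.toIsChain hc fun j => ?_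
  rw [← dv_coord, h.map_dv, h'.map_dv, hc]

lemma isEvol_zero (k : ℤ) : IsEvol k (0 : Alg U F →ₗ[ℝ] Alg U F) where
  map_mul := by simp
  twist_map := by simp
  even := Or.inl rfl
  map_fn := by simp
  map_totalD := by simp
  map_dv := by simp

lemma lie_apply {k : ℤ} (X : VField U F k) (a : Alg U F) :
    lie X a = contract X (dv a) + sg k • dv (contract X a) := rfl

lemma sg_sub_one (k : ℤ) : sg (k - 1) = -sg k := by
  rw [sg, sg, zpow_sub_one₀ (by norm_num)]; norm_num

lemma lie_totalD {k : ℤ} (X : VField U F k) (μ : Fin n) (a : Alg U F) :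
    lie X (totalD μ a) = totalD μ (lie X a) := by
  simp only [lie_apply, dv_totalD, contract_totalD, map_add, map_smul]

lemma lie_dv {k : ℤ} (X : VField U F k) (a : Alg U F) : lie X (dv a) = sg k • dv (lie X a) := by
  simp [lie_apply, dv_dv]

lemma isEvol_lie {k : ℤ} (X : VField U F k) : IsEvol k (lie X) where
  toIsChain := by
    have h := (isChain_contract X).gcomm isChain_dv
    have e : gcomm (k - 1) 1 (contract X) dv = lie X := by
      ext a
      rw [gcomm_apply, lie_apply, mul_one, sg_sub_one, alg_neg_smul, sub_neg_eq_add]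
    rwa [e, sub_add_cancel] at h
  map_totalD := lie_totalD X
  map_dv := lie_dv X

lemma lie_coord {k : ℤ} (X : VField U F k) (j : Jet n F) :
    lie X (coord j) = totalDs j.2 (X.1 j.1) := by
  rw [lie_apply, dv_coord, contract_du, contract_coord, map_zero, smul_zero, add_zero]

lemma lie_coord_zero {k : ℤ} (X : VField U F k) (a : F.Idx) : lie X (coord (a, 0)) = X.1 a := by
  rw [lie_coord, totalDs_zero]

lemma IsEvol.gcomm {k l : ℤ} {T T' : Alg U F →ₗ[ℝ] Alg U F} (h : IsEvol k T) (h' : IsEvol l T') :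
    IsEvol (k + l) (gcomm k l T T') where
  toIsChain := h.toIsChain.gcomm h'.toIsChain
  map_totalD μ a := by simp [gcomm_apply, h.map_totalD, h'.map_totalD]
  map_dv a := by
    simp only [gcomm_apply, h.map_dv, h'.map_dv, map_smul, map_sub, smul_sub, smul_smul, sg_add]
    congr 2
    · ring
    · ring

/-- The graded commutator of Lie derivatives is the Lie derivative along the bracket. -/
lemma lie_lie_of_bracket_eq {k l m : ℤ} {X : VField U F k} {Y : VField U F l} {Z : VField U F m}
    (hm : k + l = m) (h : bracket X Y = Z.1) (a : Alg U F) :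
    lie X (lie Y a) = sg (k * l) • lie Y (lie X a) + lie Z a := by
  subst hm
  have := LinearMap.congr_fun (((isEvol_lie X).gcomm (isEvol_lie Y)).ext (isEvol_lie Z)
    (fun a => by
      rw [gcomm_apply, lie_coord_zero, lie_coord_zero, lie_coord_zero, ← h, bracket])) a
  rw [← this, gcomm_apply]
  exact (add_sub_cancel _ _).symm

lemma lie_lie_of_bracket_eq_zero {k l : ℤ} {X : VField U F k} {Y : VField U F l}
    (h : bracket X Y = 0) (a : Alg U F) : lie X (lie Y a) = sg (k * l) • lie Y (lie X a) := by
  have := lie_lie_of_bracket_eq (Z := 0) rfl h a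
  have h0 : lie (0 : VField U F (k + l)) = 0 :=
    (isEvol_lie _).ext (isEvol_zero _) fun a => by rw [lie_coord_zero]; rfl
  rwa [h0, LinearMap.zero_apply, add_zero] at this

lemma lie_lie_self {Q : VField U F 1} (h : bracket Q Q = 0) (a : Alg U F) :
    lie Q (lie Q a) = 0 := by
  have h1 := lie_lie_of_bracket_eq_zero h a
  have h2 : sg (1 * 1) = -1 := by simp [sg]
  rw [h2, alg_neg_smul, one_smul] at h1
  exact eq_zero_of_eq_neg_self h1

/-- Vector fields whose components do not depend explicitly on `x^μ` have Lie derivatives that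
commute with the explicit derivative. -/
lemma explicitD_lie {k : ℤ} {X : VField U F k} {μ : Fin n} (h : ∀ a, explicitD μ (X.1 a) = 0)
    (a : Alg U F) : explicitD μ (lie X a) = lie X (explicitD μ a) := by
  have hc : ∀ j : Jet n F, explicitD μ (lie X (coord j)) = 0 := fun j => by
    rw [lie_coord, map_totalDs (explicitD_totalD μ), h, totalDs_map_zero]
  have h := (isChain_explicitD μ).graded_commute (isEvol_lie X).toIsChain
    (fun j => by rw [hc, explicitD_coord, map_zero, smul_zero])
    (fun j => by
      rw [explicitD_du, map_zero, smul_zero, ← dv_coord, lie_dv, map_smul, explicitD_dv, hc,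
        map_zero, smul_zero]) a
  simpa using h

/-! ### Bidegrees -/

lemma mem_bideg_congr {q r q' r' : ℤ} {a : Alg U F} (h : a ∈ bideg U F q r) (hq : q = q')
    (hr : r = r') : a ∈ bideg U F q' r' := hq ▸ hr ▸ h

lemma list_mem_bideg (l : List (Gen U F)) :
    (l.map gen).prod ∈ bideg U F (l.map Gen.vdeg).sum (l.map Gen.gdeg).sum :=
  Submodule.subset_span ⟨l, rfl, rfl, rfl⟩

lemma gen_mem_bideg (g : Gen U F) : gen g ∈ bideg U F g.vdeg g.gdeg := by
  simpa using list_mem_bideg [g]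

lemma one_mem_bideg : (1 : Alg U F) ∈ bideg U F 0 0 := by
  simpa using list_mem_bideg ([] : List (Gen U F))

lemma fn_mem_bideg (f : LocFn U F) : fn f ∈ bideg U F 0 0 := gen_mem_bideg (.fn f)

lemma du_mem_bideg (j : Jet n F) : gen (.du j) ∈ bideg U F 1 (F.deg j.1) := gen_mem_bideg (.du j)

lemma mul_mem_bideg {q r q' r' : ℤ} {a b : Alg U F} (ha : a ∈ bideg U F q r)
    (hb : b ∈ bideg U F q' r') : a * b ∈ bideg U F (q + q') (r + r') := by
  induction ha using Submodule.span_induction with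
  | mem a h =>
    obtain ⟨l, rfl, rfl, rfl⟩ := h
    induction hb using Submodule.span_induction with
    | mem b h =>
      obtain ⟨l', rfl, rfl, rfl⟩ := h
      simpa using list_mem_bideg (l ++ l')
    | zero => rw [mul_zero]; exact Submodule.zero_mem _
    | add b c _ _ hb hc => rw [mul_add]; exact Submodule.add_mem _ hb hc
    | smul c b _ hb => rw [mul_smul_comm]; exact Submodule.smul_mem _ _ hb
  | zero => rw [zero_mul]; exact Submodule.zero_mem _
  | add b c _ _ hb hc => rw [add_mul]; exact Submodule.add_mem _ hb hc
  | smul c b _ hb => rw [smul_mul_assoc]; exact Submodule.smul_mem _ _ hb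

lemma coord_mem_bideg (j : Jet n F) : coord j ∈ bideg U F 0 (F.deg j.1) := by
  unfold coord
  split_ifs with h
  · rw [h]; exact fn_mem_bideg _
  · exact gen_mem_bideg (.u j h)

lemma twist_mem_bideg (k : ℤ) {q r : ℤ} {a : Alg U F} (ha : a ∈ bideg U F q r) :
    twist k a ∈ bideg U F q r := by
  rw [isParity_of_mem_bideg ha]
  exact Submodule.smul_mem _ _ ha

/-- There are no forms of negative vertical degree. -/
lemma eq_zero_of_mem_bideg_neg {q r : ℤ} (hq : q < 0) {a : Alg U F} (ha : a ∈ bideg U F q r) :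
    a = 0 := by
  induction ha using Submodule.span_induction with
  | mem a h =>
    obtain ⟨l, hl, -, -⟩ := h
    have : 0 ≤ (l.map Gen.vdeg).sum := List.sum_nonneg fun x hx => by
      obtain ⟨g, -, rfl⟩ := List.mem_map.mp hx
      cases g <;> simp [Gen.vdeg]
    omega
  | zero => rfl
  | add a b _ _ ha hb => rw [ha, hb, add_zero]
  | smul c a _ ha => rw [ha, smul_zero]

/-- The bidegree of a derivation can be read off from its values on coordinates and their
differentials. -/
lemma IsChain.mem_bideg {ε p s : ℤ} {v : Fin n → ℝ} {T : Alg U F →ₗ[ℝ] Alg U F}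
    (h : IsChain ε v T) (hv : v = 0 ∨ p = 0 ∧ s = 0)
    (hu : ∀ j, T (coord j) ∈ bideg U F p (F.deg j.1 + s))
    (hdu : ∀ j, T (gen (.du j)) ∈ bideg U F (1 + p) (F.deg j.1 + s)) {q r : ℤ} {a : Alg U F}
    (ha : a ∈ bideg U F q r) : T a ∈ bideg U F (q + p) (r + s) := by
  have hg : ∀ g : Gen U F, T (gen g) ∈ bideg U F (g.vdeg + p) (g.gdeg + s) := by
    intro g
    cases g with
    | fn f =>
      change T (fn f) ∈ bideg U F (0 + p) (0 + s)
      rw [h.map_fn, zero_add, zero_add]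
      refine Submodule.add_mem _ ?_ ?_
      · rcases hv with rfl | ⟨rfl, rfl⟩
        · simp
        · exact Submodule.sum_mem _ fun μ _ => Submodule.smul_mem _ _ (fn_mem_bideg _)
      · refine finsum_induction (· ∈ bideg U F p s) (Submodule.zero_mem _)
          (fun _ _ => Submodule.add_mem _) fun j => ?_
        exact mem_bideg_congr (mul_mem_bideg (fn_mem_bideg _) (hu j.1)) (zero_add p)
          (by rw [j.2]; ring)
    | u j hj =>
      have := hu j
      rw [coord, dif_neg hj] at this
      exact mem_bideg_congr this (zero_add p).symm rfl
    | du j => exact hdu j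
  induction ha using Submodule.span_induction with
  | mem a hl =>
    obtain ⟨l, rfl, rfl, rfl⟩ := hl
    induction l with
    | nil =>
      have := h.map_algebraMap 1
      rw [map_one] at this
      simp [this]
    | cons g l ih =>
      simp only [List.map_cons, List.prod_cons, List.sum_cons, h.map_mul]
      refine Submodule.add_mem _ ?_ ?_
      · exact mem_bideg_congr (mul_mem_bideg (hg g) (list_mem_bideg l)) (by ring) (by ring)
      · exact mem_bideg_congr (mul_mem_bideg (twist_mem_bideg _ (gen_mem_bideg g)) ih)
          (by ring) (by ring)
  | zero => rw [map_zero]; exact Submodule.zero_mem _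
  | add a b _ _ ha hb => rw [map_add]; exact Submodule.add_mem _ ha hb
  | smul c a _ ha => rw [map_smul]; exact Submodule.smul_mem _ _ ha

lemma totalD_mem_bideg (μ : Fin n) {q r : ℤ} {a : Alg U F} (ha : a ∈ bideg U F q r) :
    totalD μ a ∈ bideg U F q r := by
  have := (isChain_totalD (U := U) (F := F) μ).mem_bideg (p := 0) (s := 0) (Or.inr ⟨rfl, rfl⟩)
    (fun j => by rw [totalD_coord, add_zero]; exact coord_mem_bideg (j.succ μ))
    (fun j => by rw [totalD_du, add_zero, add_zero]; exact du_mem_bideg (j.succ μ)) ha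
  rwa [add_zero, add_zero] at this

lemma totalDs_mem_bideg (I : Fin n → ℕ) {q r : ℤ} {a : Alg U F} (ha : a ∈ bideg U F q r) :
    totalDs I a ∈ bideg U F q r := by
  induction I using multiIndex_induction with
  | h0 => rwa [totalDs_zero]
  | hs I μ ih => rw [totalDs_add_single]; exact totalD_mem_bideg μ ih

lemma dv_mem_bideg {q r : ℤ} {a : Alg U F} (ha : a ∈ bideg U F q r) :
    dv a ∈ bideg U F (q + 1) r := by
  have := (isChain_dv (U := U) (F := F)).mem_bideg (p := 1) (s := 0) (Or.inl rfl)
    (fun j => by rw [dv_coord, add_zero]; exact du_mem_bideg j)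
    (fun j => by rw [dv_du]; exact Submodule.zero_mem _) ha
  rwa [add_zero] at this

lemma VField.mem_bideg {k : ℤ} (X : VField U F k) (a : F.Idx) :
    X.1 a ∈ bideg U F 0 (F.deg a + k) := X.2 a trivial

lemma contract_mem_bideg {k : ℤ} (X : VField U F k) {q r : ℤ} {a : Alg U F}
    (ha : a ∈ bideg U F q r) : contract X a ∈ bideg U F (q - 1) (r + k) :=
  (isChain_contract X).mem_bideg (p := -1) (s := k) (Or.inl rfl)
    (fun j => by rw [contract_coord]; exact Submodule.zero_mem _)
    (fun j => by rw [contract_du]; exact totalDs_mem_bideg _ (VField.mem_bideg X _)) ha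

lemma contract_eq_zero {k : ℤ} (X : VField U F k) {r : ℤ} {a : Alg U F}
    (ha : a ∈ bideg U F 0 r) : contract X a = 0 :=
  eq_zero_of_mem_bideg_neg (by norm_num) (contract_mem_bideg X ha)

lemma lie_mem_bideg {k : ℤ} (X : VField U F k) {q r : ℤ} {a : Alg U F}
    (ha : a ∈ bideg U F q r) : lie X a ∈ bideg U F q (r + k) :=
  Submodule.add_mem _
    (mem_bideg_congr (contract_mem_bideg X (dv_mem_bideg ha)) (by ring) rfl)
    (Submodule.smul_mem _ _
      (mem_bideg_congr (dv_mem_bideg (contract_mem_bideg X ha)) (by ring) rfl))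

lemma lie_eq_contract_dv {k : ℤ} (X : VField U F k) {r : ℤ} {a : Alg U F}
    (ha : a ∈ bideg U F 0 r) : lie X a = contract X (dv a) := by
  rw [lie_apply, contract_eq_zero X ha, map_zero, smul_zero, add_zero]

lemma contractJet_mem_bideg (j : Jet n F) {q r : ℤ} {a : Alg U F} (ha : a ∈ bideg U F q r) :
    contractJet j a ∈ bideg U F (q - 1) (r - F.deg j.1) := by
  refine (isChain_contractJet j).mem_bideg (p := -1) (s := -F.deg j.1) (Or.inl rfl)
    (fun i => by rw [contractJet_coord]; exact Submodule.zero_mem _) (fun i => ?_) ha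
  by_cases h : i = j
  · subst h
    rw [contractJet_du_self]
    exact mem_bideg_congr one_mem_bideg (by ring) (by ring)
  · rw [contractJet_du_of_ne h]
    exact Submodule.zero_mem _

lemma contractJet_eq_zero (j : Jet n F) {r : ℤ} {a : Alg U F} (ha : a ∈ bideg U F 0 r) :
    contractJet j a = 0 :=
  eq_zero_of_mem_bideg_neg (by norm_num) (contractJet_mem_bideg j ha)

lemma twist_zero (a : Alg U F) : twist 0 a = a := by
  induction a using alg_induction with
  | hgen g => simp [twist_gen]
  | hconst r => simp
  | hadd a b ha hb => rw [map_add, ha, hb]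
  | hmul a b ha hb => rw [map_mul, ha, hb]

variable (U F) in
/-- The Euler vector field of the ghost grading. -/
def ghostEuler : VField U F 0 :=
  ⟨fun a => (F.deg a : ℝ) • coord (a, 0), fun a _ =>
    mem_bideg_congr (Submodule.smul_mem _ _ (coord_mem_bideg (a, 0))) rfl (add_zero _).symm⟩

/-- The Euler vector field of the ghost grading counts the ghost number. -/
lemma lie_ghostEuler {q r : ℤ} {a : Alg U F} (ha : a ∈ bideg U F q r) :
    lie (ghostEuler U F) a = (r : ℝ) • a := by
  have hch := (isEvol_lie (ghostEuler U F)).toIsChain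
  have hc : ∀ j, lie (ghostEuler U F) (coord j) = (F.deg j.1 : ℝ) • coord j := by
    rintro ⟨a, I⟩
    rw [lie_coord]
    change totalDs I ((F.deg a : ℝ) • coord (a, 0)) = _
    rw [← map_totalDs (T := fun b : Alg U F => (F.deg a : ℝ) • b) (by simp), totalDs_coord]
  have hg : ∀ g : Gen U F, lie (ghostEuler U F) (gen g) = (g.gdeg : ℝ) • gen g := by
    intro g
    cases g with
    | fn f =>
      change lie (ghostEuler U F) (fn f) = ((0 : ℤ) : ℝ) • fn f
      rw [hch.map_fn]
      simp only [hc, fun j : Jet0 n F => j.2]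
      simp
    | u j hj =>
      have := hc j
      rwa [coord, dif_neg hj] at this
    | du j =>
      change _ = (F.deg j.1 : ℝ) • gen (.du j)
      rw [← dv_coord, lie_dv, hc, map_smul, sg_zero, one_smul]
  induction ha using Submodule.span_induction with
  | mem a hl =>
    obtain ⟨l, rfl, rfl, rfl⟩ := hl
    induction l with
    | nil =>
      have := hch.map_algebraMap 1
      rw [map_one] at this
      simp [this]
    | cons g l ih =>
      simp only [List.map_cons, List.prod_cons, List.sum_cons, hch.map_mul, hg, ih, twist_zero,
        Int.cast_add, add_smul, smul_mul_assoc, mul_smul_comm]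
  | zero => rw [map_zero, smul_zero]
  | add a b _ _ ha hb => rw [map_add, ha, hb, smul_add]
  | smul c a _ ha => rw [map_smul, ha, smul_comm]

/-- On forms of vertical degree zero and nonzero ghost number `d_v` is injective, because the Euler
vector field of the ghost grading inverts it up to the ghost number. -/
lemma eq_zero_of_dv_eq_zero {r : ℤ} (hr : r ≠ 0) {a : Alg U F} (ha : a ∈ bideg U F 0 r)
    (h : dv a = 0) : a = 0 := by
  have h1 := lie_ghostEuler ha
  rw [lie_eq_contract_dv _ ha, h, map_zero] at h1
  have hr' : (r : ℝ) ≠ 0 := by exact_mod_cast hr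
  have h2 := congrArg ((r : ℝ)⁻¹ • ·) h1.symm
  simpa [smul_smul, inv_mul_cancel₀ hr'] using h2

/-! ### Inclusions of fields -/

section pull
variable {F' : Fields} (e : Fields.Hom F F')

lemma pullAlg_gen (g : Gen U F) : pullAlg e (gen g) = gen (pullGen e g) := liftAlg_gen _ _ _ _ _ g

lemma pullAlg_fn (f : LocFn U F) : pullAlg e (fn f) = fn (pullFn e f) := pullAlg_gen e (.fn f)

lemma pullAlg_du (j : Jet n F) :
    pullAlg e (gen (.du j) : Alg U F) = gen (.du (e.jet j)) := pullAlg_gen e (.du j)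

lemma pullAlg_coord (j : Jet n F) : pullAlg e (coord j : Alg U F) = coord (e.jet j) := by
  unfold coord
  split_ifs with h h' h'
  · exact pullAlg_fn e _
  · exact absurd ((e.deg_eq _).trans h) h'
  · exact absurd ((e.deg_eq _).symm.trans h') h
  · exact pullAlg_gen e _

lemma pullAlg_twist (k : ℤ) (a : Alg U F) : pullAlg e (twist k a) = twist k (pullAlg e a) := by
  induction a using alg_induction with
  | hgen g => rw [twist_gen, map_smul, pullAlg_gen, twist_gen, pullGen_par]
  | hconst r => simp
  | hadd a b ha hb => simp [ha, hb]
  | hmul a b ha hb => simp [ha, hb]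

lemma pullAlg_mem_bideg {q r : ℤ} {a : Alg U F} (ha : a ∈ bideg U F q r) :
    pullAlg e a ∈ bideg U F' q r := by
  induction ha using Submodule.span_induction with
  | mem a h =>
    obtain ⟨l, rfl, rfl, rfl⟩ := h
    refine Submodule.subset_span ⟨l.map (pullGen e), ?_, ?_, ?_⟩
    · rw [List.map_map]
      congr 2
      funext g
      cases g <;> rfl
    · rw [List.map_map]
      congr 2
      funext g
      cases g <;> simp [pullGen, Gen.gdeg, Fields.Hom.jet, e.deg_eq]
    · rw [List.map_map, map_list_prod, List.map_map]
      congr 2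
      funext g
      exact (pullAlg_gen e g).symm
  | zero => rw [map_zero]; exact Submodule.zero_mem _
  | add a b _ _ ha hb => rw [map_add]; exact Submodule.add_mem _ ha hb
  | smul c a _ ha => rw [map_smul]; exact Submodule.smul_mem _ _ ha

lemma pullFn_zero : pullFn e (0 : LocFn U F) = 0 := rfl

variable {e} (he : Function.Injective e.toFun)
include he

lemma jet0_injective : Function.Injective (e.jet0 (n := n)) := by
  rintro ⟨⟨a, I⟩, h⟩ ⟨⟨a', I'⟩, h'⟩ hh
  have h1 := congrArg Subtype.val hh
  simp only [Fields.Hom.jet0, Fields.Hom.jet, Prod.mk.injEq] at h1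
  obtain ⟨h2, rfl⟩ := h1
  obtain rfl := he h2
  rfl

lemma pdu_pullFn (j : Jet0 n F) (f : LocFn U F) :
    pdu (e.jet0 j) (pullFn e f) = pullFn e (pdu j f) := by
  classical
  apply Subtype.ext
  funext p
  change deriv (fun t : ℝ => f.1 (p.1, fun i => Function.update p.2 (e.jet0 j) t (e.jet0 i))) _ =
    deriv (fun t : ℝ => f.1 (p.1, Function.update (fun i => p.2 (e.jet0 i)) j t)) _
  congr 1
  funext t
  exact congrArg (fun q => f.1 (p.1, q))
    (Function.update_comp_eq_of_injective p.2 (jet0_injective he) j t)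

omit he in
lemma pdu_pullFn_of_notMem {j : Jet0 n F'} (hj : j ∉ Set.range (e.jet0 (n := n)))
    (f : LocFn U F) : pdu j (pullFn e f) = 0 := by
  classical
  apply Subtype.ext
  funext p
  change deriv (fun t : ℝ => f.1 (p.1, fun i => Function.update p.2 j t (e.jet0 i))) _ = 0
  have : ∀ t, (fun i => Function.update p.2 j t (e.jet0 i)) = fun i => p.2 (e.jet0 i) :=
    fun t => Function.update_comp_eq_of_notMem_range p.2 t hj
  simp only [this]
  exact deriv_const _ _

/-- Derivations that correspond to each other on the coordinates are intertwined by the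
pullback. -/
lemma pullAlg_intertwine {ε : ℤ} {v : Fin n → ℝ} {T : Alg U F →ₗ[ℝ] Alg U F}
    {T' : Alg U F' →ₗ[ℝ] Alg U F'} (h : IsChain ε v T) (h' : IsChain ε v T')
    (hu : ∀ j, T' (coord (e.jet j)) = pullAlg e (T (coord j)))
    (hdu : ∀ j, T' (gen (.du (e.jet j))) = pullAlg e (T (gen (.du j)))) (a : Alg U F) :
    pullAlg e (T a) = T' (pullAlg e a) := by
  classical
  induction a using alg_induction with
  | hgen g =>
    cases g with
    | fn f =>
      change pullAlg e (T (fn f)) = T' (pullAlg e (fn f))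
      obtain ⟨s, hs⟩ := exists_finset_pdu f
      have hs' : ∀ j ∉ s.map ⟨e.jet0, jet0_injective he⟩, pdu j (pullFn e f) = 0 := by
        intro j hj
        by_cases hr : j ∈ Set.range (e.jet0 (n := n))
        · obtain ⟨i, rfl⟩ := hr
          rw [pdu_pullFn he, hs i (fun hi => hj (Finset.mem_map_of_mem _ hi)), pullFn_zero]
        · exact pdu_pullFn_of_notMem hr f
      rw [pullAlg_fn, h.map_fn_sum f hs, h'.map_fn_sum _ hs', Finset.sum_map]
      simp only [map_add, map_sum, map_smul, map_mul, pullAlg_fn, Function.Embedding.coeFn_mk,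
        pdu_pullFn he]
      congr 1
      exact Finset.sum_congr rfl fun j _ => by rw [← hu]; rfl
    | u j hj =>
      have := hu j
      rw [← pullAlg_coord, coord, dif_neg hj] at this
      exact this.symm
    | du j =>
      rw [← hdu, pullAlg_du]
  | hconst r => rw [h.map_algebraMap, AlgHom.commutes, h'.map_algebraMap, map_zero]
  | hadd a b ha hb => simp [ha, hb]
  | hmul a b ha hb => rw [h.map_mul, map_mul, h'.map_mul, map_add, map_mul, map_mul, ha, hb,
      pullAlg_twist]

lemma pullAlg_totalD (μ : Fin n) (a : Alg U F) :
    pullAlg e (totalD μ a) = totalD μ (pullAlg e a) :=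
  pullAlg_intertwine he (isChain_totalD μ) (isChain_totalD μ)
    (fun j => by rw [totalD_coord, totalD_coord, pullAlg_coord]; rfl)
    (fun j => by rw [totalD_du, totalD_du, pullAlg_du]; rfl) a

lemma pullAlg_dv (a : Alg U F) : pullAlg e (dv a) = dv (pullAlg e a) :=
  pullAlg_intertwine he isChain_dv isChain_dv
    (fun j => by rw [dv_coord, dv_coord, pullAlg_du])
    (fun j => by rw [dv_du, dv_du, map_zero]) a

lemma pullAlg_contract {k : ℤ} {X : VField U F k} {X' : VField U F' k}
    (hX : ∀ a, X'.1 (e.toFun a) = pullAlg e (X.1 a)) (a : Alg U F) :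
    pullAlg e (contract X a) = contract X' (pullAlg e a) :=
  pullAlg_intertwine he (isChain_contract X) (isChain_contract X')
    (fun j => by rw [contract_coord, contract_coord, map_zero])
    (fun j => by
      rw [contract_du, contract_du, map_totalDs (T := pullAlg e) (pullAlg_totalD he), ← hX]; rfl) a

lemma pullAlg_lie {k : ℤ} {X : VField U F k} {X' : VField U F' k}
    (hX : ∀ a, X'.1 (e.toFun a) = pullAlg e (X.1 a)) (a : Alg U F) :
    pullAlg e (lie X a) = lie X' (pullAlg e a) := by
  rw [lie_apply, lie_apply, map_add, map_smul, pullAlg_dv he, pullAlg_contract he hX,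
    pullAlg_contract he hX, pullAlg_dv he]

end pull

/-! ### Restriction to the zero section -/

section restrict
variable {F' : Fields} {e : Fields.Hom F F'}

lemma jet_injective (he : Function.Injective e.toFun) : Function.Injective (e.jet (n := n)) := by
  rintro ⟨a, I⟩ ⟨a', I'⟩ hh
  simp only [Fields.Hom.jet, Prod.mk.injEq] at hh
  obtain ⟨h1, rfl⟩ := hh
  obtain rfl := he h1
  rfl

variable (e) in
open Classical in
/-- The restriction of a local function to the points where all coordinates outside the image of
`e` vanish. -/
def restrictFn (f : LocFn U F') : LocFn U F :=
  ⟨fun p => f.1 (p.1, fun j => if h : ∃ i, e.jet0 i = j then p.2 h.choose else 0), by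
    obtain ⟨s, g, hg, hf⟩ := f.2
    have hmem : ∀ j : s, ∀ h : ∃ i, e.jet0 i = (j : Jet0 n F'),
        h.choose ∈ s.attach.biUnion fun j =>
          if h : ∃ i, e.jet0 i = (j : Jet0 n F') then {h.choose} else ∅ := by
      intro j h
      rw [Finset.mem_biUnion]
      exact ⟨j, Finset.mem_attach _ _, by rw [dif_pos h]; exact Finset.mem_singleton_self _⟩
    refine ⟨_, fun q => g (q.1, fun j => if h : ∃ i, e.jet0 i = (j : Jet0 n F') then
      q.2 ⟨h.choose, hmem j h⟩ else 0), ?_, fun p => hf _⟩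
    refine hg.comp (t := (U : Set (Fin n → ℝ)) ×ˢ Set.univ) (ContDiff.contDiffOn ?_) ?_
    · refine contDiff_fst.prodMk (contDiff_pi.mpr fun j => ?_)
      split_ifs
      · fun_prop
      · exact contDiff_const
    · rintro q ⟨h1, -⟩
      exact ⟨h1, trivial⟩⟩

lemma restrictFn_pullFn (he : Function.Injective e.toFun) (f : LocFn U F) :
    restrictFn e (pullFn e f) = f := by
  apply Subtype.ext
  funext p
  refine congrArg (fun q => f.1 (p.1, q)) (funext fun i => ?_)
  have h : ∃ i', e.jet0 i' = e.jet0 i := ⟨i, rfl⟩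
  exact (dif_pos h).trans (congrArg p.2 (jet0_injective he h.choose_spec))

variable (e) in
open Classical in
/-- The images of generators under the restriction to the zero section. -/
def restrictGen : Gen U F' → Alg U F
  | .fn f => fn (restrictFn e f)
  | .u j _ => if h : ∃ i, e.jet i = j then coord h.choose else 0
  | .du j => if h : ∃ i, e.jet i = j then gen (.du h.choose) else 0

lemma isParity_restrictGen (g : Gen U F') : IsParity g.par (restrictGen e g) := by
  cases g with
  | fn f => exact isParity_fn _
  | u j hj =>
    rw [restrictGen]
    split_ifs with h
    · have h1 := congrArg (fun i => F'.deg i.1) h.choose_spec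
      have h2 := e.deg_eq h.choose.1
      have := isParity_coord (U := U) h.choose
      rw [show (Gen.u j hj : Gen U F').par = F.deg h.choose.1 by
        simp only [Gen.par, Gen.vdeg, Gen.gdeg, zero_add]
        exact h1.symm.trans h2]
      exact this
    · exact IsParity.zero _
  | du j =>
    rw [restrictGen]
    split_ifs with h
    · have h1 := congrArg (fun i => F'.deg i.1) h.choose_spec
      have h2 := e.deg_eq h.choose.1
      have := isParity_du (U := U) h.choose
      rw [show (Gen.du j : Gen U F').par = 1 + F.deg h.choose.1 by
        simp only [Gen.par, Gen.vdeg, Gen.gdeg]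
        rw [← h2]
        exact congrArg (1 + ·) h1.symm]
      exact this
    · exact IsParity.zero _

variable (e) in
/-- The restriction of vertical forms to the zero section, a left inverse of the pullback. -/
def restrictAlg : Alg U F' →ₐ[ℝ] Alg U F :=
  liftAlg (restrictGen e) (fun f g => fn_add (restrictFn e f) (restrictFn e g))
    (fun f g => fn_mul (restrictFn e f) (restrictFn e g)) (fun r => fn_const r)
    (fun g h => (isParity_restrictGen g).comm (isParity_restrictGen h))

lemma restrictAlg_gen (g : Gen U F') : restrictAlg e (gen g) = restrictGen e g :=
  liftAlg_gen _ _ _ _ _ g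

lemma restrictAlg_pullAlg (he : Function.Injective e.toFun) (a : Alg U F) :
    restrictAlg e (pullAlg e a) = a := by
  induction a using alg_induction with
  | hgen g =>
    rw [pullAlg_gen, restrictAlg_gen]
    cases g with
    | fn f =>
      change fn (restrictFn e (pullFn e f)) = fn f
      rw [restrictFn_pullFn he]
    | u j hj =>
      have h : ∃ i, e.jet i = e.jet j := ⟨j, rfl⟩
      rw [pullGen, restrictGen, dif_pos h, jet_injective he h.choose_spec, coord, dif_neg hj]
    | du j =>
      have h : ∃ i, e.jet i = e.jet j := ⟨j, rfl⟩
      rw [pullGen, restrictGen, dif_pos h, jet_injective he h.choose_spec]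
  | hconst r => simp
  | hadd a b ha hb => simp [ha, hb]
  | hmul a b ha hb => simp [ha, hb]

lemma pull_injective (he : Function.Injective e.toFun) :
    Function.Injective (pull e : Form U F →ₗ[ℝ] Form U F') := by
  intro a b h
  funext S
  rw [← restrictAlg_pullAlg he (a S), ← restrictAlg_pullAlg he (b S)]
  exact congrArg (restrictAlg e) (congrFun h S)

end restrict

lemma ctHom_injective : Function.Injective F.ctHom.toFun := Sum.inl_injective

/-! ### Functions on the base -/

lemma exists_base_mul_eq_one (f : BaseFn U) (hf : ∀ p, f.1 p ≠ 0) :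
    ∃ w : Alg U F, base f * w = 1 := by
  have hloc : IsLocal U Fields.empty fun p => (f.1 p)⁻¹ := by
    obtain ⟨s, g, hg, hfg⟩ := f.2
    refine ⟨s, fun q => (g q)⁻¹, hg.inv ?_, fun p => by simp only [hfg]⟩
    rintro q ⟨hq, -⟩ h0
    refine hf (⟨q.1, hq⟩, fun j => j.1.1.elim) ?_
    rw [hfg, ← h0]
    exact congrArg (fun r => g (q.1, r)) (funext fun j => j.1.1.1.elim)
  refine ⟨base ⟨_, hloc⟩, ?_⟩
  rw [base, base, ← fn_mul]
  have : pullFn F.emptyHom f * pullFn F.emptyHom ⟨_, hloc⟩ = algebraMap ℝ (LocFn U F) 1 := by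
    apply Subtype.ext
    funext p
    exact mul_inv_cancel₀ (hf _)
  rw [this, fn_const, map_one]

lemma pullAlg_base {F' : Fields} (e : Fields.Hom F F') (f : BaseFn U) :
    pullAlg e (base f) = base f := by
  rw [base, base, pullAlg_fn]
  congr 1
  apply Subtype.ext
  funext p
  exact congrArg (fun r => f.1 (p.1, r)) (funext fun j => j.1.1.elim)

lemma dv_base (f : BaseFn U) : dv (base f : Alg U F) = 0 := by
  have h : ∀ j ∉ (∅ : Finset (Jet0 n F)), pdu j (pullFn F.emptyHom f) = 0 := fun j _ =>
    pdu_pullFn_of_notMem (by rintro ⟨i, -⟩; exact i.1.1.elim) f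
  rw [base, isChain_dv.map_fn_sum _ h]
  simp

lemma Metric.exists_vol_mul_eq_one (g : Metric U) : ∃ w : Alg U F, base g.vol * w = 1 :=
  exists_base_mul_eq_one _ fun p => by
    rw [g.vol_eq]
    exact (Real.sqrt_pos.mpr (g.posDef p).det_pos).ne'

/-! ### The vector field of a theory of CohLGFT type -/

/-- The index of the field `Φ^a` among the fields and antifields. -/
def fieldIdx (a : F.Idx) : F.ct.Idx := Sum.inl a

/-- The index of the antifield `Φ^+_a` among the fields and antifields. -/
def antiIdx (a : F.Idx) : F.ct.Idx := Sum.inr a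

lemma fieldIdx_ne_antiIdx (a b : F.Idx) : fieldIdx a ≠ antiIdx b := Sum.inl_ne_inr

lemma antiIdx_injective : Function.Injective (antiIdx (F := F)) := Sum.inr_injective

lemma antifield_eq (a : F.Idx) : (antifield a : Alg U F.ct) = coord (antiIdx a, 0) := rfl

lemma contractJet_du_fieldIdx (a b : F.Idx) (I J : Fin n → ℕ) :
    contractJet (antiIdx b, I) (gen (.du (fieldIdx a, J)) : Alg U F.ct) = 0 :=
  contractJet_du_of_ne fun hc => fieldIdx_ne_antiIdx a b (congrArg Prod.fst hc)

lemma contractJet_du_antiIdx_of_ne {a b : F.Idx} (hab : a ≠ b) (I J : Fin n → ℕ) :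
    contractJet (antiIdx b, I) (gen (.du (antiIdx a, J)) : Alg U F.ct) = 0 :=
  contractJet_du_of_ne fun hc => hab (antiIdx_injective (congrArg Prod.fst hc))

/-- Forms pulled back from the fields do not involve the antifields. -/
lemma contractJet_pullAlg (b : F.Idx) (I : Fin n → ℕ) (y : Alg U F) :
    contractJet (antiIdx b, I) (pullAlg F.ctHom y) = 0 := by
  have h := isChain_contractJet (U := U) (antiIdx b, I)
  induction y using alg_induction with
  | hgen g =>
    rw [pullAlg_gen]
    cases g with
    | fn f => exact contractJet_eq_zero _ (fn_mem_bideg (pullFn F.ctHom f))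
    | u j hj => exact contractJet_eq_zero _ (gen_mem_bideg (pullGen F.ctHom (.u j hj)))
    | du j => exact contractJet_du_fieldIdx j.1 b I j.2
  | hconst r => rw [AlgHom.commutes, h.map_algebraMap]
  | hadd a b ha hb => rw [map_add, map_add, ha, hb, add_zero]
  | hmul a b ha hb => rw [map_mul, h.map_mul, ha, hb, zero_mul, mul_zero, add_zero]

/-- Contracting `∂/∂u^b` into the interior Euler operator of a form of vertical degree one yields
the Euler-Lagrange expression of `u^b`. -/
lemma contractJet_interiorEuler {w : Form U F} {S : Finset (Fin n)} {r : ℤ}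
    (hw : w S ∈ bideg U F 1 r) (b : F.Idx) :
    contractJet (b, 0) (interiorEuler 1 w S) =
      ∑ᶠ I : Fin n → ℕ, sg (∑ μ, (I μ : ℤ)) • totalDs I (contractJet (b, I) (w S)) := by
  have hz : ∀ a : F.Idx, contractJet (b, 0) (∑ᶠ I : Fin n → ℕ, sg (∑ μ, (I μ : ℤ)) •
      totalDs I (contractJet (a, I) (w S))) = 0 := fun a =>
    contractJet_eq_zero (r := r - F.deg a) _ (finsum_induction (· ∈ bideg U F 0 (r - F.deg a))
      (Submodule.zero_mem _) (fun _ _ => Submodule.add_mem _) fun I =>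
      Submodule.smul_mem _ _ (totalDs_mem_bideg I
        (mem_bideg_congr (contractJet_mem_bideg (a, I) hw) (by norm_num) rfl)))
  simp only [interiorEuler, Nat.cast_one, inv_one, one_smul, map_sum,
    (isChain_contractJet _).map_mul, hz, mul_zero, add_zero]
  rw [Finset.sum_eq_single b]
  · rw [contractJet_du_self, one_mul]
  · intro a _ hab
    rw [contractJet_du_of_ne, zero_mul]
    exact fun hc => hab (congrArg Prod.fst hc)
  · exact fun hb => absurd (Finset.mem_univ b) hb

/-- The coefficient of `δΦ^+_{b,I}` in `d_v(Φ^+_a z^a)`, where `z` does not involve the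
antifields. -/
lemma contractJet_dv_antifield_mul (b : F.Idx) (I : Fin n → ℕ) (z : F.Idx → Alg U F) :
    contractJet (antiIdx b, I)
      (dv (∑ a, antifield a * pullAlg F.ctHom (z a))) =
      if I = 0 then pullAlg F.ctHom (z b) else 0 := by
  have hc := isChain_contractJet (U := U) (antiIdx b, I)
  have hterm : ∀ a, contractJet (antiIdx b, I)
      (dv (antifield a * pullAlg F.ctHom (z a))) =
      contractJet (antiIdx b, I) (gen (.du (antiIdx a, 0))) *
        pullAlg F.ctHom (z a) := by
    intro a
    have ha : contractJet (antiIdx b, I) (twist 1 (antifield a : Alg U F.ct)) = 0 :=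
      contractJet_eq_zero _ (twist_mem_bideg 1 (coord_mem_bideg _))
    rw [isChain_dv.map_mul, ← pullAlg_dv ctHom_injective, map_add, hc.map_mul, hc.map_mul, ha,
      contractJet_pullAlg, contractJet_pullAlg, antifield_eq, dv_coord]
    simp
  rw [map_sum, map_sum, Finset.sum_congr rfl fun a _ => hterm a, Finset.sum_eq_single b]
  · split_ifs with h
    · subst h
      rw [contractJet_du_self, one_mul]
    · rw [contractJet_du_of_ne, zero_mul]
      exact fun hc => h (congrArg Prod.snd hc).symm
  · intro a _ hab
    rw [contractJet_du_antiIdx_of_ne hab, zero_mul]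
  · exact fun hb => absurd (Finset.mem_univ b) hb

/-- The coefficient of `δΦ^+_b` in `ι_X d_v γ_ct` is the component of `X` along `Φ^b`, times the
volume density. -/
lemma contractJet_contract_omegaCt (g : Metric U) (X : VField U F.ct 1) (b : F.Idx) :
    contractJet (antiIdx b, 0) (vert (contract X) (omegaCt g) Finset.univ) =
      X.1 (fieldIdx b) * base g.vol := by
  have hc := isChain_contractJet (U := U) (antiIdx b, 0)
  have hX := isChain_contract X
  have hvol : ∀ j, contractJet j (base g.vol : Alg U F.ct) = 0 := fun j =>
    contractJet_eq_zero j (fn_mem_bideg _)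
  have hXvol : contract X (base g.vol : Alg U F.ct) = 0 := contract_eq_zero X (fn_mem_bideg _)
  have hfield : ∀ a : F.ct.Idx,
      contractJet (antiIdx b, 0) (X.1 a) = 0 := fun a =>
    contractJet_eq_zero _ (VField.mem_bideg X a)
  have e : vert (contract X) (omegaCt g) Finset.univ = ∑ a : F.Idx,
      (X.1 (antiIdx a) * gen (.du (fieldIdx a, 0)) +
        gen (.du (antiIdx a, 0)) * X.1 (fieldIdx a)) * base g.vol := by
    change contract X (dv (if Finset.univ = Finset.univ then ∑ a : F.Idx, coord (antiIdx a, 0) *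
      gen (.du (fieldIdx a, 0)) * base g.vol else 0)) = _
    rw [if_pos rfl]
    simp only [map_sum, isChain_dv.map_mul, dv_base, dv_du, mul_zero, add_zero,
      dv_coord, hX.map_mul, hXvol, contract_du, totalDs_zero, sub_self, twist_zero]
  simp only [e, map_sum, hc.map_mul, map_add, hvol, hfield, contractJet_du_fieldIdx,
    zero_mul, mul_zero, add_zero, zero_add]
  rw [Finset.sum_eq_single b]
  · rw [contractJet_du_self, one_mul]
  · intro a _ hab
    rw [contractJet_du_antiIdx_of_ne hab, zero_mul, zero_mul]
  · exact fun hb => absurd (Finset.mem_univ b) hb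

lemma finsum_totalDs_single (c : Alg U F) :
    ∑ᶠ I : Fin n → ℕ, sg (∑ μ, (I μ : ℤ)) • totalDs I (if I = 0 then c else 0) = c := by
  rw [finsum_eq_single _ 0]
  · simp [totalDs_zero]
  · intro I hI
    rw [if_neg hI, totalDs_map_zero, smul_zero]

lemma IsCotangentLift.apply_inl {g : Metric U} {X : VField U F 1} {Xcl : VField U F.ct 1}
    (h : IsCotangentLift g X Xcl) (b : F.Idx) :
    Xcl.1 (fieldIdx b) = pullAlg F.ctHom (X.1 b) := by
  have h1 := congrArg (contractJet (antiIdx b, 0)) (congrFun h Finset.univ)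
  have e : vert dv (tildeForm g X) Finset.univ =
      dv (∑ a, antifield a * pullAlg F.ctHom (X.1 a * base g.vol)) := by
    change dv (topForm _ Finset.univ) = _
    simp only [topForm, if_true, map_mul, pullAlg_base, mul_assoc]
  have hdeg : vert dv (tildeForm g X) Finset.univ ∈ bideg U F.ct 1 0 := by
    rw [e]
    refine mem_bideg_congr (dv_mem_bideg (q := 0) (r := 0) (Submodule.sum_mem _ fun a _ => ?_))
      rfl rfl
    rw [antifield_eq]
    refine mem_bideg_congr (mul_mem_bideg (coord_mem_bideg (antiIdx a, 0)) (pullAlg_mem_bideg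
      F.ctHom (mul_mem_bideg (VField.mem_bideg X a) (fn_mem_bideg (pullFn F.emptyHom g.vol)))))
      (by norm_num) ?_
    change -1 - F.deg a + (F.deg a + 1 + 0) = 0
    ring
  rw [contractJet_contract_omegaCt, contractJet_interiorEuler hdeg, e] at h1
  simp only [contractJet_dv_antifield_mul] at h1
  rw [finsum_totalDs_single, map_mul, pullAlg_base] at h1
  obtain ⟨w, hw⟩ := g.exists_vol_mul_eq_one (F := F.ct)
  have h2 := congrArg (· * w) h1
  simpa only [mul_assoc, hw, mul_one] using h2

/-- The vector field of a Lagrangian of the fields has no components along the fields. -/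
lemma IsLagrangianField.apply_inl {g : Metric U} {L : Form U F} {X : VField U F.ct 1}
    (hL : L ∈ Form.deg U F n 0 0) (h : IsLagrangianField g L X) (b : F.Idx) :
    X.1 (fieldIdx b) = 0 := by
  have h1 := congrArg (contractJet (antiIdx b, 0)) (congrFun h Finset.univ)
  have e : vert dv (pull F.ctHom L) Finset.univ = pullAlg F.ctHom (dv (L Finset.univ)) :=
    (pullAlg_dv ctHom_injective (L Finset.univ)).symm
  have hdeg : vert dv (pull F.ctHom L) Finset.univ ∈ bideg U F.ct 1 0 := by
    rw [e]
    have := hL Finset.univ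
    rw [if_pos (by simp)] at this
    exact pullAlg_mem_bideg F.ctHom (mem_bideg_congr (dv_mem_bideg this) (zero_add 1) rfl)
  rw [contractJet_contract_omegaCt, contractJet_interiorEuler hdeg, e] at h1
  simp only [contractJet_pullAlg, totalDs_map_zero, smul_zero, finsum_zero] at h1
  obtain ⟨w, hw⟩ := g.exists_vol_mul_eq_one (F := F.ct)
  have h2 := congrArg (· * w) h1
  simpa only [mul_assoc, hw, mul_one, zero_mul] using h2

section gauge
variable {κ : Type} [Fintype κ] {𝔤 : Type} [LieRing 𝔤] [LieAlgebra ℝ 𝔤]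
  {b : Module.Basis κ ℝ 𝔤} {N : GaugeNatural U F b} {S : QKG N} {m : ℕ}

/-- The cohomological vector field on fields and antifields is projectable: on the fields it is the
`Q` of the `QKG*`-structure. -/
lemma CohLGFTType.QBV_inl (T : CohLGFTType S m) (a : F.Idx) :
    T.QBV.1 (fieldIdx a) = pullAlg F.ctHom (S.Q.1 a) := by
  obtain ⟨Qcl, QL, h1, h2, h3⟩ := T.QBV_eq
  rw [h3, ← h1.apply_inl a]
  change Qcl.1 (fieldIdx a) + QL.1 (fieldIdx a) = _
  rw [h2.apply_inl T.cohLGFT.deg, add_zero]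

end gauge

/-! ### Horizontal calculus -/

lemma vert_apply (T : Alg U F →ₗ[ℝ] Alg U F) (w : Form U F) (S : Finset (Fin n)) :
    vert T w S = T (w S) := rfl

lemma horiz_apply (R : Fin n → Alg U F →ₗ[ℝ] Alg U F) (w : Form U F) (S : Finset (Fin n)) :
    horiz R w S = ∑ μ ∈ S, sg ((S.filter (· < μ)).card : ℤ) • R μ (w (S.erase μ)) := rfl

lemma pull_apply {F' : Fields} (e : Fields.Hom F F') (w : Form U F) (S : Finset (Fin n)) :
    pull e w S = pullAlg e (w S) := rfl

lemma vert_horiz (T : Alg U F →ₗ[ℝ] Alg U F) (R : Fin n → Alg U F →ₗ[ℝ] Alg U F)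
    (w : Form U F) : vert T (horiz R w) = horiz (fun μ => T ∘ₗ R μ) w := by
  funext S
  simp [vert_apply, horiz_apply]

lemma horiz_vert (T : Alg U F →ₗ[ℝ] Alg U F) (R : Fin n → Alg U F →ₗ[ℝ] Alg U F)
    (w : Form U F) : horiz R (vert T w) = horiz (fun μ => R μ ∘ₗ T) w := by
  funext S
  simp [vert_apply, horiz_apply]

lemma horiz_add (R R' : Fin n → Alg U F →ₗ[ℝ] Alg U F) (w : Form U F) :
    horiz (fun μ => R μ + R' μ) w = horiz R w + horiz R' w := by
  funext S
  simp [horiz_apply, Finset.sum_add_distrib]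

lemma horiz_congr {R R' : Fin n → Alg U F →ₗ[ℝ] Alg U F} {w : Form U F}
    (h : ∀ μ S, R μ (w S) = R' μ (w S)) : horiz R w = horiz R' w := by
  funext S
  simp [horiz_apply, h]

/-- `dx^μ` and `dx^ν` anticommute. -/
lemma sg_card_filter_erase {S : Finset (Fin n)} {μ ν : Fin n} (hμ : μ ∈ S) (hν : ν ∈ S)
    (h : μ ≠ ν) :
    sg ((S.filter (· < μ)).card : ℤ) * sg (((S.erase μ).filter (· < ν)).card : ℤ) =
      -(sg ((S.filter (· < ν)).card : ℤ) * sg (((S.erase ν).filter (· < μ)).card : ℤ)) := by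
  wlog hlt : μ < ν generalizing μ ν
  · rw [this hν hμ h.symm (lt_of_le_of_ne (not_lt.mp hlt) h.symm), neg_neg]
  have e1 : (S.erase ν).filter (· < μ) = S.filter (· < μ) := by
    rw [Finset.filter_erase]
    exact Finset.erase_eq_of_notMem fun hc => absurd (Finset.mem_filter.mp hc).2 hlt.not_gt
  have e2 : (((S.erase μ).filter (· < ν)).card : ℤ) = (S.filter (· < ν)).card - 1 := by
    have hm : μ ∈ S.filter (· < ν) := Finset.mem_filter.mpr ⟨hμ, hlt⟩
    rw [Finset.filter_erase, ← Finset.card_erase_add_one hm]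
    push_cast
    ring
  rw [e1, e2, sg_sub_one]
  ring

/-- One-forms with commuting operator coefficients anticommute. -/
lemma horiz_horiz {R R' : Fin n → Alg U F →ₗ[ℝ] Alg U F}
    (h : ∀ μ ν a, R μ (R' ν a) = R' ν (R μ a)) (w : Form U F) :
    horiz R (horiz R' w) = -horiz R' (horiz R w) := by
  have expand : ∀ (A B : Fin n → Alg U F →ₗ[ℝ] Alg U F) (S : Finset (Fin n)),
      horiz A (horiz B w) S = ∑ μ ∈ S, ∑ ν ∈ S, if μ = ν then 0 else
        (sg ((S.filter (· < μ)).card : ℤ) * sg (((S.erase μ).filter (· < ν)).card : ℤ)) •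
          A μ (B ν (w ((S.erase μ).erase ν))) := by
    intro A B S
    rw [horiz_apply]
    refine Finset.sum_congr rfl fun μ hμ => ?_
    rw [horiz_apply, map_sum, Finset.smul_sum, ← Finset.add_sum_erase S _ hμ, if_pos rfl, zero_add]
    refine Finset.sum_congr rfl fun ν hν => ?_
    rw [if_neg (Finset.ne_of_mem_erase hν).symm, map_smul, smul_smul]
  funext S
  rw [Pi.neg_apply, expand, expand, Finset.sum_comm, ← Finset.sum_neg_distrib]
  refine Finset.sum_congr rfl fun μ hμ => ?_
  rw [← Finset.sum_neg_distrib]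
  refine Finset.sum_congr rfl fun ν hν => ?_
  by_cases hμν : μ = ν
  · rw [if_pos hμν, if_pos hμν.symm, neg_zero]
  · rw [if_neg hμν, if_neg (Ne.symm hμν), h, Finset.erase_right_comm,
      sg_card_filter_erase hν hμ (Ne.symm hμν), alg_neg_smul]

lemma dh_dh (w : Form U F) : dh (dh w) = 0 :=
  eq_zero_of_eq_neg_self (horiz_horiz (fun μ ν a => totalD_comm μ ν a) w)

lemma vert_dh {T : Alg U F →ₗ[ℝ] Alg U F} (hT : ∀ μ a, T (totalD μ a) = totalD μ (T a))
    (w : Form U F) : vert T (dh w) = dh (vert T w) := by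
  rw [dh, vert_horiz, horiz_vert]
  exact horiz_congr fun μ S => hT μ _

lemma dv_dh (w : Form U F) : vert dv (dh w) = dh (vert dv w) := vert_dh dv_totalD w

lemma lie_dh {k : ℤ} (X : VField U F k) (w : Form U F) :
    vert (lie X) (dh w) = dh (vert (lie X) w) := vert_dh (lie_totalD X) w

lemma pull_dh {F' : Fields} {e : Fields.Hom F F'} (he : Function.Injective e.toFun)
    (w : Form U F) : pull e (dh w) = dh (pull e w) := by
  funext S
  simp only [pull_apply, dh, horiz_apply, map_sum, map_smul, pullAlg_totalD he]

lemma vert_mem_deg {T : Alg U F →ₗ[ℝ] Alg U F} {p : ℕ} {q r q' r' : ℤ}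
    (hT : ∀ a ∈ bideg U F q r, T a ∈ bideg U F q' r') {w : Form U F}
    (hw : w ∈ Form.deg U F p q r) : vert T w ∈ Form.deg U F p q' r' := by
  intro S
  have := hw S
  split_ifs at this ⊢
  · exact hT _ this
  · rw [vert_apply, this, map_zero]

lemma horiz_mem_deg {R : Fin n → Alg U F →ₗ[ℝ] Alg U F} {p : ℕ} {q r r' : ℤ}
    (hR : ∀ μ, ∀ a ∈ bideg U F q r, R μ a ∈ bideg U F q r') {w : Form U F}
    (hw : w ∈ Form.deg U F p q r) : horiz R w ∈ Form.deg U F (p + 1) q r' := by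
  intro S
  have hcard : ∀ μ ∈ S, (S.erase μ).card + 1 = S.card := fun μ hμ =>
    Finset.card_erase_add_one hμ
  split_ifs with hS
  · refine Submodule.sum_mem _ fun μ hμ => Submodule.smul_mem _ _ (hR μ _ ?_)
    have h1 := hw (S.erase μ)
    rwa [if_pos (by have := hcard μ hμ; omega)] at h1
  · refine Finset.sum_eq_zero fun μ hμ => ?_
    have h1 := hw (S.erase μ)
    rw [if_neg (by have := hcard μ hμ; omega)] at h1
    rw [h1, map_zero, smul_zero]

lemma dh_mem_deg {p : ℕ} {q r : ℤ} {w : Form U F} (hw : w ∈ Form.deg U F p q r) :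
    dh w ∈ Form.deg U F (p + 1) q r := horiz_mem_deg (fun μ _ => totalD_mem_bideg μ) hw

lemma lie_mem_deg {k : ℤ} (X : VField U F k) {p : ℕ} {q r : ℤ} {w : Form U F}
    (hw : w ∈ Form.deg U F p q r) : vert (lie X) w ∈ Form.deg U F p q (r + k) :=
  vert_mem_deg (fun _ => lie_mem_bideg X) hw

lemma pull_mem_deg {F' : Fields} (e : Fields.Hom F F') {p : ℕ} {q r : ℤ} {w : Form U F}
    (hw : w ∈ Form.deg U F p q r) : pull e w ∈ Form.deg U F' p q r := by
  intro S
  have := hw S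
  split_ifs at this ⊢
  · exact pullAlg_mem_bideg e this
  · rw [pull_apply, this, map_zero]

lemma mem_deg_congr {p p' : ℕ} {q r q' r' : ℤ} {w : Form U F} (h : w ∈ Form.deg U F p q r)
    (hp : p = p') (hq : q = q') (hr : r = r') : w ∈ Form.deg U F p' q' r' :=
  hp ▸ hq ▸ hr ▸ h

lemma Form.eq_zero_of_dv_eq_zero {p : ℕ} {r : ℤ} (hr : r ≠ 0) {w : Form U F}
    (hw : w ∈ Form.deg U F p 0 r) (h : vert dv w = 0) : w = 0 := by
  funext S
  have h1 := hw S
  split_ifs at h1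
  · exact BVBFV.eq_zero_of_dv_eq_zero hr h1 (congrFun h S)
  · exact h1

lemma form_neg_smul (c : ℝ) (w : Form U F) : (-c) • w = -(c • w) :=
  funext fun s => alg_neg_smul c (w s)

/-! ### Horizontally exact forms -/

lemma HExact.zero : HExact (0 : Form U F) := ⟨0, (map_zero _).symm⟩

lemma HExact.add {w w' : Form U F} (h : HExact w) (h' : HExact w') : HExact (w + w') := by
  obtain ⟨η, rfl⟩ := h
  obtain ⟨η', rfl⟩ := h'
  exact ⟨η + η', (map_add _ _ _).symm⟩

lemma HExact.smul {w : Form U F} (c : ℝ) (h : HExact w) : HExact (c • w) := by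
  obtain ⟨η, rfl⟩ := h
  exact ⟨c • η, (map_smul _ _ _).symm⟩

lemma HExact.neg {w : Form U F} (h : HExact w) : HExact (-w) := by
  obtain ⟨η, rfl⟩ := h
  exact ⟨-η, (map_neg _ _).symm⟩

lemma HExact.lie {k : ℤ} (X : VField U F k) {w : Form U F} (h : HExact w) :
    HExact (vert (lie X) w) := by
  obtain ⟨η, rfl⟩ := h
  exact ⟨_, lie_dh X η⟩

/-- The product with a one-form with constant operator coefficients preserves exactness. -/
lemma HExact.horiz {R : Fin n → Alg U F →ₗ[ℝ] Alg U F}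
    (hR : ∀ μ ν a, R μ (totalD ν a) = totalD ν (R μ a)) {w : Form U F} (h : HExact w) :
    HExact (horiz R w) := by
  obtain ⟨η, rfl⟩ := h
  exact ⟨-BVBFV.horiz R η, by rw [map_neg]; exact horiz_horiz hR η⟩

lemma horiz_eq_sum (R : Fin n → Alg U F →ₗ[ℝ] Alg U F) (w : Form U F) :
    horiz R w = ∑ μ, horiz (Pi.single μ LinearMap.id) (vert (R μ) w) := by
  funext S
  simp only [Finset.sum_apply, horiz_apply, vert_apply]
  rw [Finset.sum_comm]
  refine Finset.sum_congr rfl fun ν _ => ?_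
  rw [Finset.sum_eq_single ν]
  · rw [Pi.single_eq_same]
    rfl
  · intro μ _ h
    rw [Pi.single_eq_of_ne h.symm]
    simp
  · exact fun h => absurd (Finset.mem_univ ν) h

/-- If `R_μ w` is exact for each `μ`, then so is `dx^μ ∧ R_μ w`, although the potentials may depend
on `μ`. -/
lemma HExact.horiz_of_forall {R : Fin n → Alg U F →ₗ[ℝ] Alg U F} {w : Form U F}
    (h : ∀ μ, HExact (vert (R μ) w)) : HExact (BVBFV.horiz R w) := by
  rw [horiz_eq_sum]
  refine Finset.sum_induction _ HExact (fun _ _ => HExact.add) HExact.zero fun μ _ =>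
    (h μ).horiz fun ν μ' a => ?_
  by_cases hν : ν = μ
  · subst hν
    rw [Pi.single_eq_same]
    rfl
  · rw [Pi.single_eq_of_ne hν]
    simp

/-! ### Forms without explicit dependence on the coordinates -/

lemma XIndep.zero : XIndep (0 : Form U F) := fun _ => map_zero _

lemma XIndep.add {w w' : Form U F} (h : XIndep w) (h' : XIndep w') : XIndep (w + w') := fun μ => by
  rw [map_add, h, h', add_zero]

lemma XIndep.smul {w : Form U F} (c : ℝ) (h : XIndep w) : XIndep (c • w) := fun μ => by
  rw [map_smul, h, smul_zero]

lemma XIndep.sub {w w' : Form U F} (h : XIndep w) (h' : XIndep w') : XIndep (w - w') := fun μ => by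
  rw [map_sub, h, h', sub_zero]

lemma XIndep.sum {ι : Type*} {s : Finset ι} {w : ι → Form U F} (h : ∀ i ∈ s, XIndep (w i)) :
    XIndep (∑ i ∈ s, w i) :=
  Finset.sum_induction _ XIndep (fun _ _ => XIndep.add) XIndep.zero h

/-! ### Operators of a `QKG*`-structure -/

section gauge
variable {κ : Type} [Fintype κ] {𝔤 : Type} [LieRing 𝔤] [LieAlgebra ℝ 𝔤]
  {b : Module.Basis κ ℝ 𝔤} {N : GaugeNatural U F b} (S : QKG N)

lemma base_zero : base (0 : BaseFn U) = (0 : Alg U F) := by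
  rw [base, pullFn_zero, fn_zero]

lemma base_one : base (1 : BaseFn U) = (1 : Alg U F) := by
  have : pullFn F.emptyHom (1 : BaseFn U) = algebraMap ℝ (LocFn U F) 1 := rfl
  rw [base, this, fn_const, map_one]

lemma pdx_iterate_zero (μ : Fin n) (k : ℕ) : (pdx μ)^[k] (0 : LocFn U F) = 0 :=
  Function.iterate_fixed (pdx_zero μ) k

lemma pdxs_algebraMap {α : Fin n → ℕ} (hα : α ≠ 0) (r : ℝ) :
    pdxs α (algebraMap ℝ (BaseFn U) r) = 0 := by
  have key : ∀ l : List (Fin n), (∃ μ ∈ l, α μ ≠ 0) →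
      l.foldr (fun μ g => (pdx μ)^[α μ] g) (algebraMap ℝ (BaseFn U) r) = 0 := by
    intro l
    induction l with
    | nil => rintro ⟨_, h, -⟩; exact absurd h List.not_mem_nil
    | cons μ l ih =>
      intro h
      rw [List.foldr_cons]
      by_cases hl : ∃ μ ∈ l, α μ ≠ 0
      · rw [ih hl, pdx_iterate_zero]
      · have hconst : l.foldr (fun μ g => (pdx μ)^[α μ] g) (algebraMap ℝ (BaseFn U) r) =
            algebraMap ℝ (BaseFn U) r := by
          clear ih h
          induction l with
          | nil => rfl
          | cons ν l ih =>
            push Not at hl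
            rw [List.foldr_cons,
              ih (by push Not; exact fun i hi => hl i (List.mem_cons_of_mem _ hi)),
              hl ν List.mem_cons_self]
            rfl
        have hμ : α μ ≠ 0 := by
          push Not at hl
          obtain ⟨ν, hν, h0⟩ := h
          rcases List.mem_cons.mp hν with rfl | hν
          · exact h0
          · exact absurd (hl ν hν) h0
        obtain ⟨k, hk⟩ := Nat.exists_eq_succ_of_ne_zero hμ
        rw [hconst, hk, Function.iterate_succ_apply, pdx_algebraMap, pdx_iterate_zero]
  obtain ⟨μ, hμ⟩ := Function.ne_iff.mp hα
  exact key _ ⟨μ, List.mem_finRange μ, hμ⟩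

lemma pdxs_zero (α : Fin n → ℕ) : pdxs α (0 : BaseFn U) = 0 := by
  unfold pdxs
  induction List.finRange n with
  | nil => rfl
  | cons μ l ih => rw [List.foldr_cons, ih, pdx_iterate_zero]

/-- The coordinate vector field `∂_μ` acts on sections by `u^a ↦ u^a_μ`. -/
lemma act_partial (N : GaugeNatural U F b) (μ : Fin n) (a : F.Idx) :
    (N.act (InvVF.partial U κ μ)).1 a = coord (a, Pi.single μ 1) := by
  have h1 : ∑ ν, base ((InvVF.partial U κ μ).1 ν) * coord (a, Pi.single ν 1) =
      (coord (a, Pi.single μ 1) : Alg U F) := by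
    rw [Finset.sum_eq_single μ]
    · simp only [InvVF.partial, Pi.single_eq_same, base_one, one_mul]
    · intro ν _ hν
      simp only [InvVF.partial, Pi.single_eq_of_ne hν, base_zero, zero_mul]
    · exact fun h => absurd (Finset.mem_univ μ) h
  have h2 : ∀ α ν, base (pdxs α ((InvVF.partial U κ μ).1 ν)) * N.A α ν a = 0 := by
    intro α ν
    by_cases hα : α = 0
    · rw [hα, N.A_zero, mul_zero]
    · have : (InvVF.partial U κ μ).1 ν =
          algebraMap ℝ (BaseFn U) (if ν = μ then 1 else 0) := by
        by_cases hν : ν = μ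
        · subst hν
          simp [InvVF.partial]
        · simp [InvVF.partial, hν]
      rw [this, pdxs_algebraMap hα, base_zero, zero_mul]
  have h3 : ∀ α c, base (pdxs α ((InvVF.partial U κ μ).2 c)) * N.B α c a = 0 := by
    intro α c
    change base (pdxs α (0 : BaseFn U)) * _ = 0
    rw [pdxs_zero, base_zero, zero_mul]
  rw [N.act_eq, h1]
  simp [h2, h3]

/-- `Lie_{∂_μ}` on sections is the difference of the total and the explicit derivative. -/
lemma lie_act_partial (N : GaugeNatural U F b) (μ : Fin n) (a : Alg U F) :
    lie (N.act (InvVF.partial U κ μ)) a = totalD μ a - explicitD μ a := by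
  have hch : IsChain 0 0 (totalD μ - explicitD μ : Alg U F →ₗ[ℝ] Alg U F) := by
    have := (isChain_totalD (U := U) (F := F) μ).sub (isChain_explicitD μ)
    rwa [sub_self] at this
  have hev : IsEvol 0 (totalD μ - explicitD μ : Alg U F →ₗ[ℝ] Alg U F) :=
    { hch with
      map_totalD := fun ν a => by
        simp only [LinearMap.sub_apply, map_sub, explicitD_totalD, totalD_comm μ ν]
      map_dv := fun a => by
        simp only [LinearMap.sub_apply, map_sub, explicitD_dv, dv_totalD, sg_zero, one_smul] }
  refine LinearMap.congr_fun ((isEvol_lie _).ext hev fun a => ?_) a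
  rw [lie_coord_zero, act_partial, LinearMap.sub_apply, totalD_coord, explicitD_coord, sub_zero]
  simp [Jet.succ]

lemma sg_one : sg 1 = -1 := by simp [sg]

lemma sg_neg_one : sg (-1) = -1 := by simp [sg]

lemma QKG.lie_Q_K (X : InvVF U κ) (a : Alg U F) :
    lie S.Q (lie (S.K X) a) = -lie (S.K X) (lie S.Q a) + lie (N.act X) a := by
  have := lie_lie_of_bracket_eq (by norm_num) (S.Q_K X) a
  rwa [one_mul, sg_neg_one, alg_neg_smul, one_smul] at this

lemma QKG.lie_K_K (X Y : InvVF U κ) (a : Alg U F) :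
    lie (S.K X) (lie (S.K Y) a) = -lie (S.K Y) (lie (S.K X) a) := by
  have := lie_lie_of_bracket_eq_zero (S.K_K X Y) a
  rwa [neg_mul_neg, one_mul, sg_one, alg_neg_smul, one_smul] at this

lemma QKG.lie_act_K (X Y : InvVF U κ) (a : Alg U F) :
    lie (N.act X) (lie (S.K Y) a) =
      lie (S.K Y) (lie (N.act X) a) + lie (S.K (autBracket b X Y)) a := by
  have := lie_lie_of_bracket_eq (by norm_num) (S.act_K X Y) a
  rwa [zero_mul, sg_zero, one_smul] at this

/-- `Q` commutes with the action of the invariant vector fields, by `[Q, K_Ξ] = Ξ` and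
`Q^2 = 0`. -/
lemma QKG.lie_Q_act (X : InvVF U κ) (a : Alg U F) :
    lie S.Q (lie (N.act X) a) = lie (N.act X) (lie S.Q a) := by
  have h1 := congrArg (lie S.Q) (S.lie_Q_K X a)
  rw [lie_lie_self S.Q_sq, map_add, map_neg, S.lie_Q_K, lie_lie_self S.Q_sq, map_zero, neg_zero,
    zero_add] at h1
  exact (neg_add_eq_zero.mp h1.symm).symm

lemma autBracket_partial (b : Module.Basis κ ℝ 𝔤) (ν μ : Fin n) :
    autBracket b (InvVF.partial U κ ν) (InvVF.partial U κ μ) = 0 := by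
  have hc : ∀ i j k : Fin n, pdx k ((Pi.single i 1 : Fin n → BaseFn U) j) = 0 := by
    intro i j k
    by_cases h : j = i
    · subst h
      have := pdx_algebraMap (U := U) (F := Fields.empty) k 1
      rwa [map_one, ← Pi.single_eq_same (M := fun _ => BaseFn U) j 1] at this
    · rw [Pi.single_eq_of_ne h, pdx_zero]
  refine Prod.ext (funext fun i => ?_) (funext fun c => ?_)
  · simp [autBracket, InvVF.partial, hc]
  · simp [autBracket, InvVF.partial, pdx_zero]

/-- The bracket of a gauge transformation with `∂_μ` is the gauge transformation `∂_μ λ`, by the sign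
convention of `autBracket`. -/
lemma autBracket_gauge_partial (b : Module.Basis κ ℝ 𝔤) (lam : κ → BaseFn U) (μ : Fin n) :
    autBracket b (InvVF.gauge lam) (InvVF.partial U κ μ) =
      InvVF.gauge fun c => pdx μ (lam c) := by
  refine Prod.ext (funext fun i => ?_) (funext fun c => ?_)
  · simp [autBracket, InvVF.partial, InvVF.gauge, pdx_zero]
  · simp only [autBracket, InvVF.partial, InvVF.gauge, Pi.zero_apply, zero_mul, sub_zero, mul_zero,
      smul_zero, Finset.sum_const_zero, add_zero]
    rw [Finset.sum_eq_single μ]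
    · rw [Pi.single_eq_same, one_mul]
    · intro ν _ hν
      rw [Pi.single_eq_of_ne hν, zero_mul]
    · exact fun h => absurd (Finset.mem_univ μ) h

lemma QKG.explicitD_K_partial (ν μ : Fin n) (a : F.Idx) :
    explicitD ν ((S.K (InvVF.partial U κ μ)).1 a) = 0 := by
  have h := congrFun (S.act_K (InvVF.partial U κ ν) (InvVF.partial U κ μ)) a
  rw [autBracket_partial, map_zero, bracket, lie_act_partial, act_partial, zero_mul, sg_zero,
    one_smul, lie_coord] at h
  change totalD ν _ - explicitD ν _ - totalDs (Pi.single ν 1) _ = 0 at h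
  have e := totalDs_add_single 0 ν ((S.K (InvVF.partial U κ μ)).1 a)
  rw [zero_add, totalDs_zero] at e
  rw [e, sub_sub_cancel_left] at h
  exact neg_eq_zero.mp h

lemma QKG.explicitD_Q (μ : Fin n) (a : F.Idx) : explicitD μ (S.Q.1 a) = 0 := by
  have h := S.lie_Q_act (InvVF.partial U κ μ) (coord (a, 0))
  rw [lie_coord_zero, lie_coord_zero, lie_act_partial, act_partial, lie_coord] at h
  have e := totalDs_add_single 0 μ (S.Q.1 a)
  rw [zero_add, totalDs_zero] at e
  change totalDs (Pi.single μ 1) _ = _ at h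
  rw [e] at h
  exact sub_eq_self.mp h.symm

lemma QKG.xIndep_homotopy {w : Form U F} (h : XIndep w) : XIndep (S.homotopy w) := fun μ => by
  rw [QKG.homotopy, vert_horiz]
  funext s
  refine Finset.sum_eq_zero fun ν _ => ?_
  rw [LinearMap.comp_apply, explicitD_lie (S.explicitD_K_partial μ ν)]
  have := congrFun (h μ) (s.erase ν)
  rw [vert_apply] at this
  rw [this]
  simp

/-- On forms without explicit coordinate dependence `K` is a homotopy between `Lie_Q` and `d_h`. -/
lemma QKG.lie_Q_homotopy {w : Form U F} (h : XIndep w) :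
    vert (lie S.Q) (S.homotopy w) = dh w - S.homotopy (vert (lie S.Q) w) := by
  rw [eq_sub_iff_add_eq, QKG.homotopy, vert_horiz, horiz_vert, ← horiz_add, dh]
  refine horiz_congr fun μ s => ?_
  have := congrFun (h μ) s
  rw [vert_apply] at this
  rw [LinearMap.add_apply, LinearMap.comp_apply, LinearMap.comp_apply, S.lie_Q_K, lie_act_partial,
    this]
  simp

lemma QKG.homotopy_dh (w : Form U F) : S.homotopy (dh w) = -dh (S.homotopy w) :=
  horiz_horiz (fun _ ν a => lie_totalD _ ν a) w

lemma QKG.homotopy_mem_deg {p : ℕ} {q r : ℤ} {w : Form U F} (hw : w ∈ Form.deg U F p q r) :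
    S.homotopy w ∈ Form.deg U F (p + 1) q (r - 1) :=
  horiz_mem_deg (fun _ _ => lie_mem_bideg _) hw

/-! ### Basic forms -/

variable {S}

lemma QKG.IsBasic.zero : S.IsBasic (0 : Form U F) := fun lam => by
  rw [map_zero, map_zero]
  exact ⟨HExact.zero, HExact.zero⟩

lemma QKG.IsBasic.add {w w' : Form U F} (h : S.IsBasic w) (h' : S.IsBasic w') :
    S.IsBasic (w + w') := fun lam => by
  rw [map_add, map_add]
  exact ⟨(h lam).1.add (h' lam).1, (h lam).2.add (h' lam).2⟩

lemma QKG.IsBasic.smul {w : Form U F} (c : ℝ) (h : S.IsBasic w) : S.IsBasic (c • w) :=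
  fun lam => by
  rw [map_smul, map_smul]
  exact ⟨(h lam).1.smul c, (h lam).2.smul c⟩

lemma QKG.IsBasic.sub {w w' : Form U F} (h : S.IsBasic w) (h' : S.IsBasic w') :
    S.IsBasic (w - w') := by
  have e : w - w' = w + (-1 : ℝ) • w' := by
    rw [form_neg_smul, one_smul]
    exact sub_eq_add_neg _ _
  exact e ▸ h.add (h'.smul (-1))

lemma QKG.IsBasic.sum {ι : Type*} {s : Finset ι} {w : ι → Form U F}
    (h : ∀ i ∈ s, S.IsBasic (w i)) : S.IsBasic (∑ i ∈ s, w i) :=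
  Finset.sum_induction _ S.IsBasic (fun _ _ => QKG.IsBasic.add) QKG.IsBasic.zero h

lemma QKG.isBasic_dh (w : Form U F) : S.IsBasic (dh w) := fun _ =>
  ⟨⟨_, lie_dh _ w⟩, ⟨_, lie_dh _ w⟩⟩

lemma QKG.isBasic_lie_Q {w : Form U F} (h : S.IsBasic w) : S.IsBasic (vert (lie S.Q) w) := by
  intro lam
  have e1 : vert (lie (S.I lam)) (vert (lie S.Q) w) =
      -vert (lie S.Q) (vert (lie (S.I lam)) w) + vert (lie (N.delta lam)) w := by
    funext s
    have := S.lie_Q_K (InvVF.gauge lam) (w s)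
    simp only [vert_apply, Pi.add_apply, Pi.neg_apply, QKG.I, GaugeNatural.delta, this]
    abel
  have e2 : vert (lie (N.delta lam)) (vert (lie S.Q) w) =
      vert (lie S.Q) (vert (lie (N.delta lam)) w) := by
    funext s
    exact (S.lie_Q_act (InvVF.gauge lam) (w s)).symm
  rw [e1, e2]
  exact ⟨((h lam).1.lie S.Q).neg.add (h lam).2, (h lam).2.lie S.Q⟩

lemma QKG.isBasic_homotopy {w : Form U F} (h : S.IsBasic w) : S.IsBasic (S.homotopy w) := by
  intro lam
  have e1 : vert (lie (S.I lam)) (S.homotopy w) = -S.homotopy (vert (lie (S.I lam)) w) := by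
    rw [eq_neg_iff_add_eq_zero, QKG.homotopy, vert_horiz, horiz_vert, ← horiz_add]
    funext s
    refine Finset.sum_eq_zero fun μ _ => ?_
    rw [LinearMap.add_apply, LinearMap.comp_apply, LinearMap.comp_apply, QKG.I, S.lie_K_K]
    simp
  -- `[δ_λ, K_μ] = I_{∂_μ λ}`
  have e2 : vert (lie (N.delta lam)) (S.homotopy w) =
      S.homotopy (vert (lie (N.delta lam)) w) +
        horiz (fun μ => lie (S.I fun c => pdx μ (lam c))) w := by
    rw [QKG.homotopy, vert_horiz, horiz_vert, ← horiz_add]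
    refine horiz_congr fun μ s => ?_
    rw [LinearMap.comp_apply, GaugeNatural.delta, S.lie_act_K, autBracket_gauge_partial]
    rfl
  rw [e1, e2]
  exact ⟨((h lam).1.horiz fun _ ν a => lie_totalD _ ν a).neg,
    ((h lam).2.horiz fun _ ν a => lie_totalD _ ν a).add
      (HExact.horiz_of_forall fun μ => (h _).1)⟩

end gauge

section gauge
variable {κ : Type} [Fintype κ] {𝔤 : Type} [LieRing 𝔤] [LieAlgebra ℝ 𝔤]
  {b : Module.Basis κ ℝ 𝔤} {N : GaugeNatural U F b} (S : QKG N)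

/-! ### General `K`-sequences -/

lemma QKG.xIndep_homotopy_pow (p : ℕ) {w : Form U F} (h : XIndep w) :
    XIndep ((S.homotopy ^ p) w) := by
  induction p with
  | zero => exact h
  | succ p ih => rw [pow_succ', Module.End.mul_apply]; exact S.xIndep_homotopy ih

lemma QKG.isBasic_homotopy_pow {S : QKG N} (p : ℕ) {w : Form U F} (h : S.IsBasic w) :
    S.IsBasic ((S.homotopy ^ p) w) := by
  induction p with
  | zero => exact h
  | succ p ih => rw [pow_succ', Module.End.mul_apply]; exact QKG.isBasic_homotopy ih

lemma QKG.homotopy_pow_mem_deg (k : ℕ) {p : ℕ} {q r : ℤ} {w : Form U F}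
    (hw : w ∈ Form.deg U F p q r) : (S.homotopy ^ k) w ∈ Form.deg U F (p + k) q (r - k) := by
  induction k with
  | zero => exact mem_deg_congr hw rfl rfl (by simp)
  | succ k ih =>
    rw [pow_succ', Module.End.mul_apply]
    exact mem_deg_congr (S.homotopy_mem_deg ih) rfl rfl (by push_cast; ring)

/-- The homotopy formula for the powers of `K`. -/
lemma QKG.lie_Q_homotopy_pow (p : ℕ) {w : Form U F} (h : XIndep w) :
    vert (lie S.Q) ((S.homotopy ^ (p + 1)) w) = ((p : ℝ) + 1) • dh ((S.homotopy ^ p) w) +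
      (-1 : ℝ) ^ (p + 1) • (S.homotopy ^ (p + 1)) (vert (lie S.Q) w) := by
  induction p with
  | zero =>
    rw [zero_add, pow_one, pow_one, pow_zero, S.lie_Q_homotopy h, form_neg_smul, one_smul,
      Nat.cast_zero, zero_add, one_smul]
    exact sub_eq_add_neg _ _
  | succ p ih =>
    rw [pow_succ' S.homotopy (p + 1), Module.End.mul_apply,
      S.lie_Q_homotopy (S.xIndep_homotopy_pow (p + 1) h), ih, map_add, map_smul, map_smul,
      S.homotopy_dh, Module.End.mul_apply, ← Module.End.mul_apply S.homotopy (S.homotopy ^ p),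
      ← pow_succ', pow_succ (-1 : ℝ) (p + 1), mul_neg_one, form_neg_smul, smul_neg,
      Nat.cast_succ, add_smul ((p : ℝ) + 1), one_smul]
    abel

/-- The divided power `K^p / p!`. -/
def QKG.dividedPow (p : ℕ) : Form U F →ₗ[ℝ] Form U F :=
  (p.factorial : ℝ)⁻¹ • S.homotopy ^ p

lemma QKG.dividedPow_apply (p : ℕ) (w : Form U F) :
    S.dividedPow p w = (p.factorial : ℝ)⁻¹ • (S.homotopy ^ p) w := rfl

lemma QKG.dividedPow_zero (w : Form U F) : S.dividedPow 0 w = w := by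
  rw [S.dividedPow_apply]; simp

lemma QKG.lie_Q_dividedPow (p : ℕ) {w : Form U F} (h : XIndep w) :
    vert (lie S.Q) (S.dividedPow (p + 1) w) = dh (S.dividedPow p w) +
      (-1 : ℝ) ^ (p + 1) • S.dividedPow (p + 1) (vert (lie S.Q) w) := by
  have hp : ((p + 1).factorial : ℝ)⁻¹ * ((p : ℝ) + 1) = (p.factorial : ℝ)⁻¹ := by
    rw [Nat.factorial_succ]
    push_cast
    field_simp
  simp only [S.dividedPow_apply, map_smul, S.lie_Q_homotopy_pow p h, smul_add, smul_smul, hp]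
  rw [mul_comm ((p + 1).factorial : ℝ)⁻¹]

/-- The member of index `p` of the general `K`-sequence of `V 0` with the forms `V q`, `q ≥ 1`. -/
def QKG.kSum (V : ℕ → Form U F) (p : ℕ) : Form U F :=
  ∑ q ∈ Finset.range (p + 1), S.dividedPow (p - q) (V q)

lemma QKG.kSeq_eq_kSum {V : ℕ → Form U F} {O : Form U F} {W : ℕ → Form U F} (hO : V 0 = O)
    {p : ℕ} (hW : ∀ q, 1 ≤ q → q ≤ p → V q = W q) : S.kSeq O W p = S.kSum V p := by
  have hI : Finset.Icc 1 p = (Finset.range (p + 1)).erase 0 := by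
    ext q
    simp only [Finset.mem_Icc, Finset.mem_erase, Finset.mem_range]
    omega
  rw [QKG.kSum, ← Finset.add_sum_erase _ _ (Finset.mem_range.mpr p.succ_pos), ← hI, QKG.kSeq, hO]
  refine congrArg₂ (· + ·) rfl (Finset.sum_congr rfl fun q hq => ?_)
  obtain ⟨h1, h2⟩ := Finset.mem_Icc.mp hq
  rw [hW q h1 h2]
  rfl

variable {S} in
lemma QKG.isBasic_kSum {V : ℕ → Form U F} {p : ℕ} (h : ∀ q ≤ p, S.IsBasic (V q)) :
    S.IsBasic (S.kSum V p) :=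
  QKG.IsBasic.sum fun q hq =>
    (QKG.isBasic_homotopy_pow _ (h q (Nat.lt_succ_iff.mp (Finset.mem_range.mp hq)))).smul _

lemma QKG.dividedPow_mem_deg {V : ℕ → Form U F} {d : ℕ} {s r : ℤ} {p q : ℕ} (hq : q ≤ p)
    (h : V q ∈ Form.deg U F (d + q) s (r - q)) :
    S.dividedPow (p - q) (V q) ∈ Form.deg U F (d + p) s (r - p) :=
  mem_deg_congr (Submodule.smul_mem _ _ (S.homotopy_pow_mem_deg (p - q) h))
    (by omega) rfl (by rw [Nat.cast_sub hq]; ring)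

lemma QKG.kSum_mem_deg {V : ℕ → Form U F} {d : ℕ} {s r : ℤ} {p : ℕ}
    (h : ∀ q ≤ p, V q ∈ Form.deg U F (d + q) s (r - q)) :
    S.kSum V p ∈ Form.deg U F (d + p) s (r - p) :=
  Submodule.sum_mem _ fun q hq => by
    have hq' := Nat.lt_succ_iff.mp (Finset.mem_range.mp hq)
    exact S.dividedPow_mem_deg hq' (h q hq')

/-- The descent equation of a general `K`-sequence, with the defect due to members that are not
closed. -/
lemma QKG.lie_Q_kSum_succ {V : ℕ → Form U F} {p : ℕ} (h : ∀ q ≤ p + 1, XIndep (V q)) :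
    vert (lie S.Q) (S.kSum V (p + 1)) = dh (S.kSum V p) +
      ∑ q ∈ Finset.range (p + 2),
        (-1 : ℝ) ^ (p + 1 - q) • S.dividedPow (p + 1 - q) (vert (lie S.Q) (V q)) := by
  rw [QKG.kSum, QKG.kSum, Finset.sum_range_succ, Finset.sum_range_succ _ (p + 1), map_add, map_sum,
    map_sum, ← add_assoc, ← Finset.sum_add_distrib]
  congr 1
  · refine Finset.sum_congr rfl fun q hq => ?_
    have hq' := Finset.mem_range.mp hq
    rw [show p + 1 - q = p - q + 1 by omega, S.lie_Q_dividedPow _ (h q hq'.le)]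
  · rw [Nat.sub_self, pow_zero, one_smul, S.dividedPow_zero, S.dividedPow_zero]

/-- The seed of a sequence `δ`: the forms whose general `K`-sequence is `δ`. -/
def QKG.seedOf (δ : ℕ → Form U F) : ℕ → Form U F
  | p => δ p - ∑ q : Fin p, S.dividedPow (p - q) (QKG.seedOf δ q)
termination_by p => p
decreasing_by exact q.2

lemma QKG.seedOf_eq (δ : ℕ → Form U F) (p : ℕ) : S.seedOf δ p =
    δ p - ∑ q ∈ Finset.range p, S.dividedPow (p - q) (S.seedOf δ q) := by
  rw [QKG.seedOf, ← Fin.sum_univ_eq_sum_range (fun q => S.dividedPow (p - q) (S.seedOf δ q))]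

lemma QKG.kSum_seedOf (δ : ℕ → Form U F) (p : ℕ) : S.kSum (S.seedOf δ) p = δ p := by
  rw [QKG.kSum, Finset.sum_range_succ, Nat.sub_self, S.dividedPow_zero, S.seedOf_eq δ p]
  abel

lemma QKG.seedOf_mem_deg {δ : ℕ → Form U F} {d : ℕ} {s r : ℤ} {m : ℕ}
    (h : ∀ p ≤ m, δ p ∈ Form.deg U F (d + p) s (r - p)) :
    ∀ p ≤ m, S.seedOf δ p ∈ Form.deg U F (d + p) s (r - p) := by
  intro p
  induction p using Nat.strong_induction_on with
  | _ p ih =>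
    intro hp
    rw [S.seedOf_eq]
    refine Submodule.sub_mem _ (h p hp) (Submodule.sum_mem _ fun q hq => ?_)
    have hq' := Finset.mem_range.mp hq
    exact S.dividedPow_mem_deg hq'.le (ih q hq' (hq'.le.trans hp))

lemma QKG.xIndep_seedOf {δ : ℕ → Form U F} {m : ℕ} (h : ∀ p ≤ m, XIndep (δ p)) :
    ∀ p ≤ m, XIndep (S.seedOf δ p) := by
  intro p
  induction p using Nat.strong_induction_on with
  | _ p ih =>
    intro hp
    rw [S.seedOf_eq]
    refine (h p hp).sub (XIndep.sum fun q hq => ?_)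
    have hq' := Finset.mem_range.mp hq
    exact (S.xIndep_homotopy_pow _ (ih q hq' (hq'.le.trans hp))).smul _

variable {S} in
lemma QKG.isBasic_seedOf {δ : ℕ → Form U F} {m : ℕ} (h : ∀ p ≤ m, S.IsBasic (δ p)) :
    ∀ p ≤ m, S.IsBasic (S.seedOf δ p) := by
  intro p
  induction p using Nat.strong_induction_on with
  | _ p ih =>
    intro hp
    rw [S.seedOf_eq]
    refine (h p hp).sub (QKG.IsBasic.sum fun q hq => ?_)
    have hq' := Finset.mem_range.mp hq
    exact (QKG.isBasic_homotopy_pow _ (ih q hq' (hq'.le.trans hp))).smul _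

/-- The descent equations for `δ` say that its seed is `Q`-closed. -/
lemma QKG.lie_Q_seedOf {δ : ℕ → Form U F} {m : ℕ} (hx : ∀ p ≤ m, XIndep (δ p))
    (h0 : vert (lie S.Q) (δ 0) = 0)
    (hs : ∀ p, p + 1 ≤ m → vert (lie S.Q) (δ (p + 1)) = dh (δ p)) :
    ∀ p ≤ m, vert (lie S.Q) (S.seedOf δ p) = 0 := by
  intro p
  induction p using Nat.strong_induction_on with
  | _ p ih =>
    intro hp
    cases p with
    | zero => rw [S.seedOf_eq, Finset.sum_range_zero, sub_zero, h0]
    | succ p =>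
      have h1 := S.lie_Q_kSum_succ (V := S.seedOf δ) (p := p)
        fun q hq => S.xIndep_seedOf hx q (hq.trans hp)
      rw [S.kSum_seedOf, S.kSum_seedOf, hs p hp, Finset.sum_range_succ, Finset.sum_eq_zero,
        zero_add, Nat.sub_self, pow_zero, one_smul, S.dividedPow_zero] at h1
      · exact left_eq_add.mp h1
      · intro q hq
        have hq' := Finset.mem_range.mp hq
        rw [ih q hq' (hq'.le.trans hp), map_zero, smul_zero]

/-- A seed that is `Lie_Q`-exact generates a `K`-sequence that is exact for `Lie_Q + d_h`. -/
lemma QKG.kSum_lie_Q {h : ℕ → Form U F} {p : ℕ} (hx : ∀ q ≤ p + 1, XIndep (h q)) :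
    S.kSum (fun q => vert (lie S.Q) (h q)) (p + 1) =
      vert (lie S.Q) ((-1 : ℝ) ^ (p + 1) • S.kSum (fun q => (-1 : ℝ) ^ q • h q) (p + 1)) +
        dh ((-1 : ℝ) ^ p • S.kSum (fun q => (-1 : ℝ) ^ q • h q) p) := by
  have h1 := S.lie_Q_kSum_succ (V := fun q => (-1 : ℝ) ^ q • h q) (p := p)
    fun q hq => (hx q hq).smul _
  have hsq : (-1 : ℝ) ^ (p + 1) * (-1) ^ (p + 1) = 1 := by
    rw [← mul_pow]; simp
  have h2 : ∑ q ∈ Finset.range (p + 2), (-1 : ℝ) ^ (p + 1 - q) •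
      S.dividedPow (p + 1 - q) (vert (lie S.Q) ((-1 : ℝ) ^ q • h q)) =
      (-1 : ℝ) ^ (p + 1) • S.kSum (fun q => vert (lie S.Q) (h q)) (p + 1) := by
    rw [QKG.kSum, Finset.smul_sum]
    refine Finset.sum_congr rfl fun q hq => ?_
    have hq' := Finset.mem_range.mp hq
    rw [map_smul, map_smul, smul_smul, ← pow_add, Nat.sub_add_cancel (by omega)]
  rw [map_smul, h1, h2, smul_add, smul_smul, hsq, one_smul, map_smul, pow_succ, mul_neg_one,
    form_neg_smul]
  abel

/-! ### Extended BV-BFV theories and their differences -/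

lemma lie_eq_contract_dv_form {k : ℤ} (X : VField U F k) {p : ℕ} {r : ℤ} {w : Form U F}
    (hw : w ∈ Form.deg U F p 0 r) : vert (lie X) w = vert (contract X) (vert dv w) := by
  funext s
  have h1 := hw s
  simp only [vert_apply]
  split_ifs at h1
  · exact lie_eq_contract_dv X h1
  · rw [h1]
    simp

variable {S} {m : ℕ}

lemma QKG.fShift_add (f g : ℕ → Form U F) (p : ℕ) :
    S.fShift (fun p => f p + g p) p = S.fShift f p + S.fShift g p := by
  simp only [QKG.fShift, map_add]
  abel

lemma QKG.fShift_sub (f g : ℕ → Form U F) (p : ℕ) :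
    S.fShift (fun p => f p - g p) p = S.fShift f p - S.fShift g p := by
  simp only [QKG.fShift, map_sub]
  abel

lemma QKG.lie_Q_fShift (f : ℕ → Form U F) (p : ℕ) :
    vert (lie S.Q) (S.fShift f p) = dh (S.fShift f (p + 1)) := by
  have h0 : vert (lie S.Q) (vert (lie S.Q) (f p)) = 0 := funext fun s => lie_lie_self S.Q_sq _
  rw [QKG.fShift, QKG.fShift, map_add, map_add, h0, lie_dh, dh_dh, zero_add, add_zero]

lemma IsFSeq.mem_deg {f : ℕ → Form U F} (hf : IsFSeq S m f) (hm : m ≤ n) (p : ℕ) :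
    f p ∈ Form.deg U F (n - p) 0 (p - 1) := by
  by_cases hp : p ≤ n
  · exact hf.deg p hp
  · rw [hf.zero p (by omega)]
    exact Submodule.zero_mem _

lemma IsFSeq.dh_mem_deg {f : ℕ → Form U F} (hf : IsFSeq S m f) (hm : m ≤ n) {p : ℕ}
    (hp : p ≤ n) : dh (f (p + 1)) ∈ Form.deg U F (n - p) 0 p := by
  by_cases hpn : p + 1 ≤ n
  · exact mem_deg_congr (BVBFV.dh_mem_deg (hf.deg (p + 1) hpn)) (by omega) rfl (by push_cast; ring)
  · rw [hf.zero (p + 1) (by omega), map_zero]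
    exact Submodule.zero_mem _

lemma IsFSeq.fShift_mem_deg {f : ℕ → Form U F} (hf : IsFSeq S m f) (hm : m ≤ n) {p : ℕ}
    (hp : p ≤ n) : S.fShift f p ∈ Form.deg U F (n - p) 0 p :=
  Submodule.add_mem _ (mem_deg_congr (lie_mem_deg S.Q (hf.deg p hp)) rfl rfl (by ring))
    (hf.dh_mem_deg hm hp)

lemma IsFSeq.isBasic_fShift {f : ℕ → Form U F} (hf : IsFSeq S m f) (p : ℕ) :
    S.IsBasic (S.fShift f p) :=
  (QKG.isBasic_lie_Q (hf.basic p)).add (QKG.isBasic_dh _)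

lemma IsFSeq.fShift_eq_zero {f : ℕ → Form U F} (hf : IsFSeq S m f) {p : ℕ} (hp : m < p) :
    S.fShift f p = 0 := by
  rw [QKG.fShift, hf.zero p hp, hf.zero (p + 1) (by omega), map_zero, map_zero, add_zero]

lemma IsFSeq.add {f g : ℕ → Form U F} (hf : IsFSeq S m f) (hg : IsFSeq S m g) :
    IsFSeq S m fun p => f p + g p where
  deg p hp := Submodule.add_mem _ (hf.deg p hp) (hg.deg p hp)
  zero p hp := by rw [hf.zero p hp, hg.zero p hp, add_zero]
  basic p := (hf.basic p).add (hg.basic p)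

lemma IsFSeq.sub {f g : ℕ → Form U F} (hf : IsFSeq S m f) (hg : IsFSeq S m g) :
    IsFSeq S m fun p => f p - g p where
  deg p hp := Submodule.sub_mem _ (hf.deg p hp) (hg.deg p hp)
  zero p hp := by rw [hf.zero p hp, hg.zero p hp, sub_zero]
  basic p := (hf.basic p).sub (hg.basic p)

section theory
variable (T : CohLGFTType S m)

lemma CohLGFTType.pull_lie_Q (w : Form U F) :
    pull F.ctHom (vert (lie S.Q) w) = vert (lie T.QBV) (pull F.ctHom w) :=
  funext fun s => pullAlg_lie ctHom_injective T.QBV_inl (w s)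

/-- An `f`-transformation shifts the difference by a `(Lie_Q + d_h)`-exact term. -/
lemma CohLGFTType.difference_f (hm : m ≤ n) {f : ℕ → Form U F} (hf : IsFSeq S m f) (p : ℕ) :
    difference T.QBV (fL f T.L) (fγ f T.γ) p =
      difference T.QBV T.L T.γ p + pull F.ctHom (S.fShift f p) := by
  rw [QKG.fShift, map_add, T.pull_lie_Q, pull_dh ctHom_injective,
    lie_eq_contract_dv_form T.QBV (pull_mem_deg F.ctHom (hf.mem_deg hm p))]
  simp only [difference, fL, fγ, map_sub]
  abel

lemma vert_dv_dv (w : Form U F) : vert dv (vert dv w) = 0 := funext fun _ => dv_dv _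

lemma dv_fγ (f : ℕ → Form U F) (γ : ℕ → Form U F.ct) (p : ℕ) :
    vert dv (fγ f γ p) = vert dv (γ p) := by
  rw [fγ, map_sub, vert_dv_dv, sub_zero]

lemma CohLGFTType.isExtendedBVBFV_f (hm : m ≤ n) {f : ℕ → Form U F} (hf : IsFSeq S m f) :
    IsExtendedBVBFV m T.QBV (fL f T.L) (fγ f T.γ) where
  Q_sq := T.extended.Q_sq
  noether := by
    rw [IsNoether, fL, map_add]
    exact HExact.add T.extended.noether ⟨_, lie_dh _ _⟩
  symplectic := by
    rw [dv_fγ]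
    exact T.extended.symplectic
  L_deg p hp := by
    refine Submodule.add_mem _ (T.extended.L_deg p hp) ?_
    rw [← pull_dh ctHom_injective]
    exact pull_mem_deg _ (hf.dh_mem_deg hm hp)
  L_zero p hp := by
    rw [fL, T.extended.L_zero p hp, hf.zero (p + 1) (by omega), map_zero, map_zero, add_zero]
  γ_deg p hp := by
    refine Submodule.sub_mem _ (T.extended.γ_deg p hp) ?_
    exact mem_deg_congr (vert_mem_deg (fun _ => dv_mem_bideg)
      (pull_mem_deg F.ctHom (hf.deg p hp))) rfl (zero_add 1) rfl
  γ_zero p hp := by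
    rw [fγ, T.extended.γ_zero p hp, hf.zero p hp, map_zero, map_zero, sub_zero]
  ascent p hp := by
    rw [dv_fγ, dv_fγ]
    exact T.extended.ascent p hp
  hamilton p hp := by
    rw [dv_fγ, T.extended.hamilton p hp, fL, fγ, map_add, map_sub, dv_dh]
    abel

/-- The vertical differential of the difference, from Cartan's formula and the structure
equations. -/
lemma CohLGFTType.dv_difference (hm : m ≤ n) (p : ℕ) :
    vert dv (difference T.QBV T.L T.γ p) =
      vert (lie T.QBV) (T.γ p) - dh (T.γ (p + 1)) := by
  by_cases hp : p ≤ n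
  · have h := T.extended.hamilton p hp
    have hl : vert (lie T.QBV) (T.γ p) =
        vert (contract T.QBV) (vert dv (T.γ p)) - vert dv (vert (contract T.QBV) (T.γ p)) := by
      funext s
      simp only [vert_apply, Pi.sub_apply, lie_apply, sg_one, alg_neg_smul, one_smul]
      exact (sub_eq_add_neg _ _).symm
    rw [hl, h, difference, map_sub]
    abel
  · rw [difference, T.extended.L_zero p (by omega), T.extended.γ_zero p (by omega),
      T.extended.γ_zero (p + 1) (by omega)]
    simp only [map_zero, sub_zero]

lemma CohLGFTType.difference_eq_zero (hm : m ≤ n) {p : ℕ} (hp : m < p) :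
    difference T.QBV T.L T.γ p = 0 := by
  by_cases hpn : p ≤ n
  · have hdeg := T.extended.L_deg p hpn
    have h := T.dv_difference hm p
    rw [difference, T.extended.γ_zero p hp, T.extended.γ_zero (p + 1) (by omega), map_zero,
      map_zero, map_zero, sub_zero, sub_zero] at h
    rw [difference, T.extended.γ_zero p hp, map_zero, sub_zero]
    exact Form.eq_zero_of_dv_eq_zero (by omega) hdeg h
  · rw [difference, T.extended.L_zero p (by omega), T.extended.γ_zero p hp, map_zero, sub_zero]

lemma CohLGFTType.Δ_eq_zero (hm : m ≤ n) {p : ℕ} (hp : m < p) : T.Δ p = 0 :=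
  pull_injective ctHom_injective (by rw [T.Δ_eq, T.difference_eq_zero hm hp, map_zero])

/-- The descent equations for the difference: both sides have the same vertical differential and
positive ghost number. -/
lemma CohLGFTType.descent (hm : m ≤ n) {p : ℕ} (hp : p ≤ n) :
    vert (lie S.Q) (T.Δ p) = dh (T.Δ (p + 1)) := by
  have hdeg : vert (lie S.Q) (T.Δ p) - dh (T.Δ (p + 1)) ∈ Form.deg U F (n - p) 0 (p + 1) := by
    refine Submodule.sub_mem _ (lie_mem_deg S.Q (T.Δ_deg p hp)) ?_
    by_cases hpn : p + 1 ≤ n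
    · exact mem_deg_congr (dh_mem_deg (T.Δ_deg (p + 1) hpn)) (by omega) rfl (by push_cast; ring)
    · rw [T.Δ_eq_zero hm (by omega), map_zero]
      exact Submodule.zero_mem _
  have hQ2 : ∀ w, vert (lie T.QBV) (vert (lie T.QBV) w) = 0 := fun w =>
    funext fun s => lie_lie_self T.extended.Q_sq (w s)
  have hdvQ : ∀ w, vert dv (vert (lie T.QBV) w) = -vert (lie T.QBV) (vert dv w) := fun w =>
    funext fun s => by
      rw [Pi.neg_apply, vert_apply, vert_apply, vert_apply, vert_apply, lie_dv, sg_one,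
        alg_neg_smul, one_smul, neg_neg]
  refine sub_eq_zero.mp (pull_injective ctHom_injective ?_)
  rw [map_zero]
  refine Form.eq_zero_of_dv_eq_zero (by omega) (pull_mem_deg F.ctHom hdeg) ?_
  rw [map_sub, T.pull_lie_Q, pull_dh ctHom_injective, T.Δ_eq, T.Δ_eq, map_sub, hdvQ,
    T.dv_difference hm, dv_dh, T.dv_difference hm, map_sub, map_sub, hQ2, lie_dh, dh_dh]
  abel

/-- The `f`-transformation that makes the difference invariant already turns it into a general
`K`-sequence. -/
lemma CohLGFTType.exists_represents (hm : m ≤ n) (hT : T.IsInvariant) :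
    ∃ W f : ℕ → Form U F, T.Represents W f := by
  obtain ⟨hx, f, hf, hfm, hinv⟩ := hT
  set δ : ℕ → Form U F := fun p => T.Δ (m - p) + S.fShift f (m - p) with hδ
  have hδ0 : δ 0 = T.Δ m := by
    simp only [hδ, Nat.sub_zero, hfm, add_zero]
  have hδx : ∀ p ≤ m, XIndep (δ p) := fun p _ => hinv _ (Nat.sub_le m p)
  have hδb : ∀ p ≤ m, S.IsBasic (δ p) := fun p _ => (T.basic _).add (hf.isBasic_fShift _)
  have hδdeg : ∀ p ≤ m, δ p ∈ Form.deg U F (n - m + p) 0 ((m : ℤ) - p) := fun p hp =>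
    mem_deg_congr (Submodule.add_mem _ (T.Δ_deg (m - p) (by omega))
      (hf.fShift_mem_deg hm (by omega))) (by omega) rfl (by omega)
  have hδQ : ∀ p, p + 1 ≤ m → vert (lie S.Q) (δ (p + 1)) = dh (δ p) := fun p hp => by
    simp only [hδ]
    rw [map_add, T.descent hm (by omega), QKG.lie_Q_fShift,
      show m - (p + 1) + 1 = m - p by omega, map_add]
  have hδQ0 : vert (lie S.Q) (δ 0) = 0 := by
    rw [hδ0, T.descent hm hm, T.Δ_eq_zero hm m.lt_succ_self, map_zero]
  refine ⟨S.seedOf δ, f, ⟨⟨?_, ?_, ?_, ?_⟩, hf, hx, fun p hp => ?_⟩⟩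
  · exact fun q _ hq => S.seedOf_mem_deg hδdeg q hq
  · exact fun q _ hq => S.lie_Q_seedOf hδx hδQ0 hδQ q hq
  · exact fun q _ hq => S.xIndep_seedOf hδx q hq
  · exact fun q _ hq => QKG.isBasic_seedOf hδb q hq
  · rw [S.kSeq_eq_kSum (V := S.seedOf δ) (by rw [S.seedOf_eq, Finset.sum_range_zero, sub_zero, hδ0])
      (fun _ _ _ => rfl), S.kSum_seedOf, T.difference_f hm hf, ← T.Δ_eq, ← map_add]

variable {T} in
lemma CohLGFTType.Represents.Δ_add_fShift (hm : m ≤ n) {W f : ℕ → Form U F}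
    (h : T.Represents W f) {p : ℕ} (hp : p ≤ m) :
    T.Δ (m - p) + S.fShift f (m - p) = S.kSeq (T.Δ m) W p :=
  pull_injective ctHom_injective (by
    rw [map_add, T.Δ_eq, ← T.difference_f hm h.fSeq, h.eq p hp])

end theory

/-- Seeds that differ by `Lie_Q`-exact terms generate `K`-sequences that differ by the shift of an
`f`-transformation. -/
lemma QKG.Cohomologous.exists_fSeq (hm : m ≤ n) {O O' : Form U F} {W W' : ℕ → Form U F}
    (h : S.Cohomologous m O W O' W') : ∃ g : ℕ → Form U F, IsFSeq S m g ∧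
      ∀ p ≤ m, S.kSeq O' W' p = S.kSeq O W p + S.fShift g (m - p) := by
  obtain ⟨h, hh, hO, hW⟩ := h
  -- the `f`-transformation read off from `QKG.kSum_lie_Q`, indexed from the bottom
  set G : ℕ → Form U F := fun p => (-1 : ℝ) ^ p • S.kSum (fun q => (-1 : ℝ) ^ q • h q) p with hG
  have hGdeg : ∀ p ≤ m, G p ∈ Form.deg U F (n - m + p) 0 ((m : ℤ) - 1 - p) := fun p hp =>
    Submodule.smul_mem _ _ (S.kSum_mem_deg fun q hq => Submodule.smul_mem _ _
      (mem_deg_congr (hh q (hq.trans hp)).1 rfl rfl (by ring)))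
  refine ⟨fun p => if p ≤ m then G (m - p) else 0, ⟨fun p hp => ?_, fun p hp => ?_, fun p => ?_⟩,
    fun p hp => ?_⟩
  · by_cases hpm : p ≤ m
    · rw [if_pos hpm]
      exact mem_deg_congr (hGdeg (m - p) (Nat.sub_le m p)) (by omega) rfl (by omega)
    · rw [if_neg hpm]
      exact Submodule.zero_mem _
  · rw [if_neg (by omega)]
  · split_ifs with hpm
    · exact (QKG.isBasic_kSum fun q hq => ((hh q (by omega)).2.2.smul _)).smul _
    · exact QKG.IsBasic.zero
  · have hsum : S.kSeq O' W' p = S.kSeq O W p + S.kSum (fun q => vert (lie S.Q) (h q)) p := by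
      rw [S.kSeq_eq_kSum (V := fun q => (if q = 0 then O else W q) + vert (lie S.Q) (h q)) (O := O')
          (W := W') (by rw [if_pos rfl, hO])
          (fun q h1 h2 => by rw [if_neg (by omega), hW q h1 (h2.trans hp)]),
        S.kSeq_eq_kSum (V := fun q => if q = 0 then O else W q) (if_pos rfl)
          (fun q h1 _ => if_neg (by omega)), QKG.kSum, QKG.kSum, QKG.kSum,
        ← Finset.sum_add_distrib]
      simp only [map_add]
    rw [hsum]
    congr 1
    rw [QKG.fShift, if_pos (Nat.sub_le m p), Nat.sub_sub_self hp]
    cases p with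
    | zero =>
      rw [if_neg (by omega), map_zero, add_zero]
      simp only [hG, QKG.kSum, zero_add, Finset.sum_range_one, Nat.sub_self, pow_zero, one_smul,
        S.dividedPow_zero]
    | succ p =>
      rw [if_pos (by omega), show m - (m - (p + 1) + 1) = p by omega]
      exact S.kSum_lie_Q fun q hq => (hh q (hq.trans hp)).2.1

end gauge

end BVBFV

end

theorem mainTheorem3 {n : ℕ} (U : TopologicalSpace.Opens (Fin n → ℝ)) (F : BVBFV.Fields)
    {κ : Type} [Fintype κ] {𝔤 : Type} [LieRing 𝔤] [LieAlgebra ℝ 𝔤] (b : Module.Basis κ ℝ 𝔤)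
    (N : BVBFV.GaugeNatural U F b) (S : BVBFV.QKG N) (m : ℕ) (hm : m ≤ n)
    (T : BVBFV.CohLGFTType S m) :
    -- an `f`-transformation gives an `m`-extended theory and shifts the difference
    (∀ f : ℕ → BVBFV.Form U F, BVBFV.IsFSeq S m f →
      BVBFV.IsExtendedBVBFV m T.QBV (BVBFV.fL f T.L) (BVBFV.fγ f T.γ) ∧
      ∀ p, BVBFV.difference T.QBV (BVBFV.fL f T.L) (BVBFV.fγ f T.γ) p =
        BVBFV.difference T.QBV T.L T.γ p + BVBFV.pull F.ctHom (S.fShift f p)) ∧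
    -- up to an `f`-transformation, the difference is a general `K`-sequence of `Δ^(m)`
    (T.IsInvariant → ∃ W f : ℕ → BVBFV.Form U F, T.Represents W f) ∧
    -- the `K`-sequence determines the difference up to an `f`-transformation
    (∀ (T' : BVBFV.CohLGFTType S m) (W f W' f' : ℕ → BVBFV.Form U F),
      T.Represents W f → T'.Represents W' f' → S.Cohomologous m (T.Δ m) W (T'.Δ m) W' →
      ∃ f'' : ℕ → BVBFV.Form U F, BVBFV.IsFSeq S m f'' ∧
        ∀ p, BVBFV.difference T'.QBV T'.L T'.γ p =
          BVBFV.difference T.QBV (BVBFV.fL f'' T.L) (BVBFV.fγ f'' T.γ) p) := by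
  refine ⟨fun f hf => ⟨T.isExtendedBVBFV_f hm hf, T.difference_f hm hf⟩, T.exists_represents hm,
    fun T' W f W' f' hW hW' hcoh => ?_⟩
  obtain ⟨g, hg, hshift⟩ := hcoh.exists_fSeq hm
  -- `f` and the inverse of `f'` lead to the `K`-sequences, whose difference is the shift by `g`
  have hf'' := (hW.fSeq.add hg).sub hW'.fSeq
  refine ⟨_, hf'', fun p => ?_⟩
  rw [T.difference_f hm hf'']
  by_cases hp : p ≤ m
  · have h1 := hW.Δ_add_fShift hm (Nat.sub_le m p)
    have h2 := hW'.Δ_add_fShift hm (Nat.sub_le m p)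
    rw [hshift _ (Nat.sub_le m p), ← h1, Nat.sub_sub_self hp] at h2
    rw [← T'.Δ_eq, ← T.Δ_eq, ← map_add, BVBFV.QKG.fShift_sub, BVBFV.QKG.fShift_add,
      eq_sub_of_add_eq h2]
    congr 1
    abel
  · rw [T.difference_eq_zero hm (by omega), T'.difference_eq_zero hm (by omega),
      hf''.fShift_eq_zero (by omega), map_zero, add_zero]
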